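/- **Setting.** Fix an integer $d \ge 2$. A *weight law* is a Borel probability measure $\mathcal W$ on $\mathbb R$ all of whose moments $\mu_{\mathcal W}(k) = \int x^k \, d\mathcal W(x)$ are finite. For a simple $d$-regular graph $G$ on $N$ vertices, put independent weights of law $\mathcal W$ on the edges of $G$ (that is, replace the symmetric pairs of nonzero entries of the adjacency matrix by independent random variables of law $\mathcal W$), and let $\nu_{G,\mathcal W}$ be the average over the weights of the uniform measure $\frac1N\sum_{j=1}^N \delta_{\lambda_j}$ on the eigenvalues $\lambda_1,\dots,\lambda_N$ (with multiplicity) of the resulting real symmetric matrix. Write $T_d\mathcal W = \nu$ if $\nu_{G_i,\mathcal W} \to \nu$ weakly for every sequence $(G_i)$ of simple $d$-regular graphs with $|G_i| \to \infty$ such that, for each $k \ge 3$, the number of cycles of length $k$ in $G_i$ is $o(|G_i|)$. For $\lambda > 0$ and a measure $\nu$ on $\mathbb R$ let $\nu^{(\lambda)}(A) = \nu(\lambda A)$. A weight law $\mathcal W$ is an *eigendistribution* of $T_d$ if $T_d\mathcal W = \mathcal W^{(\lambda)}$ for some $\lambda > 0$. Let $c_m$ be the $m$-th moment of the semicircle distribution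 with density $\frac2\pi\sqrt{1-x^2}$ on $[-1,1]$, which has second moment $1/4$. **Theorem.** For each integer $d \ge 2$ there is a unique eigendistribution $\mathcal W_d$ of $T_d$ with second moment equal to $1/4$. For all integers $k \ge 0$ we have $\mu_{\mathcal W_d}(2k+1) = 0$ and $$\mu_{\mathcal W_d}(2k) = c_{2k} + O(1/d^2),$$ where the implied constant depends only on $k$. Moreover $\mu_{\mathcal W_d}(2) = 1/4 = c_2$, $\mu_{\mathcal W_d}(4) = 1/8 = c_4$ and $\mu_{\mathcal W_d}(6) = 5/64 = c_6$, but $$\mu_{\mathcal W_d}(8) = \frac{7}{128} + \frac{1}{128(d^2+d+1)},$$ which differs from $c_8 = 7/128$; in particular $\mathcal W_d$ is not the semicircle distribution. -/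

import Mathlib

open MeasureTheory ProbabilityTheory Filter Topology
open scoped BoundedContinuousFunction

noncomputable section

namespace RegularSpectra

open Classical in
/-- The adjacency matrix of the graph `G` with the edge `{i, j}` carrying the weight `w s(i, j)`.
(Unordered pairs index the entries of a real symmetric weight matrix; the weights of pairs that
are not edges play no role.) -/
def weightedAdjMatrix {N : ℕ} (G : SimpleGraph (Fin N)) (w : Sym2 (Fin N) → ℝ) :
    Matrix (Fin N) (Fin N) ℝ :=
  Matrix.of fun i j => if G.Adj i j then w s(i, j) else 0

theorem weightedAdjMatrix_isHermitian {N : ℕ} (G : SimpleGraph (Fin N))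
    (w : Sym2 (Fin N) → ℝ) : (weightedAdjMatrix G w).IsHermitian := by
  ext i j
  by_cases h : G.Adj i j
  · simp [weightedAdjMatrix, h, h.symm, Sym2.eq_swap (a := i) (b := j)]
  · have h' : ¬ G.Adj j i := fun hh => h hh.symm
    simp [weightedAdjMatrix, h, h']

/-- The spectral measure of the weighted graph: the uniform measure `(1/N) ∑ δ_{λ_j}` on the
eigenvalues of the weighted adjacency matrix, counted with multiplicity. -/
def spectralMeasure {N : ℕ} (G : SimpleGraph (Fin N)) (w : Sym2 (Fin N) → ℝ) : Measure ℝ :=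
  (N : ENNReal)⁻¹ •
    ∑ j : Fin N, Measure.dirac ((weightedAdjMatrix_isHermitian G w).eigenvalues j)

/-- The number of cycles of length `k` in `G`, i.e. the number of subgraphs of `G` that are
cycles with `k` vertices (used for `k ≥ 3` only). -/
def cycleCount {N : ℕ} (k : ℕ) (G : SimpleGraph (Fin N)) : ℕ :=
  G.copyCount (SimpleGraph.cycleGraph k)

open Classical in
/-- `G i` is a sequence of simple `d`-regular graphs on `N i` vertices, with `N i → ∞` and, for
every `k ≥ 3`, only `o(N i)` cycles of length `k`. -/
structure IsLocallyTreelike (d : ℕ) (N : ℕ → ℕ) (G : ∀ i, SimpleGraph (Fin (N i))) : Prop where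
  regular : ∀ i, (G i).IsRegularOfDegree d
  size : Tendsto N atTop atTop
  cycles : ∀ k, 3 ≤ k →
    (fun i => (cycleCount k (G i) : ℝ)) =o[atTop] (fun i => (N i : ℝ))

/-- `T_d W = ν`: for every sequence of `d`-regular graphs as above, the spectral measures of the
graphs with independent weights of law `W` on the edges, averaged over the weights, converge
weakly to `ν`. The average of a random measure is given by its values on test functions: the
inner integral is `(1/N) ∑ f(λ_j)`, the outer one is the expectation over the weights. -/
def IsLimitingSpectralLaw (d : ℕ) (W ν : Measure ℝ) : Prop :=
  ∀ (N : ℕ → ℕ) (G : ∀ i, SimpleGraph (Fin (N i))), IsLocallyTreelike d N G →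
    ∀ f : ℝ →ᵇ ℝ,
      Tendsto
        (fun i => ∫ w, (∫ x, f x ∂(spectralMeasure (G i) w))
          ∂(Measure.pi fun _ : Sym2 (Fin (N i)) => W))
        atTop (𝓝 (∫ x, f x ∂ν))

/-- The rescaled measure `A ↦ ν (r A)`, for `r > 0`. -/
def rescale (r : ℝ) (ν : Measure ℝ) : Measure ℝ :=
  ν.map fun x => x / r

/-- A weight distribution: a probability measure on the line with finite moments of all orders. -/
structure IsWeightLaw (W : Measure ℝ) : Prop where
  prob : IsProbabilityMeasure W
  finite_moments : ∀ k : ℕ, Integrable (fun x : ℝ => x ^ k) W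

/-- `W` is an eigendistribution of `T_d`: it is a weight distribution, and `T_d W` is a rescaling
of `W`. -/
def IsEigendistribution (d : ℕ) (W : Measure ℝ) : Prop :=
  IsWeightLaw W ∧ ∃ r : ℝ, 0 < r ∧ IsLimitingSpectralLaw d W (rescale r W)

/-- The semicircle distribution of variance `1/4`, with density `(2/π) √(1 - x²)` on `[-1, 1]`
(`Real.sqrt` vanishes at negative numbers, so the density is `0` elsewhere). -/
def semicircle : Measure ℝ :=
  volume.withDensity fun x => ENNReal.ofReal (2 / Real.pi * Real.sqrt (1 - x ^ 2))

/-- The `k`-th moment `∫ x ^ k` of a measure on the line. -/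
def mom (W : Measure ℝ) (k : ℕ) : ℝ := ∫ x, x ^ k ∂W

end RegularSpectra

end

/-! The proof is the method of moments on a tree. Only o(N) vertices of a locally treelike graph lie
near a short cycle, so the moments of the averaged spectral measure converge to the expected
weighted numbers of closed walks at the root of the d-regular tree. Odd ones vanish, since a tree is
bipartite. If an edge of weight w joins a root with closed-walk series P to a root with series Q,
the new series satisfies F = P + x²w²PQF. Hence F^m is the sum over j of multichoose(m, j) w^(2j)
x^(2j) P^(m+j) Q^j. The weights are independent, so expectations turn this into a linear recursion
for the expected coefficients of all powers at once (`step`, `treeCoeff`,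
`polyExp_coeff_walkSeries`). All powers are needed because different powers of the same series are
dependent.

With second moment 1/4, comparing second moments forces the scale 1/√d, and the even moments a_k of
an eigendistribution must satisfy d^k a_k = `treeCoeff a d k d 1 k`. The unknown a_k enters the
right side only as d·a_k (`treeCoeff_top`). For k ≥ 2 it is therefore determined by the lower
moments, which gives the sequence `fixedSeq`; expanding to order four gives the explicit values.

That `fixedSeq` comes from a measure follows by iterating the rescaled T_d from a point mass. The
k-th even moment contracts by d^(1-k) up to lower moments, so all moments converge, and Prokhorov's
theorem gives a limit. The bound (k!)² (8d²)^(k-1) on `fixedSeq` (`treeCoeff_le`, `fixedSeq_le`)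
makes the exponential moments finite near 0. The moments then determine the measure, which yields
both uniqueness and weak convergence of the spectral measures. Uniqueness also needs one locally
treelike sequence to exist; Cayley graphs of permutation groups of reduced words provide it.

For the asymptotics, put ε = 1/d and compute modulo ε² in the ring of bounded sequences in d. After
scaling, the 2j-th moment carries ε^(j-1), so only the second and fourth survive, and the latter is
2ε(1/4)². At order ε, the loss from the binomial coefficients (distinct children, and one child
fewer below the root) is balanced by the walks using one edge twice as often. The root series
satisfies F = 1 + xF²/4 exactly (`root_series_eq`), whose coefficients are the semicircle moments.
-/

namespace RegularSpectra

/-! ### The recursion for closed walks on a random weighted tree -/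

section Recursion

open Finset

variable {R S : Type*} [CommRing R] [CommRing S]

/-- The coefficients of the constant power series `1`, for every exponent. -/
def unitArray (R : Type*) [CommRing R] : ℕ → ℕ → R := fun _ k => if k = 0 then 1 else 0

/-- The change in the coefficients of the powers of the generating function of the closed walks at
the root of a weighted tree when a new edge at the root, leading to a tree with coefficients `g`,
is added; `a j` is the moment of order `2 * j` of the weights. -/
def step (a : ℕ → R) (g : ℕ → ℕ → R) : (ℕ → ℕ → R) →ₗ[R] (ℕ → ℕ → R) where
  toFun F := fun m k => ∑ j ∈ range k, (m.multichoose (j + 1) : R) * a (j + 1) *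
    ∑ p ∈ antidiagonal (k - (j + 1)), F (m + (j + 1)) p.1 * g (j + 1) p.2
  map_add' F G := by
    ext m k
    simp [add_mul, mul_add, sum_add_distrib]
  map_smul' c F := by
    ext m k
    simp only [Pi.smul_apply, smul_eq_mul, RingHom.id_apply, mul_sum]
    refine sum_congr rfl fun j _ => sum_congr rfl fun p _ => by ring

theorem step_apply (a : ℕ → R) (g F : ℕ → ℕ → R) (m k : ℕ) :
    step a g F m k = ∑ j ∈ range k, (m.multichoose (j + 1) : R) * a (j + 1) *
      ∑ p ∈ antidiagonal (k - (j + 1)), F (m + (j + 1)) p.1 * g (j + 1) p.2 := rfl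

/-- The coefficients for a root with `D` children, each carrying a tree with coefficients `g`. -/
def layer (a : ℕ → R) (g : ℕ → ℕ → R) (D : ℕ) : ℕ → ℕ → R :=
  ((1 + step a g) ^ D) (unitArray R)

/-- `treeCoeff a d h D m k` is the expected coefficient of order `2 * k` of the `m`-th power of the
generating function of closed walks at the root of a tree of height `h`, where the root has `D`
children and every other inner vertex has `d - 1` children. -/
def treeCoeff (a : ℕ → R) (d : ℕ) : ℕ → ℕ → ℕ → ℕ → R
  | 0 => fun _ => unitArray R
  | h + 1 => layer a (treeCoeff a d h (d - 1))

theorem layer_zero (a : ℕ → R) (g : ℕ → ℕ → R) : layer a g 0 = unitArray R := by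
  simp [layer]

theorem layer_succ (a : ℕ → R) (g : ℕ → ℕ → R) (D m k : ℕ) :
    layer a g (D + 1) m k = layer a g D m k + step a g (layer a g D) m k := by
  simp [layer, pow_succ']

theorem layer_order_zero (a : ℕ → R) (g : ℕ → ℕ → R) (D m : ℕ) : layer a g D m 0 = 1 := by
  induction D generalizing m with
  | zero => simp [layer_zero, unitArray]
  | succ D ih => simp [layer_succ, ih, step_apply]

theorem treeCoeff_order_zero (a : ℕ → R) (d h D m : ℕ) : treeCoeff a d h D m 0 = 1 := by
  cases h with
  | zero => simp [treeCoeff, unitArray]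
  | succ h => exact layer_order_zero _ _ _ _

theorem treeCoeff_root_zero (a : ℕ → R) (d h m k : ℕ) :
    treeCoeff a d h 0 m k = if k = 0 then 1 else 0 := by
  cases h with
  | zero => rfl
  | succ h => simp [treeCoeff, layer_zero, unitArray]

theorem treeCoeff_succ (a : ℕ → R) (d h D m k : ℕ) :
    treeCoeff a d (h + 1) (D + 1) m k = treeCoeff a d (h + 1) D m k +
      step a (treeCoeff a d h (d - 1)) (treeCoeff a d (h + 1) D) m k :=
  layer_succ _ _ _ _ _

theorem step_congr {a a' : ℕ → R} {g g' F F' : ℕ → ℕ → R} {k : ℕ}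
    (ha : ∀ j, 1 ≤ j → j ≤ k → a j = a' j) (hg : ∀ j l, l < k → g j l = g' j l)
    (hF : ∀ m l, l < k → F m l = F' m l) (m : ℕ) : step a g F m k = step a' g' F' m k := by
  simp only [step_apply]
  refine sum_congr rfl fun j hj => ?_
  rw [mem_range] at hj
  rw [ha (j + 1) (by omega) (by omega)]
  congr 1
  refine sum_congr rfl fun p hp => ?_
  have := mem_antidiagonal.1 hp
  rw [hF _ _ (by omega), hg _ _ (by omega)]

theorem layer_congr {a a' : ℕ → R} {g g' : ℕ → ℕ → R} {k : ℕ}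
    (ha : ∀ j, 1 ≤ j → j ≤ k → a j = a' j) (hg : ∀ j l, l < k → g j l = g' j l) (D m : ℕ) :
    layer a g D m k = layer a' g' D m k := by
  induction D generalizing m k with
  | zero => simp [layer_zero]
  | succ D ih =>
    rw [layer_succ, layer_succ, ih ha hg]
    congr 1
    exact step_congr ha hg (fun m l hl => ih (fun j h1 h2 => ha j h1 (by omega))
      (fun j i hi => hg j i (by omega)) m) m

/-- A closed walk of length 2k descends at most k levels and crosses an edge at most 2k times.
Heights beyond k and moments beyond a k are therefore invisible at order k. -/
theorem treeCoeff_congr {a a' : ℕ → R} {d h h' k : ℕ} (ha : ∀ j, 1 ≤ j → j ≤ k → a j = a' j)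
    (hk : k ≤ h) (hk' : k ≤ h') (D m : ℕ) :
    treeCoeff a d h D m k = treeCoeff a' d h' D m k := by
  induction h generalizing h' k D m with
  | zero =>
    obtain rfl : k = 0 := by omega
    simp [treeCoeff_order_zero]
  | succ h ih =>
    cases h' with
    | zero =>
      obtain rfl : k = 0 := by omega
      simp [treeCoeff_order_zero]
    | succ h' =>
      exact layer_congr ha (fun j l hl => ih (fun i h1 h2 => ha i h1 (by omega)) (by omega)
        (by omega) _ _) _ _

/-- The dependence on the moment of highest order comes from the walks along a single edge. -/
theorem treeCoeff_top {a a' : ℕ → R} {d h k : ℕ} (hk0 : 1 ≤ k) (hk : k ≤ h)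
    (ha : ∀ j, 1 ≤ j → j < k → a j = a' j) (ha' : a' k = 0) (D m : ℕ) :
    treeCoeff a d h D m k = D * m.multichoose k * a k + treeCoeff a' d h D m k := by
  obtain ⟨h, rfl⟩ : ∃ i, h = i + 1 := ⟨h - 1, by omega⟩
  obtain ⟨k, rfl⟩ : ∃ i, k = i + 1 := ⟨k - 1, by omega⟩
  induction D generalizing m with
  | zero => simp [treeCoeff_root_zero]
  | succ D ih =>
    rw [treeCoeff_succ, treeCoeff_succ, ih]
    -- The last summand of `step` leaves order 0 to both factors, which are then 1. The other
    -- summands only see orders at which `a` and `a'` agree.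
    have key : step a (treeCoeff a d h (d - 1)) (treeCoeff a d (h + 1) D) m (k + 1) =
        m.multichoose (k + 1) * a (k + 1) +
          step a' (treeCoeff a' d h (d - 1)) (treeCoeff a' d (h + 1) D) m (k + 1) := by
      simp only [step_apply, sum_range_succ _ k, ha', mul_zero, add_zero, Nat.sub_self,
        Finset.Nat.antidiagonal_zero, sum_singleton, treeCoeff_order_zero, mul_one]
      rw [add_comm]
      congr 1
      refine sum_congr rfl fun j hj => ?_
      rw [mem_range] at hj
      rw [ha (j + 1) (by omega) (by omega)]
      congr 1
      refine sum_congr rfl fun p hp => ?_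
      have := mem_antidiagonal.1 hp
      rw [treeCoeff_congr (a' := a') (h' := h + 1) (fun i h1 h2 => ha i h1 (by omega)) (by omega)
        (by omega), treeCoeff_congr (a' := a') (h' := h) (k := p.2)
        (fun i h1 h2 => ha i h1 (by omega)) (by omega) (by omega)]
    rw [key]
    push_cast
    ring

theorem step_pow_eq_zero (a : ℕ → R) (g : ℕ → ℕ → R) {r k : ℕ} (h : k < r) (m : ℕ) :
    ((step a g) ^ r) (unitArray R) m k = 0 := by
  induction r generalizing k m with
  | zero => omega
  | succ r ih =>
    rw [pow_succ', Module.End.mul_apply, step_apply]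
    refine sum_eq_zero fun j hj => ?_
    rw [mem_range] at hj
    rw [sum_eq_zero, mul_zero]
    intro p hp
    have := mem_antidiagonal.1 hp
    rw [ih (by omega), zero_mul]

/-- Binomial expansion of (1 + step)^D, where r is the number of root edges actually used. The
degree then enters only through `D.choose r`, which is what the asymptotics in d exploit. Terms with
r > k vanish since each `step` raises the order, terms with r > D since the binomial coefficient is
0. -/
theorem layer_eq_sum (a : ℕ → R) (g : ℕ → ℕ → R) (D m k : ℕ) :
    layer a g D m k =
      ∑ r ∈ range (k + 1), (D.choose r : R) * ((step a g) ^ r) (unitArray R) m k := by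
  have h1 : layer a g D m k =
      ∑ r ∈ range (D + 1), (D.choose r : R) * ((step a g) ^ r) (unitArray R) m k := by
    rw [layer, add_comm, (Commute.one_right (step a g)).add_pow]
    simp only [one_pow, mul_one, LinearMap.sum_apply, Finset.sum_apply]
    refine sum_congr rfl fun r _ => ?_
    rw [← Nat.cast_comm, ← nsmul_eq_mul]
    simp
  rw [h1]
  rcases le_total k D with h | h
  · symm
    refine sum_subset (range_subset_range.2 (by omega)) fun r _ hr => ?_
    rw [mem_range, not_lt] at hr
    rw [step_pow_eq_zero _ _ (by omega), mul_zero]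
  · refine sum_subset (range_subset_range.2 (by omega)) fun r _ hr => ?_
    rw [mem_range, not_lt] at hr
    rw [Nat.choose_eq_zero_of_lt (by omega)]
    simp

theorem tendsto_treeCoeff {ι : Type*} {l : Filter ι} {a : ι → ℕ → ℝ} {b : ℕ → ℝ}
    (hab : ∀ j, Tendsto (fun i => a i j) l (𝓝 (b j))) (d h D m k : ℕ) :
    Tendsto (fun i => treeCoeff (a i) d h D m k) l (𝓝 (treeCoeff b d h D m k)) := by
  induction h generalizing D m k with
  | zero => exact tendsto_const_nhds
  | succ h ih =>
    induction D generalizing m k with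
    | zero => simp only [treeCoeff_root_zero]; exact tendsto_const_nhds
    | succ D ihD =>
      simp only [treeCoeff_succ, step_apply]
      exact (ihD m k).add (tendsto_finsetSum _ fun j _ => ((tendsto_const_nhds.mul (hab _)).mul
        (tendsto_finsetSum _ fun p _ => (ihD _ _).mul (ih _ _ _))))

theorem treeCoeff_nonneg {a : ℕ → ℝ} (ha : ∀ j, 0 ≤ a j) (d h D m k : ℕ) :
    0 ≤ treeCoeff a d h D m k := by
  induction h generalizing D m k with
  | zero => simp only [treeCoeff, unitArray]; positivity
  | succ h ih =>
    induction D generalizing m k with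
    | zero => rw [treeCoeff_root_zero]; positivity
    | succ D ihD =>
      rw [treeCoeff_succ, step_apply]
      exact add_nonneg (ihD m k) (sum_nonneg fun j _ => mul_nonneg
        (mul_nonneg (Nat.cast_nonneg _) (ha _))
        (sum_nonneg fun p _ => mul_nonneg (ihD _ _) (ih _ _ _)))

end Recursion

/-! ### Growth of the tree coefficients -/

section Growth

open Finset
open scoped Nat

/-- The factor p + q gained over p! q! ≤ (p + q)! pays for the divisions by k in the estimates
below. -/
theorem factorial_mul_factorial_le {p q : ℕ} (hp : 1 ≤ p) (hq : 1 ≤ q) :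
    p ! * q ! ≤ (p + q - 1)! := by
  obtain ⟨p, rfl⟩ : ∃ i, p = i + 1 := ⟨p - 1, by omega⟩
  obtain ⟨q, rfl⟩ : ∃ i, q = i + 1 := ⟨q - 1, by omega⟩
  have h : p ! * (p + 1) ^ (q + 1) ≤ (p + (q + 1))! := Nat.factorial_mul_pow_le_factorial
  induction q with
  | zero => simp
  | succ q ih =>
    have h1 := ih (by omega) Nat.factorial_mul_pow_le_factorial
    have e1 : p + 1 + (q + 1) - 1 = p + q + 1 := by omega
    have e2 : p + 1 + (q + 1 + 1) - 1 = (p + q + 1) + 1 := by omega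
    rw [e1] at h1
    rw [e2, Nat.factorial_succ (q + 1), Nat.factorial_succ (p + q + 1)]
    calc (p + 1)! * ((q + 1 + 1) * (q + 1)!) = (q + 2) * ((p + 1)! * (q + 1)!) := by ring
      _ ≤ (p + q + 1 + 1) * (p + q + 1)! := Nat.mul_le_mul (by omega) h1

theorem multichoose_succ_cast (m j : ℕ) :
    ((m + 1).multichoose j : ℝ) = (m + j)! / (m ! * j !) := by
  rw [Nat.multichoose_eq, show m + 1 + j - 1 = m + j by omega, ← Nat.choose_symm_add,
    Nat.cast_add_choose]

/-- The size of the contribution of a single edge, if the moment of order `2 * k` of the weights is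
`(k !) ^ 2 * C ^ (k - 1)`. -/
noncomputable def edgeBound (C : ℝ) (m k : ℕ) : ℝ := C ^ (k - 1) * ((k + m)! * k !) / m !

theorem edgeBound_pos {C : ℝ} (hC : 0 < C) (m k : ℕ) : 0 < edgeBound C m k := by
  unfold edgeBound; positivity

/-- The index is shifted: `edgeBound C m` belongs to the power m + 1 of the generating function. -/
theorem multichoose_mul_eq_edgeBound (C : ℝ) (m k : ℕ) :
    ((m + 1).multichoose k : ℝ) * ((k ! : ℝ) ^ 2 * C ^ (k - 1)) = edgeBound C m k := by
  rw [multichoose_succ_cast, edgeBound, add_comm m k]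
  field_simp

/-- After an edge has been used, the remaining order goes to the root, to the child, or to both;
this and the next two lemmas treat these cases. Every split loses one power of C, because the
exponent is k - 1, and one factor k from the factorials. This compensates the number of splits once
C is large compared with d². -/
theorem edgeBound_mul_right_le {C : ℝ} (hC : 0 < C) {m j p k : ℕ} (hj : 1 ≤ j) (hp : 1 ≤ p)
    (hk : j + p = k) :
    edgeBound C m j * edgeBound C (m + j) p ≤ edgeBound C m k / (C * k) := by
  subst hk
  obtain ⟨j, rfl⟩ : ∃ i, j = i + 1 := ⟨j - 1, by omega⟩
  obtain ⟨p, rfl⟩ : ∃ i, p = i + 1 := ⟨p - 1, by omega⟩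
  have h1 : (((j + 1)! * (p + 1)! : ℕ) : ℝ) ≤ ((j + p + 1)! : ℕ) := by
    exact_mod_cast (factorial_mul_factorial_le (p := j + 1) (q := p + 1) (by omega)
      (by omega)).trans_eq (by congr 1; omega)
  have e : edgeBound C m (j + 1 + (p + 1)) / (C * ((j + 1 + (p + 1) : ℕ) : ℝ)) =
      C ^ (j + p) * ((j + p + 2 + m)! : ℕ) * ((j + p + 1)! : ℕ) / (m ! : ℕ) := by
    rw [edgeBound, show j + 1 + (p + 1) - 1 = j + p + 1 by omega,
      show j + 1 + (p + 1) = j + p + 1 + 1 by omega, Nat.factorial_succ (j + p + 1),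
      Nat.cast_mul, pow_succ]
    field_simp
  rw [e, edgeBound, edgeBound]
  simp only [Nat.add_sub_cancel]
  rw [show p + 1 + (m + (j + 1)) = j + p + 2 + m by omega, show j + 1 + m = m + (j + 1) by omega]
  calc C ^ j * ((m + (j + 1))! * (j + 1)! : ℝ) / m ! *
        (C ^ p * ((j + p + 2 + m)! * (p + 1)! : ℝ) / (m + (j + 1))!)
      = C ^ (j + p) * ((j + p + 2 + m)! : ℕ) / (m ! : ℕ) * (((j + 1)! * (p + 1)! : ℕ) : ℝ) := by
        push_cast
        field_simp
        ring
    _ ≤ C ^ (j + p) * ((j + p + 2 + m)! : ℕ) / (m ! : ℕ) * ((j + p + 1)! : ℕ) := by gcongr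
    _ = _ := by ring

theorem edgeBound_mul_child_le {C : ℝ} (hC : 0 < C) {m j l k : ℕ} (hl : 1 ≤ l)
    (hk : j + 1 + l = k) :
    edgeBound C m (j + 1) * edgeBound C j l ≤ edgeBound C m k / (C * k) := by
  subst hk
  obtain ⟨l, rfl⟩ : ∃ i, l = i + 1 := ⟨l - 1, by omega⟩
  have h1 : (((j + 1 + m)! * (l + 1)! : ℕ) : ℝ) ≤ ((j + l + 1 + m)! : ℕ) := by
    exact_mod_cast (factorial_mul_factorial_le (p := j + 1 + m) (q := l + 1) (by omega)
      (by omega)).trans_eq (by congr 1; omega)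
  have e : edgeBound C m (j + 1 + (l + 1)) / (C * ((j + 1 + (l + 1) : ℕ) : ℝ)) =
      C ^ (j + l) * ((j + l + 2 + m : ℕ) * ((j + l + 1 + m)! : ℕ)) * ((j + l + 1)! : ℕ) /
        (m ! : ℕ) := by
    rw [edgeBound, show j + 1 + (l + 1) - 1 = j + l + 1 by omega,
      show j + 1 + (l + 1) + m = (j + l + 1 + m) + 1 by omega, Nat.factorial_succ (j + l + 1 + m),
      show j + 1 + (l + 1) = j + l + 1 + 1 by omega, Nat.factorial_succ (j + l + 1),
      Nat.cast_mul, Nat.cast_mul, pow_succ, show j + l + 1 + m + 1 = j + l + 2 + m by omega]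
    field_simp
  rw [e, edgeBound, edgeBound]
  simp only [Nat.add_sub_cancel]
  rw [show l + 1 + j = j + l + 1 by omega, Nat.factorial_succ j]
  have h2 : ((j + 1 : ℕ) : ℝ) ≤ ((j + l + 2 + m : ℕ) : ℝ) := by exact_mod_cast (by omega)
  calc C ^ j * ((j + 1 + m)! * ((j + 1) * j ! : ℕ) : ℝ) / m ! *
        (C ^ l * ((j + l + 1)! * (l + 1)! : ℝ) / j !)
      = C ^ (j + l) * ((j + l + 1)! : ℕ) / (m ! : ℕ) *
          (((j + 1 : ℕ) : ℝ) * (((j + 1 + m)! * (l + 1)! : ℕ) : ℝ)) := by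
        push_cast
        field_simp
        ring
    _ ≤ C ^ (j + l) * ((j + l + 1)! : ℕ) / (m ! : ℕ) *
          (((j + l + 2 + m : ℕ) : ℝ) * ((j + l + 1 + m)! : ℕ)) := by gcongr
    _ = _ := by ring

theorem edgeBound_mul_mul_le {C : ℝ} (hC : 0 < C) {m j p l k : ℕ} (hp : 1 ≤ p) (hl : 1 ≤ l)
    (hk : j + 1 + p + l = k) :
    edgeBound C m (j + 1) * (edgeBound C (m + (j + 1)) p * edgeBound C j l) ≤
      edgeBound C m k / (C * k) ^ 2 := by
  have hC' := hC.ne'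
  have h1 := edgeBound_mul_right_le hC (m := m) (j := j + 1) (p := p) (by omega) hp rfl
  have h2 := edgeBound_mul_child_le hC (m := m) (j := j) (l := l + p) (by omega) rfl
  subst hk
  obtain ⟨l, rfl⟩ : ∃ i, l = i + 1 := ⟨l - 1, by omega⟩
  obtain ⟨p, rfl⟩ : ∃ i, p = i + 1 := ⟨p - 1, by omega⟩
  set K := j + p + l + 2 with hK
  have i1 : (((K - l + m)! * (l + 1)! : ℕ) : ℝ) ≤ ((K + m)! : ℕ) := by
    exact_mod_cast (factorial_mul_factorial_le (p := K - l + m) (q := l + 1) (by omega)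
      (by omega)).trans_eq (by congr 1; omega)
  have i2 : (((p + 1)! * ((j + 1) * (j + l + 1)!) : ℕ) : ℝ) ≤ (K ! : ℕ) := by
    have : (p + 1)! * ((j + l + 1) + 1)! ≤ K ! :=
      (factorial_mul_factorial_le (p := p + 1) (q := j + l + 1 + 1) (by omega)
      (by omega)).trans_eq (by congr 1; omega)
    refine Nat.cast_le.2 (le_trans ?_ this)
    rw [Nat.factorial_succ (j + l + 1)]
    gcongr
    omega
  have e : edgeBound C m (j + 1 + (p + 1) + (l + 1)) /
      (C * ((j + 1 + (p + 1) + (l + 1) : ℕ) : ℝ)) ^ 2 =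
      C ^ (j + p + l) * (((K + 1 + m : ℕ) : ℝ) / ((K + 1 : ℕ) : ℝ) * ((K + m)! : ℕ)) * (K ! : ℕ) /
        (m ! : ℕ) := by
    rw [edgeBound, show j + 1 + (p + 1) + (l + 1) - 1 = j + p + l + 2 by omega,
      show j + 1 + (p + 1) + (l + 1) = K + 1 by omega,
      show K + 1 + m = (K + m) + 1 by omega, Nat.factorial_succ (K + m), Nat.factorial_succ K,
      Nat.cast_mul, Nat.cast_mul, pow_succ, pow_succ]
    field_simp
  have h3 : (1 : ℝ) ≤ ((K + 1 + m : ℕ) : ℝ) / ((K + 1 : ℕ) : ℝ) := by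
    rw [one_le_div (by positivity)]; exact_mod_cast (by omega)
  rw [e, edgeBound, edgeBound, edgeBound]
  simp only [Nat.add_sub_cancel]
  rw [show l + 1 + j = j + l + 1 by omega, Nat.factorial_succ j,
    show p + 1 + (m + (j + 1)) = K - l + m by omega, show j + 1 + m = m + (j + 1) by omega]
  calc C ^ j * ((m + (j + 1))! * ((j + 1) * j ! : ℕ) : ℝ) / m ! *
        (C ^ p * ((K - l + m)! * (p + 1)! : ℝ) / (m + (j + 1))! *
          (C ^ l * ((j + l + 1)! * (l + 1)! : ℝ) / j !))
      = C ^ (j + p + l) / (m ! : ℕ) * ((((K - l + m)! * (l + 1)! : ℕ) : ℝ) *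
          (((p + 1)! * ((j + 1) * (j + l + 1)!) : ℕ) : ℝ)) := by
        push_cast
        field_simp
        ring
    _ ≤ C ^ (j + p + l) / (m ! : ℕ) * (((K + m)! : ℕ) * (K ! : ℕ)) := by gcongr
    _ ≤ C ^ (j + p + l) / (m ! : ℕ) * ((((K + 1 + m : ℕ) : ℝ) / ((K + 1 : ℕ) : ℝ) *
          ((K + m)! : ℕ)) * (K ! : ℕ)) := by
        gcongr
        exact le_mul_of_one_le_left (by positivity) h3
    _ = _ := by ring

/-- If the moments grow at most like `(k !) ^ 2 * C ^ (k - 1)`, then the walks along a single edge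
dominate. -/
theorem treeCoeff_le {a : ℕ → ℝ} {d k : ℕ} {C : ℝ} (hd : 1 ≤ d) (hC : 8 * (d : ℝ) ^ 2 ≤ C)
    (ha0 : ∀ j, 0 ≤ a j) (ha : ∀ j, 1 ≤ j → j < k → a j ≤ (j ! : ℝ) ^ 2 * C ^ (j - 1))
    (hk : 1 ≤ k) (h D m : ℕ) (hD : D ≤ d) :
    treeCoeff a d h D (m + 1) k ≤
      D * (m + 1).multichoose k * a k + D / d * edgeBound C m k := by
  have hd' : (1 : ℝ) ≤ d := by exact_mod_cast hd
  have hC0 : 0 < C := lt_of_lt_of_le (by positivity) hC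
  induction k using Nat.strong_induction_on generalizing h D m with
  | _ k ihk =>
  -- Below order k the hypothesis on `a` absorbs the moment into `edgeBound`: at most d from the
  -- edges, plus at most 1 ≤ d from the error.
  have small : ∀ l, l < k → 1 ≤ l → ∀ h D m, D ≤ d →
      treeCoeff a d h D (m + 1) l ≤ 2 * d * edgeBound C m l := by
    intro l hl hl1 h D m hD
    refine (ihk l hl (fun j h1 h2 => ha j h1 (by omega)) hl1 h D m hD).trans ?_
    have h1 : ((m + 1).multichoose l : ℝ) * a l ≤ edgeBound C m l := by
      rw [← multichoose_mul_eq_edgeBound]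
      exact mul_le_mul_of_nonneg_left (ha l hl1 hl) (Nat.cast_nonneg _)
    have h2 : (D : ℝ) ≤ d := by exact_mod_cast hD
    have h3 : (D : ℝ) / d ≤ d := (div_le_one_of_le₀ h2 (by positivity)).trans hd'
    have h4 := edgeBound_pos hC0 m l
    have h5 : 0 ≤ ((m + 1).multichoose l : ℝ) * a l := mul_nonneg (Nat.cast_nonneg _) (ha0 l)
    calc (D : ℝ) * (m + 1).multichoose l * a l + D / d * edgeBound C m l
        = (D : ℝ) * ((m + 1).multichoose l * a l) + D / d * edgeBound C m l := by ring
      _ ≤ d * edgeBound C m l + d * edgeBound C m l := by gcongr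
      _ = _ := by ring
  cases h with
  | zero =>
    have : treeCoeff a d 0 D (m + 1) k = 0 := by
      simp [treeCoeff, unitArray, show k ≠ 0 by omega]
    rw [this]
    have := edgeBound_pos hC0 m k
    have := ha0 k
    positivity
  | succ h =>
  induction D generalizing m with
  | zero => simp [treeCoeff_root_zero, show k ≠ 0 by omega]
  | succ D ihD =>
    obtain ⟨k, rfl⟩ : ∃ i, k = i + 1 := ⟨k - 1, by omega⟩
    have ih := ihD m (by omega)
    set W := edgeBound C m (k + 1) with hW
    have hWpos : 0 < W := edgeBound_pos hC0 _ _
    set Z := C * ((k + 1 : ℕ) : ℝ) with hZ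
    have hZpos : 0 < Z := by positivity
    have inner : ∀ j ∈ range k, ((m + 1).multichoose (j + 1) : ℝ) * a (j + 1) *
        ∑ p ∈ antidiagonal (k + 1 - (j + 1)), treeCoeff a d (h + 1) D (m + 1 + (j + 1)) p.1 *
          treeCoeff a d h (d - 1) (j + 1) p.2 ≤
        4 * d * (W / Z) + (k + 1) * (4 * d ^ 2 * (W / Z ^ 2)) := by
      intro j hj
      rw [mem_range] at hj
      -- The two boundary cases p.1 = 0 and p.2 = 0 occur once each and exclude each other as j < k.
      -- They need the weaker gain 1/Z, while the up to k + 1 other pairs have the gain 1/Z².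
      have term : ∀ p ∈ antidiagonal (k + 1 - (j + 1)),
          ((m + 1).multichoose (j + 1) : ℝ) * a (j + 1) *
          (treeCoeff a d (h + 1) D (m + 1 + (j + 1)) p.1 *
          treeCoeff a d h (d - 1) (j + 1) p.2) ≤
          (if p.1 = 0 then 2 * d * (W / Z) else 0) + (if p.2 = 0 then 2 * d * (W / Z) else 0) +
            4 * d ^ 2 * (W / Z ^ 2) := by
        rintro ⟨p, l⟩ hpl
        have hpl := mem_antidiagonal.1 hpl
        simp only at hpl ⊢
        have hE := edgeBound_pos hC0 m (j + 1)
        have h1 : ((m + 1).multichoose (j + 1) : ℝ) * a (j + 1) ≤ edgeBound C m (j + 1) := by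
          rw [← multichoose_mul_eq_edgeBound]
          exact mul_le_mul_of_nonneg_left (ha _ (by omega) (by omega)) (Nat.cast_nonneg _)
        have hp : 1 ≤ p → treeCoeff a d (h + 1) D (m + 1 + (j + 1)) p ≤
            2 * d * edgeBound C (m + (j + 1)) p := fun hp => by
          have := small p (by omega) hp (h + 1) D (m + (j + 1)) (by omega)
          rwa [show m + (j + 1) + 1 = m + 1 + (j + 1) by omega] at this
        have hl : 1 ≤ l → treeCoeff a d h (d - 1) (j + 1) l ≤ 2 * d * edgeBound C j l :=
          fun hl => small l (by omega) hl h (d - 1) j (by omega)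
        have hn1 := treeCoeff_nonneg ha0 d (h + 1) D (m + 1 + (j + 1)) p
        have hn2 := treeCoeff_nonneg ha0 d h (d - 1) (j + 1) l
        have hpos : 0 ≤ 4 * (d : ℝ) ^ 2 * (W / Z ^ 2) := by positivity
        rcases Nat.eq_zero_or_pos p with rfl | hp0
        · have hl0 : 1 ≤ l := by omega
          rw [treeCoeff_order_zero, one_mul, if_pos rfl, if_neg (by omega), add_zero]
          have hb := edgeBound_mul_child_le hC0 (m := m) (j := j) (l := l) (k := k + 1) hl0
            (by omega)
          calc _ ≤ edgeBound C m (j + 1) * (2 * d * edgeBound C j l) := by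
                gcongr
                exact hl hl0
            _ = 2 * d * (edgeBound C m (j + 1) * edgeBound C j l) := by ring
            _ ≤ 2 * d * (W / Z) := by gcongr
            _ ≤ _ := by linarith
        · rcases Nat.eq_zero_or_pos l with rfl | hl0
          · rw [treeCoeff_order_zero, mul_one, if_pos rfl, if_neg (by omega), zero_add]
            have hb := edgeBound_mul_right_le hC0 (m := m) (j := j + 1) (p := p) (k := k + 1)
              (by omega) hp0 (by omega)
            calc _ ≤ edgeBound C m (j + 1) * (2 * d * edgeBound C (m + (j + 1)) p) := by
                  gcongr
                  exact hp hp0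
              _ = 2 * d * (edgeBound C m (j + 1) * edgeBound C (m + (j + 1)) p) := by ring
              _ ≤ 2 * d * (W / Z) := by gcongr
              _ ≤ _ := by linarith
          · rw [if_neg (by omega), if_neg (by omega), zero_add, zero_add]
            have hb := edgeBound_mul_mul_le hC0 (m := m) (j := j) (p := p) (l := l) (k := k + 1)
              hp0 hl0 (by omega)
            have hE2 := edgeBound_pos hC0 (m + (j + 1)) p
            calc _ ≤ edgeBound C m (j + 1) *
                  ((2 * d * edgeBound C (m + (j + 1)) p) * (2 * d * edgeBound C j l)) := by
                  gcongr
                  · exact hp hp0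
                  · exact hl hl0
              _ = 4 * d ^ 2 * (edgeBound C m (j + 1) *
                  (edgeBound C (m + (j + 1)) p * edgeBound C j l)) := by ring
              _ ≤ _ := by gcongr
      rw [mul_sum]
      refine (sum_le_sum term).trans ?_
      have hpos : 0 ≤ 4 * (d : ℝ) ^ 2 * (W / Z ^ 2) := by positivity
      rw [sum_add_distrib, sum_add_distrib, sum_const, Nat.card_antidiagonal, nsmul_eq_mul,
        Nat.sum_antidiagonal_eq_sum_range_succ_mk, Nat.sum_antidiagonal_eq_sum_range_succ_mk]
      have s1 : ∑ x ∈ range (k + 1 - (j + 1)).succ,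
          (if x = 0 then 2 * (d : ℝ) * (W / Z) else 0) = 2 * d * (W / Z) := by
        rw [sum_ite_eq' _ 0, if_pos (by simp)]
      have s2 : ∑ x ∈ range (k + 1 - (j + 1)).succ,
          (if k + 1 - (j + 1) - x = 0 then 2 * (d : ℝ) * (W / Z) else 0) = 2 * d * (W / Z) := by
        rw [sum_eq_single (k + 1 - (j + 1))]
        · simp
        · intro x hx hne
          rw [mem_range] at hx
          rw [if_neg (by omega)]
        · simp
      simp only [s1, s2]
      have : ((k + 1 - (j + 1) + 1 : ℕ) : ℝ) ≤ k + 1 := by exact_mod_cast (by omega)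
      have := mul_le_mul_of_nonneg_right this hpos
      linarith
    rw [treeCoeff_succ, step_apply, sum_range_succ]
    have hlast : ((m + 1).multichoose (k + 1) : ℝ) * a (k + 1) *
        ∑ p ∈ antidiagonal (k + 1 - (k + 1)), treeCoeff a d (h + 1) D (m + 1 + (k + 1)) p.1 *
          treeCoeff a d h (d - 1) (k + 1) p.2 = (m + 1).multichoose (k + 1) * a (k + 1) := by
      simp [treeCoeff_order_zero]
    rw [hlast]
    have hsum := sum_le_sum inner
    rw [sum_const, card_range, nsmul_eq_mul] at hsum
    -- Here C ≥ 8d² is used. Each new edge may add at most W/d to the error, so that D edges add at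
    -- most (D/d)·W. The two terms cost at most 1/(2d) and 1/(4d)².
    have herr : (k : ℝ) * (4 * d * (W / Z) + (k + 1) * (4 * d ^ 2 * (W / Z ^ 2))) ≤ 1 / d * W := by
      have hk1 : (k : ℝ) ≤ k + 1 := by linarith
      have hpos : 0 ≤ 4 * d * (W / Z) + (k + 1) * (4 * d ^ 2 * (W / Z ^ 2)) := by positivity
      refine (mul_le_mul_of_nonneg_right hk1 hpos).trans ?_
      have e : ((k : ℝ) + 1) * (4 * d * (W / Z) + (k + 1) * (4 * d ^ 2 * (W / Z ^ 2))) =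
          W * (4 * d / C + (2 * d / C) ^ 2) := by
        rw [hZ]; push_cast; field_simp; ring
      rw [e, mul_comm (1 / (d : ℝ))]
      refine mul_le_mul_of_nonneg_left ?_ hWpos.le
      have c1 : 4 * (d : ℝ) / C ≤ 1 / (2 * d) := by
        rw [div_le_div_iff₀ hC0 (by positivity)]; nlinarith
      have c2 : 2 * (d : ℝ) / C ≤ 1 / (4 * d) := by
        rw [div_le_div_iff₀ hC0 (by positivity)]; nlinarith
      have c3 : (2 * (d : ℝ) / C) ^ 2 ≤ (1 / (4 * d)) ^ 2 := by gcongr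
      have c4 : 1 / (2 * (d : ℝ)) + (1 / (4 * d)) ^ 2 ≤ 1 / d := by
        rw [div_pow, div_add_div _ _ (by positivity) (by positivity),
          div_le_div_iff₀ (by positivity) (by positivity)]
        nlinarith [pow_pos (show (0 : ℝ) < d by linarith) 3]
      linarith
    have : (((D + 1 : ℕ) : ℝ)) / d * W = D / d * W + 1 / d * W := by push_cast; ring
    rw [this, Nat.cast_succ D, add_mul, add_mul, one_mul]
    linarith

end Growth

/-! ### The fixed point of the moment recursion and its first values -/

section FixedSequence

open Finset
open scoped Nat

/-- The even moments of the eigendistribution, as determined by the walk recursion. -/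
noncomputable def fixedSeq (d k : ℕ) : ℝ :=
  if k = 0 then 1 else if k = 1 then 1 / 4 else
    treeCoeff (fun j => if _h : j < k then fixedSeq d j else 0) d k d 1 k / ((d : ℝ) ^ k - d)
termination_by k

theorem fixedSeq_zero (d : ℕ) : fixedSeq d 0 = 1 := by rw [fixedSeq]; simp

theorem fixedSeq_one (d : ℕ) : fixedSeq d 1 = 1 / 4 := by rw [fixedSeq]; simp

/-- The sequence `a` cut off at `k`. -/
def cutoff (a : ℕ → ℝ) (k : ℕ) : ℕ → ℝ := fun j => if j < k then a j else 0

theorem fixedSeq_of_two_le {k : ℕ} (d : ℕ) (hk : 2 ≤ k) :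
    fixedSeq d k = treeCoeff (cutoff (fixedSeq d) k) d k d 1 k / ((d : ℝ) ^ k - d) := by
  rw [fixedSeq, if_neg (by omega), if_neg (by omega)]
  simp only [dite_eq_ite]
  rfl

theorem treeCoeff_root_top (a : ℕ → ℝ) (d : ℕ) {k : ℕ} (hk : 1 ≤ k) :
    treeCoeff a d k d 1 k = d * a k + treeCoeff (cutoff a k) d k d 1 k := by
  rw [treeCoeff_top (a' := cutoff a k) hk le_rfl (fun j _ hj => by simp [cutoff, hj])
    (by simp [cutoff])]
  simp

theorem pow_sub_self_pos {d k : ℕ} (hd : 2 ≤ d) (hk : 2 ≤ k) : (1 : ℝ) ≤ (d : ℝ) ^ k - d := by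
  have h2 : (2 : ℝ) ≤ d := by exact_mod_cast hd
  have : (d : ℝ) ^ 2 ≤ (d : ℝ) ^ k := pow_le_pow_right₀ (by linarith) hk
  nlinarith

theorem treeCoeff_one_one (a : ℕ → ℝ) (d D m : ℕ) (h : ℕ) :
    treeCoeff a d (h + 1) D m 1 = D * m * a 1 := by
  induction D with
  | zero => simp [treeCoeff_root_zero]
  | succ D ih =>
    rw [treeCoeff_succ, ih, step_apply]
    simp [treeCoeff_order_zero]
    ring

/-- At k = 1 the equation reads d a₁ = d a₁, so the second moment is a free normalisation. For k ≥ 2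
the term d·a_k has been moved to the left, which produces the denominator d^k - d; the right side is
evaluated with a_k and all higher moments replaced by 0. -/
theorem fixedSeq_spec {d : ℕ} (hd : 2 ≤ d) (k : ℕ) :
    treeCoeff (fixedSeq d) d k d 1 k = (d : ℝ) ^ k * fixedSeq d k := by
  rcases Nat.lt_or_ge k 2 with hk | hk
  · interval_cases k
    · simp [treeCoeff_order_zero, fixedSeq_zero]
    · simp [treeCoeff_one_one]
  · have h := pow_sub_self_pos hd hk
    rw [treeCoeff_root_top _ _ (by omega)]
    have e := fixedSeq_of_two_le d hk
    rw [eq_div_iff (by linarith)] at e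
    linarith

theorem eq_fixedSeq {d : ℕ} (hd : 2 ≤ d) {a : ℕ → ℝ} (h0 : a 0 = 1) (h1 : a 1 = 1 / 4)
    (ha : ∀ k, treeCoeff a d k d 1 k = (d : ℝ) ^ k * a k) : a = fixedSeq d := by
  ext k
  induction k using Nat.strong_induction_on with
  | _ k ih =>
  rcases Nat.lt_or_ge k 2 with hk | hk
  · interval_cases k
    · rw [h0, fixedSeq_zero]
    · rw [h1, fixedSeq_one]
  · have h := pow_sub_self_pos hd hk
    have e := ha k
    rw [treeCoeff_root_top _ _ (by omega)] at e
    rw [fixedSeq_of_two_le d hk, eq_div_iff (by linarith),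
      show cutoff (fixedSeq d) k = cutoff a k from ?_]
    · linarith
    · ext j
      by_cases hj : j < k
      · simp [cutoff, hj, ih j hj]
      · simp [cutoff, hj]

theorem fixedSeq_nonneg {d : ℕ} (hd : 2 ≤ d) (k : ℕ) : 0 ≤ fixedSeq d k := by
  induction k using Nat.strong_induction_on with
  | _ k ih =>
  rcases Nat.lt_or_ge k 2 with hk | hk
  · interval_cases k
    · simp [fixedSeq_zero]
    · simp [fixedSeq_one]
  · have h := pow_sub_self_pos hd hk
    rw [fixedSeq_of_two_le d hk]
    refine div_nonneg (treeCoeff_nonneg (fun j => ?_) _ _ _ _ _) (by linarith)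
    unfold cutoff
    split_ifs with hj
    · exact ih j hj
    · exact le_rfl

/-- The growth hypothesis reproduces itself. For m = 0 and D = d, `treeCoeff_le` gives (d^k - d) a_k
≤ (k!)² C^(k-1) with C = 8d², and d^k - d ≥ 1. -/
theorem fixedSeq_le {d k : ℕ} (hd : 2 ≤ d) (hk : 1 ≤ k) :
    fixedSeq d k ≤ (k ! : ℝ) ^ 2 * (8 * (d : ℝ) ^ 2) ^ (k - 1) := by
  induction k using Nat.strong_induction_on with
  | _ k ih =>
  rcases Nat.lt_or_ge k 2 with hk2 | hk2
  · obtain rfl : k = 1 := by omega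
    simp [fixedSeq_one]
    norm_num
  · have h := pow_sub_self_pos hd hk2
    have hd' : (2 : ℝ) ≤ d := by exact_mod_cast hd
    have hb := treeCoeff_le (a := fixedSeq d) (d := d) (k := k) (C := 8 * (d : ℝ) ^ 2)
      (by omega) le_rfl (fixedSeq_nonneg hd) (fun j h1 h2 => ih j h2 h1) hk k d 0 le_rfl
    rw [zero_add, fixedSeq_spec hd, Nat.multichoose_one, Nat.cast_one, mul_one,
      div_self (by linarith), one_mul, edgeBound] at hb
    have hb' : ((d : ℝ) ^ k - d) * fixedSeq d k ≤
        (k ! : ℝ) ^ 2 * (8 * (d : ℝ) ^ 2) ^ (k - 1) := by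
      simp only [add_zero, Nat.factorial_zero, Nat.cast_one, div_one] at hb
      linarith
    exact (le_mul_of_one_le_left (fixedSeq_nonneg hd k) h).trans hb'

theorem tendsto_of_affine_recursion {q L : ℝ} {x y : ℕ → ℝ} (hq0 : 0 ≤ q) (hq : q < 1)
    (hx : ∀ n, x (n + 1) = q * x n + y n) (hy : Tendsto y atTop (𝓝 (L - q * L))) :
    Tendsto x atTop (𝓝 L) := by
  rw [Metric.tendsto_atTop] at hy ⊢
  intro ε hε
  -- The tolerance is chosen so that q·ε/2 + (1 - q)·ε/2 = ε/2 and the bound in `key` is preserved.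
  obtain ⟨N, hN⟩ := hy (ε / 2 * (1 - q)) (by have : 0 < 1 - q := by linarith
                                             positivity)
  have key : ∀ n, |x (N + n) - L| ≤ q ^ n * |x N - L| + ε / 2 := by
    intro n
    induction n with
    | zero => simp; linarith
    | succ n ih =>
      have h1 := (hN (N + n) (by omega)).le
      rw [Real.dist_eq] at h1
      rw [← add_assoc, hx, show q * x (N + n) + y (N + n) - L =
        q * (x (N + n) - L) + (y (N + n) - (L - q * L)) by ring]
      refine (abs_add_le _ _).trans ?_
      rw [abs_mul, abs_of_nonneg hq0, pow_succ]
      nlinarith [mul_le_mul_of_nonneg_left ih hq0]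
  have hpow : Tendsto (fun n => q ^ n * |x N - L|) atTop (𝓝 0) := by
    simpa using (tendsto_pow_atTop_nhds_zero_of_lt_one hq0 hq).mul_const |x N - L|
  obtain ⟨M, hM⟩ := (Metric.tendsto_atTop.1 hpow) (ε / 2) (by linarith)
  refine ⟨N + M, fun n hn => ?_⟩
  obtain ⟨i, rfl⟩ := Nat.exists_eq_add_of_le (show N ≤ n by omega)
  have h1 := hM i (by omega)
  rw [Real.dist_eq, sub_zero] at h1
  rw [Real.dist_eq]
  have := le_abs_self (q ^ i * |x N - L|)
  linarith [key i]

/-- Iterating the walk recursion leads to its fixed point. -/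
theorem tendsto_fixedSeq {d : ℕ} (hd : 2 ≤ d) {b : ℕ → ℕ → ℝ} (h0 : ∀ n, b n 0 = 1)
    (h1 : ∀ n, b n 1 = 1 / 4)
    (hb : ∀ n k, (d : ℝ) ^ k * b (n + 1) k = treeCoeff (b n) d k d 1 k) (k : ℕ) :
    Tendsto (fun n => b n k) atTop (𝓝 (fixedSeq d k)) := by
  induction k using Nat.strong_induction_on with
  | _ k ih =>
  rcases Nat.lt_or_ge k 2 with hk2 | hk2
  · interval_cases k
    · simp [h0, fixedSeq_zero]
    · simp [h1, fixedSeq_one]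
  · have hd' : (2 : ℝ) ≤ d := by exact_mod_cast hd
    have hdk : (0 : ℝ) < (d : ℝ) ^ k := by positivity
    have h := pow_sub_self_pos hd hk2
    -- The moment of order k is contracted by d^(1-k) < 1; the inhomogeneous term depends only on
    -- lower moments, which converge by induction.
    refine tendsto_of_affine_recursion (q := d / (d : ℝ) ^ k)
      (y := fun n => treeCoeff (cutoff (b n) k) d k d 1 k / (d : ℝ) ^ k) (by positivity)
      ((div_lt_one hdk).2 (by linarith)) (fun n => ?_) ?_
    · have := hb n k
      rw [treeCoeff_root_top _ _ (by omega)] at this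
      field_simp
      linarith
    · have e : fixedSeq d k - d / (d : ℝ) ^ k * fixedSeq d k =
          treeCoeff (cutoff (fixedSeq d) k) d k d 1 k / (d : ℝ) ^ k := by
        have := fixedSeq_spec hd k
        rw [treeCoeff_root_top _ _ (by omega)] at this
        field_simp
        linarith
      rw [e]
      refine (tendsto_treeCoeff (fun j => ?_) _ _ _ _ _).div_const _
      by_cases hj : j < k
      · simpa [cutoff, hj] using ih j hj
      · simp [cutoff, hj]

theorem layer_order_one (a : ℕ → ℝ) (g : ℕ → ℕ → ℝ) (hg : ∀ j, g j 0 = 1) (D m : ℕ) :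
    layer a g D m 1 = D * m * a 1 := by
  simp [layer_eq_sum, sum_range_succ, step_apply, unitArray, hg]
  ring

theorem multichoose_two_cast (m : ℕ) : (m.multichoose 2 : ℝ) = m * (m + 1) / 2 := by
  rw [Nat.multichoose_eq, show m + 2 - 1 = m + 1 by omega, Nat.cast_choose_two]
  push_cast
  ring

theorem layer_order_two (a : ℕ → ℝ) (g : ℕ → ℕ → ℝ) (hg : ∀ j, g j 0 = 1) (D m : ℕ) :
    layer a g D m 2 = D * (m * a 1 * g 1 1 + m * (m + 1) / 2 * a 2) +
      D * (D - 1) / 2 * (m * (m + 1) * a 1 ^ 2) := by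
  induction D with
  | zero => simp [layer_zero, unitArray]
  | succ D ih =>
    rw [layer_succ, ih, step_apply]
    simp only [Finset.Nat.sum_antidiagonal_eq_sum_range_succ_mk, sum_range_succ, sum_range_zero,
      zero_add, Nat.reduceSub, Nat.reduceAdd, hg, layer_order_zero, layer_order_one a g hg,
      Nat.multichoose_one_right, multichoose_two_cast]
    push_cast
    ring

theorem layer_order_three (a : ℕ → ℝ) (g : ℕ → ℕ → ℝ) (hg : ∀ j, g j 0 = 1) (D m : ℕ) :
    layer a g D m 3 = D * (m * a 1 * g 1 2 + m * (m + 1) / 2 * a 2 * g 2 1 +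
        m.multichoose 3 * a 3) +
      D * (D - 1) / 2 * (2 * m * (m + 1) * a 1 ^ 2 * g 1 1 +
        m * (m + 1) * (m + 2) * a 1 * a 2) +
      D * (D - 1) * (D - 2) / 6 * (m * (m + 1) * (m + 2) * a 1 ^ 3) := by
  induction D with
  | zero => simp [layer_zero, unitArray]
  | succ D ih =>
    rw [layer_succ, ih, step_apply]
    simp only [Finset.Nat.sum_antidiagonal_eq_sum_range_succ_mk, sum_range_succ, sum_range_zero,
      zero_add, Nat.reduceSub, Nat.reduceAdd, hg, layer_order_zero, layer_order_one a g hg,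
      layer_order_two a g hg, Nat.multichoose_one_right, multichoose_two_cast]
    push_cast
    ring

/-- The terms are grouped by the number of root edges used. At the top order the first power
suffices, whereas the lower orders are needed for general m because each use of an edge raises the
power. -/
theorem layer_order_four (a : ℕ → ℝ) (g : ℕ → ℕ → ℝ) (hg : ∀ j, g j 0 = 1) (D : ℕ) :
    layer a g D 1 4 = D * (a 1 * g 1 3 + a 2 * g 2 2 + a 3 * g 3 1 + a 4) +
      D * (D - 1) / 2 * (4 * a 1 ^ 2 * g 1 2 + 6 * a 1 * a 2 * g 2 1 + 8 * a 1 * a 3 +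
        2 * a 1 ^ 2 * g 1 1 ^ 2 + 6 * a 1 * a 2 * g 1 1 + 6 * a 2 ^ 2) +
      D * (D - 1) * (D - 2) / 6 * (18 * a 1 ^ 3 * g 1 1 + 36 * a 1 ^ 2 * a 2) +
      D * (D - 1) * (D - 2) * (D - 3) * a 1 ^ 4 := by
  induction D with
  | zero => simp [layer_zero, unitArray]
  | succ D ih =>
    have h3 : Nat.multichoose 2 3 = 4 := by rw [Nat.multichoose_eq]; rfl
    rw [layer_succ, ih, step_apply]
    simp only [Finset.Nat.sum_antidiagonal_eq_sum_range_succ_mk, sum_range_succ, sum_range_zero,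
      zero_add, Nat.reduceSub, Nat.reduceAdd, hg, layer_order_zero, layer_order_one a g hg,
      layer_order_two a g hg, layer_order_three a g hg, Nat.multichoose_one, h3]
    push_cast
    ring

theorem fixedSeq_two {d : ℕ} (hd : 2 ≤ d) : fixedSeq d 2 = 1 / 8 := by
  have h := fixedSeq_spec hd 2
  have hd' : (2 : ℝ) ≤ d := by exact_mod_cast hd
  have hg := fun j => treeCoeff_order_zero (fixedSeq d) d 1 (d - 1) j
  rw [treeCoeff, layer_order_two _ _ hg, treeCoeff_one_one, fixedSeq_one,
    Nat.cast_sub (by omega)] at h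
  have h2 : (d : ℝ) * (d - 1) * (fixedSeq d 2 - 1 / 8) = 0 := by
    push_cast at h
    linarith
  have h3 : (d : ℝ) * (d - 1) ≠ 0 := by nlinarith
  have := (mul_eq_zero.1 h2).resolve_left h3
  linarith

theorem fixedSeq_three {d : ℕ} (hd : 2 ≤ d) : fixedSeq d 3 = 5 / 64 := by
  have h := fixedSeq_spec hd 3
  have hd' : (2 : ℝ) ≤ d := by exact_mod_cast hd
  have hg := fun h j => treeCoeff_order_zero (fixedSeq d) d h (d - 1) j
  have h13 : Nat.multichoose 1 3 = 1 := Nat.multichoose_one 3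
  rw [treeCoeff, layer_order_three _ _ (hg 2), treeCoeff_one_one, treeCoeff_one_one, treeCoeff,
    layer_order_two _ _ (hg 1), treeCoeff_one_one, fixedSeq_one, fixedSeq_two hd,
    Nat.cast_sub (by omega), h13] at h
  -- Here d³ - d = d(d - 1)(d + 1), and the factor d + 1 also divides the right side, so no d
  -- remains in the moment.
  have h2 : (d : ℝ) * (d - 1) * (d + 1) * (fixedSeq d 3 - 5 / 64) = 0 := by
    push_cast at h
    linarith
  have h3 : (d : ℝ) * (d - 1) * (d + 1) ≠ 0 := by
    have : 0 < (d : ℝ) * (d - 1) * (d + 1) :=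
      mul_pos (mul_pos (by linarith) (by linarith)) (by linarith)
    exact this.ne'
  have := (mul_eq_zero.1 h2).resolve_left h3
  linarith

theorem fixedSeq_four {d : ℕ} (hd : 2 ≤ d) :
    fixedSeq d 4 = 7 / 128 + 1 / (128 * ((d : ℝ) ^ 2 + d + 1)) := by
  have h := fixedSeq_spec hd 4
  have hd' : (2 : ℝ) ≤ d := by exact_mod_cast hd
  have hg := fun h j => treeCoeff_order_zero (fixedSeq d) d h (d - 1) j
  have h13 : Nat.multichoose 1 3 = 1 := Nat.multichoose_one 3
  rw [treeCoeff, layer_order_four _ _ (hg 3), treeCoeff_one_one, treeCoeff_one_one,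
    treeCoeff_one_one, treeCoeff,
    layer_order_three _ _ (hg 2), layer_order_two _ _ (hg 2), layer_order_two _ _ (hg 2),
    treeCoeff_one_one, treeCoeff_one_one, treeCoeff,
    layer_order_two _ _ (hg 1), treeCoeff_one_one, fixedSeq_one, fixedSeq_two hd,
    fixedSeq_three hd, Nat.cast_sub (by omega), h13] at h
  have hpos : 0 < (d : ℝ) ^ 2 + d + 1 := by positivity
  -- The denominator comes from d⁴ - d = d(d - 1)(d² + d + 1). This time the last factor does not
  -- cancel.
  have h2 : (d : ℝ) * (d - 1) * (128 * (d ^ 2 + d + 1) * fixedSeq d 4 -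
      (7 * (d ^ 2 + d + 1) + 1)) = 0 := by
    push_cast at h
    linarith
  have h3 : (d : ℝ) * (d - 1) ≠ 0 := by nlinarith
  have h4 := (mul_eq_zero.1 h2).resolve_left h3
  field_simp
  linarith

end FixedSequence

/-! ### The recursion to first order in 1/d -/

section SquareZero

open Finset PowerSeries
open scoped Nat

variable {Q : Type*} [CommRing Q]

/-- The hypotheses describe the scaled moments ε^(j-1) a_j modulo ε², with q = 1/4 and ε/8 = 2εq².
The factor 2 in `h2` cancels the division in multichoose(m, 2) = m(m + 1)/2, so nothing has to be
inverted in Q. -/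
theorem mk_step (a : ℕ → Q) (g F : ℕ → ℕ → Q) (q e : Q) (h1 : a 1 = q) (h2 : a 2 = 2 * e * q ^ 2)
    (h3 : ∀ j, 3 ≤ j → a j = 0) (m : ℕ) :
    PowerSeries.mk (step a g F m) =
      (m : Q⟦X⟧) * (C q * X) * PowerSeries.mk (F (m + 1)) * PowerSeries.mk (g 1) +
      C e * (m * (m + 1) : Q⟦X⟧) * (C q * X) ^ 2 * PowerSeries.mk (F (m + 2)) *
        PowerSeries.mk (g 2) := by
  have hm2 : (m.multichoose 2 : Q) * 2 = m * (m + 1) := by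
    have : m.multichoose 2 * 2 = m * (m + 1) := by
      rw [Nat.multichoose_eq, show m + 2 - 1 = m + 1 by omega, Nat.choose_two_right,
        Nat.div_mul_cancel (Nat.even_mul_pred_self _).two_dvd, Nat.add_sub_cancel, mul_comm]
    exact_mod_cast congrArg (Nat.cast : ℕ → Q) this
  have e1 : (m : Q⟦X⟧) * (C q * X) * PowerSeries.mk (F (m + 1)) * PowerSeries.mk (g 1) =
      C ((m : Q) * q) * (X ^ 1 * (PowerSeries.mk (F (m + 1)) * PowerSeries.mk (g 1))) := by
    rw [map_mul, map_natCast]; ring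
  have e2 : C e * (m * (m + 1) : Q⟦X⟧) * (C q * X) ^ 2 * PowerSeries.mk (F (m + 2)) *
        PowerSeries.mk (g 2) = C ((m.multichoose 2 : Q) * (2 * e * q ^ 2)) *
          (X ^ 2 * (PowerSeries.mk (F (m + 2)) * PowerSeries.mk (g 2))) := by
    rw [show (m.multichoose 2 : Q) * (2 * e * q ^ 2) = e * (m * (m + 1)) * q ^ 2 by
      rw [← hm2]; ring]
    simp only [map_mul, map_pow, map_add, map_natCast, map_one]
    ring
  rw [e1, e2]
  ext k
  rw [coeff_mk, map_add, coeff_C_mul, coeff_C_mul, coeff_X_pow_mul', coeff_X_pow_mul',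
    step_apply]
  simp only [coeff_mul, coeff_mk]
  rcases k with _ | _ | k
  · simp
  · simp [h1]
  · rw [sum_range_succ', sum_range_succ', sum_eq_zero]
    · simp [h1, h2]
      ring
    · intro j _
      rw [h3 _ (by omega)]
      simp

/-- The composition of the power series with coefficients `c` with the power series `z`, which is
meant to have constant coefficient `0`. -/
noncomputable def composition (z : Q⟦X⟧) (c : ℕ → Q) : Q⟦X⟧ :=
  PowerSeries.mk fun k => ∑ r ∈ range (k + 1), c r * coeff k (z ^ r)

theorem coeff_pow_mul_eq_zero {z : Q⟦X⟧} {w : Q⟦X⟧} (hz : z = X * w) {k r : ℕ} (h : k < r) :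
    coeff k (z ^ r) = 0 := by
  rw [hz, mul_pow, coeff_X_pow_mul', if_neg (by omega)]

theorem mk_sum_shift {z w : Q⟦X⟧} (hz : z = X * w) (c : ℕ → Q) :
    (PowerSeries.mk fun k => ∑ r ∈ range (k + 1), c r * coeff k (z ^ (r + 1))) =
      z * composition z c := by
  ext k
  rw [coeff_mk, coeff_mul]
  simp only [composition, coeff_mk]
  have : ∀ p ∈ antidiagonal k, coeff p.1 z * ∑ r ∈ range (p.2 + 1), c r * coeff p.2 (z ^ r) =
      ∑ r ∈ range (k + 1), c r * (coeff p.1 z * coeff p.2 (z ^ r)) := by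
    intro p hp
    have := mem_antidiagonal.1 hp
    rw [mul_sum]
    rw [sum_subset (range_subset_range.2 (show p.2 + 1 ≤ k + 1 by omega))]
    · exact sum_congr rfl fun r _ => by ring
    · intro r _ hr
      rw [mem_range, not_lt] at hr
      rw [coeff_pow_mul_eq_zero hz (by omega)]
      simp
  rw [sum_congr rfl this, sum_comm]
  refine sum_congr rfl fun r _ => ?_
  rw [← mul_sum, pow_succ', coeff_mul]

/-- Splitting off the constant term turns a recurrence for the outer coefficients into an equation
between power series. -/
theorem composition_eq {z w : Q⟦X⟧} (hz : z = X * w) (c : ℕ → Q) :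
    composition z c = C (c 0) + z * composition z fun n => c (n + 1) := by
  rw [← mk_sum_shift hz]
  ext k
  rw [composition, coeff_mk, sum_range_succ', map_add, coeff_mk, pow_zero, coeff_one, coeff_C,
    sum_range_succ _ k, coeff_pow_mul_eq_zero hz (Nat.lt_succ_self k)]
  simp [add_comm]

theorem composition_add (z : Q⟦X⟧) (b c : ℕ → Q) :
    composition z (fun n => b n + c n) = composition z b + composition z c := by
  ext k
  simp [composition, add_mul, sum_add_distrib]

theorem composition_mul (z : Q⟦X⟧) (x : Q) (c : ℕ → Q) :
    composition z (fun n => x * c n) = C x * composition z c := by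
  ext k
  simp [composition, mul_sum, mul_assoc]

theorem two_ascFactorial (r : ℕ) : (2 : ℕ).ascFactorial r = (r + 1)! := by
  have := Nat.factorial_mul_ascFactorial 1 r
  rwa [Nat.factorial_one, one_mul, add_comm 1 r] at this

/-- Since e² = 0, at most one of the r chosen edges takes the second-order term. A first-order edge
gives a factor m and raises m by 1, a second-order edge gives m(m + 1) and raises m by 2. The rising
factorial is thus the same for each of the r positions of the exceptional edge. At r = 0 the
truncated exponent r - 1 is harmless because of the factor r. -/
theorem mk_step_pow (a : ℕ → Q) (g : ℕ → ℕ → Q) (q e : Q) (h1 : a 1 = q)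
    (h2 : a 2 = 2 * e * q ^ 2) (h3 : ∀ j, 3 ≤ j → a j = 0) (he : e * e = 0) (m r : ℕ) :
    PowerSeries.mk (((step a g) ^ r) (unitArray Q) m) =
      (m.ascFactorial r : Q⟦X⟧) * (C q * X * PowerSeries.mk (g 1)) ^ r +
      C e * (r * m.ascFactorial (r + 1) : Q⟦X⟧) * (C q * X) ^ 2 *
        (C q * X * PowerSeries.mk (g 1)) ^ (r - 1) * PowerSeries.mk (g 2) := by
  have he' : C e * C e = (0 : Q⟦X⟧) := by rw [← map_mul, he, map_zero]
  induction r generalizing m with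
  | zero =>
    simp only [pow_zero, Nat.ascFactorial_zero, Module.End.one_apply]
    ext k
    simp [unitArray, coeff_one]
  | succ r ih =>
    rw [pow_succ', Module.End.mul_apply, mk_step a g _ q e h1 h2 h3, ih, ih]
    have f1 : (m.ascFactorial (r + 1) : Q⟦X⟧) = m * (m + 1).ascFactorial r := by
      rw [Nat.ascFactorial_succ, ← Nat.succ_ascFactorial, Nat.cast_mul]
    have f2 : (m.ascFactorial (r + 1 + 1) : Q⟦X⟧) = m * (m + 1).ascFactorial (r + 1) := by
      rw [Nat.ascFactorial_succ, ← Nat.succ_ascFactorial, Nat.cast_mul]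
    have f3 : ((m + 1).ascFactorial (r + 1) : Q⟦X⟧) = (m + 1) * (m + 2).ascFactorial r := by
      rw [Nat.ascFactorial_succ, ← Nat.succ_ascFactorial, Nat.cast_mul]
      push_cast
      rfl
    rw [f2, f1, f3, Nat.add_sub_cancel]
    set z := C q * X * PowerSeries.mk (g 1) with hz
    set A := ((m + 2).ascFactorial r : Q⟦X⟧)
    set B := ((m + 1).ascFactorial r : Q⟦X⟧)
    cases r with
    | zero =>
      push_cast
      simp only [pow_zero, zero_mul, mul_zero, add_zero, mul_one, pow_one]
      rw [hz]
      ring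
    | succ r =>
      rw [Nat.add_sub_cancel]
      push_cast
      have hzz : C q * X * PowerSeries.mk (g 1) = z := rfl
      generalize PowerSeries.mk (g 2) = h at *
      generalize PowerSeries.mk (g 1) = g1 at *
      generalize ((m + 2).ascFactorial (r + 1 + 1) : Q⟦X⟧) = A'
      linear_combination (m * B * z ^ (r + 1) + C e * m * (r + 1) * (m + 1) * A * (C q * X) ^ 2 *
        z ^ r * h) * hzz + (m * (m + 1) * (C q * X) ^ 2 * h * ((r + 1) * A' * (C q * X) ^ 2 *
          z ^ r * h)) * he'

/-- Up to an error of second order, the fixed point of the walk recursion has the Catalan numbers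
as moments. -/
theorem root_series_eq (a : ℕ → Q) (g : ℕ → ℕ → Q) (q e : Q) (h1 : a 1 = q)
    (h2 : a 2 = 2 * e * q ^ 2) (h3 : ∀ j, 3 ≤ j → a j = 0) (he : e * e = 0)
    (c c' : ℕ → Q) (hc : ∀ r, c r * r ! = 1 - (r.choose 2 : Q) * e)
    (hc' : ∀ r, c' r * r ! = 1 - ((r.choose 2 : Q) + r) * e)
    (hg : ∀ m k, g m k =
      ∑ r ∈ range (k + 1), c' r * ((step a g) ^ r) (unitArray Q) m k)
    (f : ℕ → Q) (hf : ∀ k, f k = ∑ r ∈ range (k + 1), c r * ((step a g) ^ r) (unitArray Q) 1 k) :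
    PowerSeries.mk f = 1 + C q * X * PowerSeries.mk f ^ 2 := by
  have he' : C e * C e = (0 : Q⟦X⟧) := by rw [← map_mul, he, map_zero]
  set t : Q⟦X⟧ := C q * X with ht
  set g1 := PowerSeries.mk (g 1) with hg1
  set h := PowerSeries.mk (g 2) with hh
  set z := t * g1 with hz
  have hzX : z = X * (C q * g1) := by rw [hz, ht]; ring
  have hU : ∀ m r k, ((step a g) ^ r) (unitArray Q) m k =
      coeff k ((m.ascFactorial r : Q⟦X⟧) * z ^ r +
        C e * (r * m.ascFactorial (r + 1) : Q⟦X⟧) * t ^ 2 * z ^ (r - 1) * h) := by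
    intro m r k
    rw [← mk_step_pow a g q e h1 h2 h3 he, coeff_mk]
  set Y := composition z (fun _ => 1) with hY
  set T1 := composition z (fun n => (n : Q)) with hT1
  set T2 := composition z (fun n => (n.choose 2 : Q)) with hT2
  have rY : Y = 1 + z * Y := by
    have := composition_eq hzX (fun _ => 1)
    rwa [map_one] at this
  have rT1 : T1 = z * (T1 + Y) := by
    have := composition_eq hzX (fun n => (n : Q))
    simp only [Nat.cast_zero, map_zero, zero_add, Nat.cast_add, Nat.cast_one] at this
    rwa [composition_add] at this
  have rT2 : T2 = z * (T1 + T2) := by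
    have := composition_eq hzX (fun n => (n.choose 2 : Q))
    simp only [Nat.choose_zero_succ, Nat.cast_zero, map_zero, zero_add,
      Nat.choose_succ_succ' _ 1, Nat.cast_add, Nat.choose_one_right] at this
    rwa [composition_add] at this
  -- Both sides are (1 - z)⁻², the left one in the form Σ (n + 1) zⁿ.
  have sq : T1 + Y = Y ^ 2 := by
    have i1 : (1 - z) * (T1 + Y) = Y := by linear_combination rT1
    have i2 : (1 - z) * Y = 1 := by linear_combination rY
    linear_combination Y * i1 - (T1 + Y) * i2
  have series : ∀ (b : ℕ → Q) (m : ℕ), (PowerSeries.mk fun k => ∑ r ∈ range (k + 1), b r *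
      ((step a g) ^ r) (unitArray Q) m k) = PowerSeries.mk fun k => ∑ r ∈ range (k + 1),
        coeff k (C (b r) * ((m.ascFactorial r : Q⟦X⟧) * z ^ r +
        C e * (r * m.ascFactorial (r + 1) : Q⟦X⟧) * t ^ 2 * z ^ (r - 1) * h)) := by
    intro b m
    ext k
    rw [coeff_mk, coeff_mk]
    exact sum_congr rfl fun r _ => by rw [hU, coeff_C_mul]
  have hgm : ∀ m, PowerSeries.mk (g m) = PowerSeries.mk fun k => ∑ r ∈ range (k + 1), c' r *
      ((step a g) ^ r) (unitArray Q) m k := fun m => by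
    ext k
    rw [coeff_mk, coeff_mk, hg]
  have natC : ∀ n : ℕ, (n : Q⟦X⟧) = C (n : Q) := fun n => (map_natCast _ _).symm
  -- Inside a multiple of e only the zeroth order counts, where c' r · r! = 1.
  have low : ∀ (m : ℕ) (s : ℕ → Q), (∀ r, (m.ascFactorial r : Q) = s r * r !) →
      C e * PowerSeries.mk (g m) = C e * composition z s := by
    intro m s hs
    rw [hgm, series]
    ext k
    rw [coeff_C_mul, coeff_C_mul, composition, coeff_mk, coeff_mk, mul_sum, mul_sum]
    refine sum_congr rfl fun r _ => ?_
    rw [← coeff_C_mul, ← coeff_C_mul, ← coeff_C_mul]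
    congr 1
    have hcr : C (c' r) * C (r ! : Q) = (1 : Q⟦X⟧) - (C (r.choose 2 : Q) + C (r : Q)) * C e := by
      rw [← map_mul, hc']
      simp only [map_sub, map_mul, map_add, map_one]
    have hsr : (C (m.ascFactorial r : Q) : Q⟦X⟧) = C (s r) * C (r ! : Q) := by
      rw [← map_mul, hs]
    rw [natC (m.ascFactorial r), hsr]
    linear_combination (C e * C (s r) * z ^ r) * hcr + (C (c' r) * (r * m.ascFactorial (r + 1) :
      Q⟦X⟧) * t ^ 2 * z ^ (r - 1) * h - (C (r.choose 2 : Q) + C (r : Q)) * C (s r) * z ^ r) * he'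
  have eg : C e * g1 = C e * Y := low 1 _ fun r => by rw [Nat.one_ascFactorial, one_mul]
  have eh : C e * h = C e * (T1 + Y) := by
    rw [hT1, hY, ← composition_add]
    refine low 2 _ fun r => ?_
    rw [two_ascFactorial, Nat.factorial_succ]
    push_cast
    ring
  have ez : C e * z = C e * (t * Y) := by rw [hz]; linear_combination t * eg
  -- To zeroth order `g 2` is the square of `g 1`. An edge used to second order therefore weighs as
  -- much as two edges used to first order.
  have eth : C e * t ^ 2 * h = C e * z ^ 2 := by
    linear_combination t ^ 2 * eh + (C e * t ^ 2) * sq - (z + t * Y) * ez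
  -- First-order balance: the coefficients lose s r, and the exceptional edge contributes r(r + 1)
  -- z^(r+1) = 2·choose(r + 1, 2) z^(r+1), which sums to 2·T2.
  have high : ∀ (b : ℕ → Q) (s : ℕ → Q), (∀ r, b r * r ! = 1 - s r * e) →
      (PowerSeries.mk fun k => ∑ r ∈ range (k + 1), b r *
      ((step a g) ^ r) (unitArray Q) 1 k) = Y - C e * composition z s + C e * (2 * T2) := by
    intro b s hbs
    have e2 : C e * (2 * T2) = C e * PowerSeries.mk fun k => ∑ r ∈ range (k + 1),
        (2 * ((r + 1).choose 2 : Q)) * coeff k (z ^ (r + 1)) := by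
      rw [mk_sum_shift hzX, composition_mul, hT2, composition_eq hzX (fun n => (n.choose 2 : Q))]
      simp only [Nat.choose_zero_succ, Nat.cast_zero, map_zero, zero_add, map_ofNat]
      ring
    rw [series, e2]
    ext k
    rw [map_add, map_sub, coeff_C_mul, coeff_C_mul, hY, composition, composition, coeff_mk,
      coeff_mk, coeff_mk, coeff_mk, mul_sum, mul_sum, ← sum_sub_distrib, ← sum_add_distrib]
    refine sum_congr rfl fun r _ => ?_
    rw [one_mul, ← coeff_C_mul, ← coeff_C_mul, ← coeff_C_mul, ← coeff_C_mul, ← map_sub, ← map_add]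
    congr 1
    have hbr : C (b r) * C (r ! : Q) = (1 : Q⟦X⟧) - C (s r) * C e := by
      rw [← map_mul, hbs]
      simp only [map_sub, map_mul, map_one]
    rw [Nat.one_ascFactorial, Nat.one_ascFactorial, natC (r !)]
    have hchoose : (C (2 * ((r + 1).choose 2 : Q)) : Q⟦X⟧) = r * (r + 1) := by
      have : 2 * (r + 1).choose 2 = r * (r + 1) := by
        rw [Nat.choose_two_right, Nat.mul_div_cancel' (Nat.even_mul_pred_self _).two_dvd,
          Nat.add_sub_cancel, mul_comm]
      rw [show (2 * ((r + 1).choose 2 : Q)) = ((2 * (r + 1).choose 2 : ℕ) : Q) by push_cast; rfl,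
        this, map_natCast]
      push_cast
      rfl
    rw [hchoose, Nat.factorial_succ, Nat.cast_mul, natC (r !), Nat.cast_succ]
    cases r with
    | zero =>
      push_cast
      simp only [zero_mul, mul_zero, add_zero, pow_zero, mul_one] at hbr ⊢
      linear_combination hbr
    | succ r =>
      rw [Nat.add_sub_cancel]
      push_cast
      linear_combination (z ^ (r + 1) + (r + 1) * (r + 1 + 1) * C e * t ^ 2 * z ^ r * h) * hbr +
        (r + 1) * (r + 1 + 1) * z ^ r * eth -
        ((r + 1) * (r + 1 + 1) * t ^ 2 * z ^ r * h * C (s (r + 1))) * he'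
  have hf' : PowerSeries.mk f = Y + C e * T2 := by
    have : PowerSeries.mk f = PowerSeries.mk fun k => ∑ r ∈ range (k + 1), c r *
      ((step a g) ^ r) (unitArray Q) 1 k := by
      ext k
      rw [coeff_mk, coeff_mk, hf]
    rw [this, high c _ hc]
    ring
  have hg1' : g1 = Y + C e * (T2 - T1) := by
    rw [hg1, hgm, high c' _ hc', composition_add]
    ring
  rw [hf']
  -- In Y = 1 + zY substitute z = t·g1. The e-terms cancel because T2 = z(T1 + T2).
  linear_combination rY + Y * hz + (t * Y) * hg1' + C e * rT2 + (T1 + T2) * ez - t * T2 ^ 2 * he'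

end SquareZero

/-! ### Comparison with the Catalan numbers up to O(1/d²) -/

section Asymptotics

open Finset
open scoped Nat

theorem map_step_pow {R S : Type*} [CommRing R] [CommRing S] (ev : R →+* S) (a : ℕ → R)
    (g : ℕ → ℕ → R) (r m k : ℕ) :
    ev (((step a g) ^ r) (unitArray R) m k) =
      ((step (fun j => ev (a j)) fun j l => ev (g j l)) ^ r) (unitArray S) m k := by
  induction r generalizing m k with
  | zero => by_cases h : k = 0 <;> simp [unitArray, h]
  | succ r ih =>
    simp only [pow_succ', Module.End.mul_apply, step_apply, map_sum, map_mul, map_natCast, ih]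

/-- Each of the r edges keeps one factor x and hands x^(j-1) to its moment. For x = 1/d the factor
x^r normalises `D.choose r`, and the higher moments become small. -/
theorem scale_step_pow {R : Type*} [CommRing R] (x : R) (a : ℕ → R) (g : ℕ → ℕ → R) (r m k : ℕ) :
    x ^ k * ((step a g) ^ r) (unitArray R) m k =
      x ^ r * ((step (fun j => x ^ (j - 1) * a j) fun j l => x ^ l * g j l) ^ r)
        (unitArray R) m k := by
  induction r generalizing m k with
  | zero =>
    by_cases h : k = 0 <;> simp [unitArray, h]
  | succ r ih =>
    simp only [pow_succ', Module.End.mul_apply, step_apply, mul_sum]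
    refine sum_congr rfl fun j hj => sum_congr rfl fun p hp => ?_
    have := mem_antidiagonal.1 hp
    rw [mem_range] at hj
    have hk : x ^ k = x * x ^ j * x ^ p.1 * x ^ p.2 := by
      rw [← pow_succ', ← pow_add, ← pow_add]
      congr 1
      omega
    rw [hk, Nat.add_sub_cancel]
    linear_combination (x * x ^ j * x ^ p.2 * (m.multichoose (j + 1) : R) * a (j + 1) *
      g (j + 1) p.2) * ih (m + (j + 1)) p.1

theorem scale_layer {R : Type*} [CommRing R] (x : R) (a : ℕ → R) (g : ℕ → ℕ → R) (D m k : ℕ) :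
    x ^ k * layer a g D m k = ∑ r ∈ range (k + 1), ((D.choose r : R) * x ^ r) *
      ((step (fun j => x ^ (j - 1) * a j) fun j l => x ^ l * g j l) ^ r) (unitArray R) m k := by
  rw [layer_eq_sum, mul_sum]
  refine sum_congr rfl fun r _ => ?_
  rw [mul_assoc, ← scale_step_pow]
  ring

/-- The coefficients of the trees hanging from the root, at sufficient height. -/
def childCoeff {R : Type*} [CommRing R] (a : ℕ → R) (d m k : ℕ) : R := treeCoeff a d k (d - 1) m k

/-- Taking the height equal to the order removes the height: the stable coefficients solve one
self-consistent equation, for the root and for the children alike. -/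
theorem treeCoeff_eq_layer {R : Type*} [CommRing R] (a : ℕ → R) (d k D m : ℕ) :
    treeCoeff a d k D m k = layer a (childCoeff a d) D m k := by
  rw [treeCoeff_congr (h' := k + 1) (a' := a) (fun _ _ _ => rfl) le_rfl (Nat.le_succ k), treeCoeff]
  exact layer_congr (fun _ _ _ => rfl) (fun j l hl =>
    treeCoeff_congr (fun _ _ _ => rfl) hl.le le_rfl _ _) _ _

/-- Boundedness of a real sequence. -/
def IsBdd (f : ℕ → ℝ) : Prop := ∃ B, ∀ n, |f n| ≤ B

theorem IsBdd.add {f g : ℕ → ℝ} (hf : IsBdd f) (hg : IsBdd g) : IsBdd fun n => f n + g n := by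
  obtain ⟨A, hA⟩ := hf
  obtain ⟨B, hB⟩ := hg
  exact ⟨A + B, fun n => (abs_add_le _ _).trans (add_le_add (hA n) (hB n))⟩

theorem IsBdd.mul {f g : ℕ → ℝ} (hf : IsBdd f) (hg : IsBdd g) : IsBdd fun n => f n * g n := by
  obtain ⟨A, hA⟩ := hf
  obtain ⟨B, hB⟩ := hg
  refine ⟨A * B, fun n => ?_⟩
  rw [abs_mul]
  exact mul_le_mul (hA n) (hB n) (abs_nonneg _) ((abs_nonneg _).trans (hA n))

theorem IsBdd.const (c : ℝ) : IsBdd fun _ => c := ⟨|c|, fun _ => le_rfl⟩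

theorem IsBdd.sum {ι : Type*} {s : Finset ι} {f : ι → ℕ → ℝ} (hf : ∀ i ∈ s, IsBdd (f i)) :
    IsBdd fun n => ∑ i ∈ s, f i n := by
  classical
  induction s using Finset.induction_on with
  | empty => simpa using IsBdd.const 0
  | insert i s hi ih =>
    simp only [sum_insert hi]
    exact (hf i (mem_insert_self i s)).add (ih fun j hj => hf j (mem_insert_of_mem hj))

theorem IsBdd.step_pow {a : ℕ → ℕ → ℝ} {g : ℕ → ℕ → ℕ → ℝ} {k : ℕ}
    (ha : ∀ j, 1 ≤ j → j ≤ k → IsBdd fun n => a n j)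
    (hg : ∀ j l, l < k → IsBdd fun n => g n j l) (r m : ℕ) :
    IsBdd fun n => ((step (a n) (g n)) ^ r) (unitArray ℝ) m k := by
  induction r generalizing m k with
  | zero => exact IsBdd.const _
  | succ r ih =>
    simp only [pow_succ', Module.End.mul_apply, step_apply]
    refine IsBdd.sum fun j hj => ((IsBdd.const _).mul (ha _ (by omega) ?_)).mul
      (IsBdd.sum fun p hp => ?_)
    · rw [mem_range] at hj
      omega
    · have := mem_antidiagonal.1 hp
      rw [mem_range] at hj
      exact (ih (fun i h1 h2 => ha i h1 (by omega)) (fun i l hl => hg i l (by omega)) _).mul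
        (hg _ _ (by omega))

/-- The inverse of the degree `n + 2`. -/
noncomputable def invDegree (n : ℕ) : ℝ := 1 / ((n : ℝ) + 2)

theorem invDegree_pos (n : ℕ) : 0 < invDegree n := by unfold invDegree; positivity

theorem invDegree_le_one (n : ℕ) : invDegree n ≤ 1 := by
  unfold invDegree
  rw [div_le_one (by positivity)]
  have : (0 : ℝ) ≤ n := Nat.cast_nonneg n
  linarith

theorem isBdd_invDegree : IsBdd invDegree :=
  ⟨1, fun n => by rw [abs_of_pos (invDegree_pos n)]; exact invDegree_le_one n⟩

theorem isBdd_invDegree_pow (i : ℕ) : IsBdd fun n => invDegree n ^ i :=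
  ⟨1, fun n => by
    rw [abs_of_pos (pow_pos (invDegree_pos n) i)]
    exact pow_le_one₀ (invDegree_pos n).le (invDegree_le_one n)⟩

theorem invDegree_mul (n : ℕ) : ((n + 2 : ℕ) : ℝ) * invDegree n = 1 := by
  unfold invDegree
  push_cast
  field_simp

theorem invDegree_pow_mul (n k : ℕ) : invDegree n ^ k * ((n + 2 : ℕ) : ℝ) ^ k = 1 := by
  rw [← mul_pow, mul_comm, invDegree_mul, one_pow]

theorem isBdd_choose {D : ℕ → ℕ} (hD : ∀ n, D n ≤ n + 2) (r : ℕ) :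
    IsBdd fun n => ((D n).choose r : ℝ) * invDegree n ^ r := by
  refine ⟨1, fun n => ?_⟩
  rw [abs_of_nonneg (mul_nonneg (Nat.cast_nonneg _) (pow_nonneg (invDegree_pos n).le _)),
    ← invDegree_pow_mul n r, mul_comm]
  refine mul_le_mul_of_nonneg_left ?_ (pow_nonneg (invDegree_pos n).le _)
  exact_mod_cast (Nat.choose_le_pow (D n) r).trans (Nat.pow_le_pow_left (hD n) r)

theorem isBdd_scaled_layer {a : ℕ → ℕ → ℝ} {g : ℕ → ℕ → ℕ → ℝ} {D : ℕ → ℕ} {k : ℕ}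
    (hD : ∀ n, D n ≤ n + 2) (ha : ∀ j, 1 ≤ j → j ≤ k → IsBdd fun n => a n j)
    (hg : ∀ j l, l < k → IsBdd fun n => invDegree n ^ l * g n j l) (m : ℕ) :
    IsBdd fun n => invDegree n ^ k * layer (a n) (g n) (D n) m k := by
  simp only [scale_layer]
  exact IsBdd.sum fun r _ => (isBdd_choose hD r).mul
    (IsBdd.step_pow (fun j h1 h2 => (isBdd_invDegree_pow _).mul (ha j h1 h2)) hg r m)

/-- A joint induction: the moment of order k needs the children at lower orders, and the children at
order k need that moment. -/
theorem isBdd_fixedSeq_and_childCoeff (k : ℕ) :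
    (IsBdd fun n => fixedSeq (n + 2) k) ∧
    ∀ m, IsBdd fun n => invDegree n ^ k * childCoeff (fixedSeq (n + 2)) (n + 2) m k := by
  induction k using Nat.strong_induction_on with
  | _ k ih =>
  have h1 : IsBdd fun n => fixedSeq (n + 2) k := by
    rcases Nat.lt_or_ge k 2 with hk | hk
    · interval_cases k
      · simpa only [fixedSeq_zero] using IsBdd.const 1
      · simpa only [fixedSeq_one] using IsBdd.const (1 / 4)
    · obtain ⟨B, hB⟩ := isBdd_scaled_layer (a := fun n => cutoff (fixedSeq (n + 2)) k)
        (g := fun n => childCoeff (fixedSeq (n + 2)) (n + 2)) (D := fun n => n + 2) (k := k)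
        (fun n => le_rfl) (fun j hj1 hj2 => by
          rcases lt_or_eq_of_le hj2 with h | rfl
          · simpa [cutoff, h] using (ih j h).1
          · simpa [cutoff] using IsBdd.const 0) (fun j l hl => (ih l hl).2 j) 1
      -- The 2 comes from d^k - d ≥ d^k / 2.
      refine ⟨2 * B, fun n => ?_⟩
      have hd := pow_sub_self_pos (d := n + 2) (k := k) (by omega) hk
      have e : treeCoeff (cutoff (fixedSeq (n + 2)) k) (n + 2) k (n + 2) 1 k =
          layer (cutoff (fixedSeq (n + 2)) k) (childCoeff (fixedSeq (n + 2)) (n + 2)) (n + 2)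
            1 k := by
        rw [treeCoeff_eq_layer]
        exact layer_congr (fun _ _ _ => rfl) (fun j l hl => treeCoeff_congr (fun i _ hi => by
          simp [cutoff, show i < k by omega]) le_rfl le_rfl _ _) _ _
      have h := hB n
      beta_reduce at h ⊢
      rw [← e] at h
      rw [fixedSeq_of_two_le _ hk, abs_div, abs_of_pos (a := ((n + 2 : ℕ) : ℝ) ^ k - _)
        (by linarith), div_le_iff₀ (by linarith)]
      rw [abs_mul, abs_of_pos (pow_pos (invDegree_pos n) k)] at h
      have hp := invDegree_pow_mul n k
      have hpos : (0 : ℝ) < ((n + 2 : ℕ) : ℝ) ^ k := by positivity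
      have hT : |treeCoeff (cutoff (fixedSeq (n + 2)) k) (n + 2) k (n + 2) 1 k| ≤
          ((n + 2 : ℕ) : ℝ) ^ k * B := by
        have := mul_le_mul_of_nonneg_left h hpos.le
        rwa [← mul_assoc, mul_comm _ (invDegree n ^ k), hp, one_mul] at this
      refine hT.trans ?_
      have hB0 : 0 ≤ B := (abs_nonneg _).trans (hB 0)
      have h2 : 2 * ((n + 2 : ℕ) : ℝ) ≤ ((n + 2 : ℕ) : ℝ) ^ k := by
        have h2' : (2 : ℝ) ≤ ((n + 2 : ℕ) : ℝ) := by exact_mod_cast (by omega)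
        have : ((n + 2 : ℕ) : ℝ) ^ 2 ≤ ((n + 2 : ℕ) : ℝ) ^ k :=
          pow_le_pow_right₀ (by linarith) hk
        nlinarith
      nlinarith
  refine ⟨h1, fun m => ?_⟩
  have e : ∀ n, childCoeff (fixedSeq (n + 2)) (n + 2) m k =
      layer (fixedSeq (n + 2)) (childCoeff (fixedSeq (n + 2)) (n + 2)) (n + 1) m k :=
    fun n => treeCoeff_eq_layer _ _ _ _ _
  simp only [e]
  refine isBdd_scaled_layer (fun n => by omega) (fun j hj1 hj2 => ?_) (fun j l hl => (ih l hl).2 j) m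
  rcases lt_or_eq_of_le hj2 with h | rfl
  · exact (ih j h).1
  · exact h1

/-- A bounded sequence as an element of the ring of bounded sequences. -/
noncomputable def bddSeq (f : ℕ → ℝ) (hf : IsBdd f) : ℕ →ᵇ ℝ :=
  BoundedContinuousFunction.ofNormedAddCommGroupDiscrete f hf.choose hf.choose_spec

theorem cast_choose_mul_invDegree (n r : ℕ) :
    ((n + 2).choose r : ℝ) * invDegree n ^ r * r ! = ∏ i ∈ range r, (1 - i * invDegree n) := by
  rw [mul_right_comm, ← Nat.cast_mul, mul_comm (Nat.choose _ _), ← Nat.descFactorial_eq_factorial_mul_choose]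
  induction r with
  | zero => simp
  | succ r ih =>
    rw [prod_range_succ, ← ih, Nat.descFactorial_succ, Nat.cast_mul, pow_succ]
    rcases le_or_gt r (n + 2) with h | h
    · rw [Nat.cast_sub h]
      linear_combination (((n + 2).descFactorial r : ℝ) * invDegree n ^ r) * invDegree_mul n
    · rw [Nat.descFactorial_eq_zero_iff_lt.2 h]
      simp

theorem cast_choose_pred_mul_invDegree (n r : ℕ) :
    ((n + 1).choose r : ℝ) * invDegree n ^ r * r ! =
      ∏ i ∈ range r, (1 - (i + 1 : ℕ) * invDegree n) := by
  rw [mul_right_comm, ← Nat.cast_mul, mul_comm (Nat.choose _ _), ← Nat.descFactorial_eq_factorial_mul_choose]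
  induction r with
  | zero => simp
  | succ r ih =>
    rw [prod_range_succ, ← ih, Nat.descFactorial_succ, Nat.cast_mul, pow_succ]
    rcases le_or_gt r (n + 1) with h | h
    · rw [Nat.cast_sub h]
      have := invDegree_mul n
      push_cast at this ⊢
      linear_combination (((n + 1).descFactorial r : ℝ) * invDegree n ^ r) * this
    · rw [Nat.descFactorial_eq_zero_iff_lt.2 h]
      simp

/-- To first order only the sum of the b i matters. It is choose(r, 2) at the root and choose(r, 2)
+ r at a vertex with d - 1 children. -/
theorem prod_one_sub_mul {Q : Type*} [CommRing Q] {e : Q} (he : e * e = 0) (b : ℕ → ℕ) (r : ℕ) :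
    ∏ i ∈ range r, (1 - (b i : Q) * e) = 1 - (∑ i ∈ range r, b i : ℕ) * e := by
  induction r with
  | zero => simp
  | succ r ih =>
    rw [prod_range_succ, ih, sum_range_succ]
    push_cast
    linear_combination ((∑ i ∈ range r, (b i : Q)) * b r) * he

theorem coeff_eq_catalan {Q : Type*} [CommRing Q] {q : Q} {F : PowerSeries Q}
    (hF : F = 1 + PowerSeries.C q * PowerSeries.X * F ^ 2) (k : ℕ) :
    PowerSeries.coeff k F = q ^ k * catalan k := by
  induction k using Nat.strong_induction_on with
  | _ k ih =>
  rw [hF, show PowerSeries.C q * PowerSeries.X * F ^ 2 =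
    PowerSeries.C q * (PowerSeries.X * (F * F)) by ring]
  cases k with
  | zero => simp
  | succ k =>
    rw [map_add, PowerSeries.coeff_C_mul, PowerSeries.coeff_succ_X_mul, PowerSeries.coeff_mul,
      catalan_succ', PowerSeries.coeff_one, if_neg (by omega), zero_add, mul_sum, Nat.cast_sum,
      mul_sum]
    refine sum_congr rfl fun p hp => ?_
    have := mem_antidiagonal.1 hp
    rw [ih _ (by omega), ih _ (by omega), ← this]
    push_cast
    ring

/-- The even moments of the eigendistribution agree with those of the semicircle distribution up to
an error of order `1 / d ^ 2`. -/
theorem fixedSeq_asymptotics (k : ℕ) :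
    ∃ B : ℝ, ∀ d : ℕ, 2 ≤ d → |fixedSeq d k - (1 / 4) ^ k * catalan k| ≤ B / (d : ℝ) ^ 2 := by
  let ε : ℕ →ᵇ ℝ := bddSeq invDegree isBdd_invDegree
  -- An O(1/d²) bound is a congruence modulo ε² in the ring of bounded sequences, indexed by n = d -
  -- 2. The sup norm of the quotient is the implied constant.
  obtain ⟨Q, hQ, π, hπ⟩ : ∃ (Q : Type) (_ : CommRing Q) (π : (ℕ →ᵇ ℝ) →+* Q),
      ∀ u, π u = 0 ↔ ε ^ 2 ∣ u :=
    ⟨(ℕ →ᵇ ℝ) ⧸ Ideal.span {ε ^ 2}, inferInstance, Ideal.Quotient.mk _, fun u => by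
      rw [Ideal.Quotient.eq_zero_iff_mem, Ideal.mem_span_singleton]⟩
  have hF : ∀ k, IsBdd fun n => fixedSeq (n + 2) k := fun k => (isBdd_fixedSeq_and_childCoeff k).1
  have hG := fun k => (isBdd_fixedSeq_and_childCoeff k).2
  have hA : ∀ j, IsBdd fun n => invDegree n ^ (j - 1) * fixedSeq (n + 2) j :=
    fun j => (isBdd_invDegree_pow _).mul (hF j)
  let A : ℕ → (ℕ →ᵇ ℝ) := fun j => bddSeq _ (hA j)
  let G : ℕ → ℕ → (ℕ →ᵇ ℝ) := fun m l => bddSeq _ (hG l m)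
  let f : ℕ → (ℕ →ᵇ ℝ) := fun k => bddSeq _ (hF k)
  let c : ℕ → (ℕ →ᵇ ℝ) := fun r => bddSeq _ (isBdd_choose (D := fun n => n + 2) (fun n => le_rfl) r)
  let c' : ℕ → (ℕ →ᵇ ℝ) := fun r =>
    bddSeq _ (isBdd_choose (D := fun n => n + 1) (fun n => by omega) r)
  let quarter : ℕ →ᵇ ℝ := bddSeq _ (IsBdd.const (1 / 4))
  have evalHom : ∀ n : ℕ, ∃ ev : (ℕ →ᵇ ℝ) →+* ℝ, ∀ u, ev u = u n := fun n =>
    ⟨{ toFun := fun u => u n, map_one' := rfl, map_mul' := fun _ _ => rfl, map_zero' := rfl,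
       map_add' := fun _ _ => rfl }, fun _ => rfl⟩
  have hε : π ε * π ε = 0 := by
    rw [← map_mul, ← sq]
    exact (hπ _).2 dvd_rfl
  have evalStep : ∀ n r m k, ((step A G) ^ r) (unitArray (ℕ →ᵇ ℝ)) m k n =
      ((step (fun j => invDegree n ^ (j - 1) * fixedSeq (n + 2) j) fun m l =>
        invDegree n ^ l * childCoeff (fixedSeq (n + 2)) (n + 2) m l) ^ r) (unitArray ℝ) m k := by
    intro n r m k
    obtain ⟨ev, hev⟩ := evalHom n
    rw [← hev, map_step_pow]
    simp only [hev]
    rfl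
  have hf : ∀ k, f k = ∑ r ∈ range (k + 1), c r * ((step A G) ^ r) (unitArray (ℕ →ᵇ ℝ)) 1 k := by
    intro k
    ext n
    rw [BoundedContinuousFunction.sum_apply]
    simp only [BoundedContinuousFunction.mul_apply, evalStep]
    refine Eq.trans ?_ (scale_layer (invDegree n) (fixedSeq (n + 2))
      (childCoeff (fixedSeq (n + 2)) (n + 2)) (n + 2) 1 k)
    rw [← treeCoeff_eq_layer, fixedSeq_spec (by omega), ← mul_assoc, invDegree_pow_mul, one_mul]
    rfl
  have hg : ∀ m k, G m k =
      ∑ r ∈ range (k + 1), c' r * ((step A G) ^ r) (unitArray (ℕ →ᵇ ℝ)) m k := by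
    intro m k
    ext n
    rw [BoundedContinuousFunction.sum_apply]
    simp only [BoundedContinuousFunction.mul_apply, evalStep]
    refine Eq.trans ?_ (scale_layer (invDegree n) (fixedSeq (n + 2))
      (childCoeff (fixedSeq (n + 2)) (n + 2)) (n + 1) m k)
    rw [← treeCoeff_eq_layer]
    rfl
  have hprod : ∀ (b : ℕ → ℕ) r, π (∏ i ∈ range r, (1 - (b i : ℕ →ᵇ ℝ) * ε)) =
      1 - (∑ i ∈ range r, b i : ℕ) * π ε := by
    intro b r
    rw [← prod_one_sub_mul hε]
    simp
  have evalCast : ∀ i n : ℕ, (i : ℕ →ᵇ ℝ) n = i := fun i n => rfl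
  have evalProd : ∀ (b : ℕ → ℕ) r n, (∏ i ∈ range r, (1 - (b i : ℕ →ᵇ ℝ) * ε)) n =
      ∏ i ∈ range r, (1 - (b i : ℝ) * invDegree n) := by
    intro b r n
    obtain ⟨ev, hev⟩ := evalHom n
    rw [← hev, map_prod]
    simp only [hev]
    rfl
  have hsum : ∀ r, ∑ i ∈ range r, i = r.choose 2 := fun r => by
    rw [sum_range_id, Nat.choose_two_right]
  have hc : ∀ r, π (c r) * r ! = 1 - (r.choose 2 : Q) * π ε := by
    intro r
    have : c r * (r ! : ℕ →ᵇ ℝ) = ∏ i ∈ range r, (1 - (i : ℕ →ᵇ ℝ) * ε) := by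
      ext n
      rw [evalProd (fun i => i), ← cast_choose_mul_invDegree]
      rfl
    rw [← map_natCast π, ← map_mul, this, hprod (fun i => i), hsum]
  have hc' : ∀ r, π (c' r) * r ! = 1 - ((r.choose 2 : Q) + r) * π ε := by
    intro r
    have : c' r * (r ! : ℕ →ᵇ ℝ) = ∏ i ∈ range r, (1 - ((i + 1 : ℕ) : ℕ →ᵇ ℝ) * ε) := by
      ext n
      rw [evalProd (fun i => i + 1), ← cast_choose_pred_mul_invDegree]
      rfl
    rw [← map_natCast π, ← map_mul, this, hprod (fun i => i + 1), sum_add_distrib, hsum]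
    simp
  have a1 : π (A 1) = π quarter := by
    congr 1
    ext n
    show invDegree n ^ (1 - 1) * fixedSeq (n + 2) 1 = 1 / 4
    simp [fixedSeq_one]
  have a2 : π (A 2) = 2 * π ε * π quarter ^ 2 := by
    rw [← map_ofNat π 2, ← map_pow, ← map_mul, ← map_mul]
    congr 1
    ext n
    show invDegree n ^ (2 - 1) * fixedSeq (n + 2) 2 = 2 * invDegree n * (1 / 4) ^ 2
    rw [fixedSeq_two (by omega)]
    norm_num
    ring
  have a3 : ∀ j, 3 ≤ j → π (A j) = 0 := by
    intro j hj
    -- The scaled moment carries ε^(j-1), which is ε² times the bounded sequence ε^(j-3) for j ≥ 3.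
    refine (hπ _).2 ?_
    refine ⟨bddSeq _ ((isBdd_invDegree_pow (j - 3)).mul (hF j)), ?_⟩
    ext n
    show invDegree n ^ (j - 1) * fixedSeq (n + 2) j =
      invDegree n ^ 2 * (invDegree n ^ (j - 3) * fixedSeq (n + 2) j)
    rw [← mul_assoc, ← pow_add, show 2 + (j - 3) = j - 1 by omega]
  have main := root_series_eq (fun j => π (A j)) (fun m l => π (G m l)) (π quarter) (π ε) a1 a2 a3
    hε (fun r => π (c r)) (fun r => π (c' r)) hc hc' (fun m k => by
      rw [hg m k, map_sum]
      exact sum_congr rfl fun r _ => by rw [map_mul, map_step_pow]) (fun k => π (f k))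
    (fun k => by
      rw [hf k, map_sum]
      exact sum_congr rfl fun r _ => by rw [map_mul, map_step_pow])
  have hk := coeff_eq_catalan main k
  rw [PowerSeries.coeff_mk, ← map_natCast π, ← map_pow, ← map_mul, ← sub_eq_zero,
    ← map_sub, hπ] at hk
  obtain ⟨u, hu⟩ := hk
  refine ⟨‖u‖, fun d hd => ?_⟩
  obtain ⟨n, rfl⟩ : ∃ n, d = n + 2 := ⟨d - 2, by omega⟩
  have h := DFunLike.congr_fun hu n
  have h' : fixedSeq (n + 2) k - (1 / 4) ^ k * catalan k = invDegree n ^ 2 * u n := h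
  rw [h', abs_mul, abs_of_pos (pow_pos (invDegree_pos n) 2), invDegree, one_div, inv_pow, mul_comm,
    ← div_eq_mul_inv]
  push_cast
  gcongr
  exact u.norm_coe_le_norm n

end Asymptotics

/-! ### Moments of the semicircle distribution -/

section Semicircle

/-- Integration of the derivative of x^(2k+1) (1 - x²)^(3/2), which vanishes at ±1.
Differentiability is asked only in the open interval, since the square root is not differentiable at
the ends. -/
theorem sqrt_integral_recursion (k : ℕ) :
    (2 * k + 4 : ℝ) * ∫ x in (-1 : ℝ)..1, x ^ (2 * (k + 1)) * Real.sqrt (1 - x ^ 2) =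
      (2 * k + 1) * ∫ x in (-1 : ℝ)..1, x ^ (2 * k) * Real.sqrt (1 - x ^ 2) := by
  have hint : ∀ n : ℕ, IntervalIntegrable (fun x : ℝ => x ^ n * Real.sqrt (1 - x ^ 2))
      volume (-1) 1 := fun n => Continuous.intervalIntegrable (by fun_prop) _ _
  have hderiv : ∀ x ∈ Set.Ioo (-1 : ℝ) 1,
      HasDerivAt (fun x : ℝ => x ^ (2 * k + 1) * ((1 - x ^ 2) * Real.sqrt (1 - x ^ 2)))
        ((2 * k + 1) * (x ^ (2 * k) * Real.sqrt (1 - x ^ 2)) -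
          (2 * k + 4) * (x ^ (2 * (k + 1)) * Real.sqrt (1 - x ^ 2))) x := by
    intro x hx
    have hpos : 0 < 1 - x ^ 2 := by nlinarith [hx.1, hx.2]
    have h1 : HasDerivAt (fun x : ℝ => 1 - x ^ 2) (-(2 * x)) x := by
      simpa using (hasDerivAt_pow 2 x).const_sub 1
    have h2 := h1.sqrt hpos.ne'
    have h3 := (hasDerivAt_pow (2 * k + 1) x).mul (h1.mul h2)
    refine h3.congr_deriv ?_
    have hs : Real.sqrt (1 - x ^ 2) * Real.sqrt (1 - x ^ 2) = 1 - x ^ 2 :=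
      Real.mul_self_sqrt hpos.le
    have hs0 : Real.sqrt (1 - x ^ 2) ≠ 0 := (Real.sqrt_pos.2 hpos).ne'
    simp only [Pi.mul_apply, Nat.add_sub_cancel]
    generalize Real.sqrt (1 - x ^ 2) = s at hs hs0
    push_cast
    field_simp
    linear_combination (x ^ (2 * k) * x ^ 2) * hs
  have hftc := intervalIntegral.integral_eq_sub_of_hasDerivAt_of_le (by norm_num : (-1 : ℝ) ≤ 1)
    (by fun_prop) hderiv (((hint (2 * k)).const_mul _).sub ((hint (2 * (k + 1))).const_mul _))
  rw [intervalIntegral.integral_sub ((hint _).const_mul _) ((hint _).const_mul _),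
    intervalIntegral.integral_const_mul, intervalIntegral.integral_const_mul] at hftc
  norm_num at hftc
  linarith

theorem sqrt_integral (k : ℕ) :
    ∫ x in (-1 : ℝ)..1, x ^ (2 * k) * Real.sqrt (1 - x ^ 2) =
      Real.pi / 2 * ((1 / 4) ^ k * catalan k) := by
  induction k with
  | zero => simpa using integral_sqrt_one_sub_sq
  | succ k ih =>
    have h := sqrt_integral_recursion k
    rw [ih] at h
    have hcat : ((k : ℝ) + 2) * catalan (k + 1) = 2 * (2 * k + 1) * catalan k := by
      have h1 := succ_mul_catalan_eq_centralBinom (k + 1)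
      have h2 := succ_mul_catalan_eq_centralBinom k
      have h3 := Nat.succ_mul_centralBinom_succ k
      rw [← h1, ← h2] at h3
      have h4 : (k + 1) * ((k + 2) * catalan (k + 1)) = (k + 1) * (2 * (2 * k + 1) * catalan k) := by
        rw [h3]; ring
      exact_mod_cast Nat.eq_of_mul_eq_mul_left (Nat.succ_pos k) h4
    have hk : (2 * k + 4 : ℝ) ≠ 0 := by positivity
    refine mul_left_cancel₀ hk ?_
    rw [h, pow_succ]
    linear_combination (-(Real.pi / 4) * (1 / 4) ^ k) * hcat

theorem mom_semicircle (k : ℕ) : mom semicircle (2 * k) = (1 / 4) ^ k * catalan k := by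
  have hm : Measurable fun x : ℝ => ENNReal.ofReal (2 / Real.pi * Real.sqrt (1 - x ^ 2)) := by
    fun_prop
  rw [mom, semicircle, integral_withDensity_eq_integral_toReal_smul hm
    (ae_of_all _ fun _ => ENNReal.ofReal_lt_top)]
  have hsupp : ∀ x : ℝ, x ∉ Set.Ioc (-1 : ℝ) 1 → Real.sqrt (1 - x ^ 2) = 0 := by
    intro x hx
    refine Real.sqrt_eq_zero_of_nonpos ?_
    rw [Set.mem_Ioc, not_and_or, not_lt, not_le] at hx
    rcases hx with hx | hx <;> nlinarith
  rw [← setIntegral_eq_integral_of_forall_compl_eq_zero (s := Set.Ioc (-1 : ℝ) 1)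
    (fun x hx => by simp [hsupp x hx]), ← intervalIntegral.integral_of_le (by norm_num)]
  have : ∀ x : ℝ, (ENNReal.ofReal (2 / Real.pi * Real.sqrt (1 - x ^ 2))).toReal • x ^ (2 * k) =
      2 / Real.pi * (x ^ (2 * k) * Real.sqrt (1 - x ^ 2)) := by
    intro x
    rw [ENNReal.toReal_ofReal (by positivity), smul_eq_mul]
    ring
  simp only [this]
  rw [intervalIntegral.integral_const_mul, sqrt_integral]
  have := Real.pi_pos
  field_simp

theorem catalan_four : catalan 4 = 14 := by
  rw [catalan_eq_centralBinom_div, Nat.centralBinom]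
  rfl

theorem mom_semicircle_small : mom semicircle 2 = 1 / 4 ∧ mom semicircle 4 = 1 / 8 ∧
    mom semicircle 6 = 5 / 64 ∧ mom semicircle 8 = 7 / 128 := by
  refine ⟨(mom_semicircle 1).trans ?_, (mom_semicircle 2).trans ?_, (mom_semicircle 3).trans ?_,
    (mom_semicircle 4).trans ?_⟩
  · rw [catalan_one]; norm_num
  · rw [catalan_two]; norm_num
  · rw [catalan_three]; norm_num
  · rw [catalan_four]; norm_num

end Semicircle

/-! ### Determinacy, tightness and convergence of moments -/

section MomentProblem

open scoped Nat ENNReal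

/-- The Taylor terms of cosh are nonnegative, so it can be integrated term by term. The growth bound
leaves a geometric series with ratio Bt², and exp ≤ 2 cosh. -/
theorem integrable_exp_mul_of_moment_growth {W : Measure ℝ}
    (hint : ∀ k : ℕ, Integrable (fun x : ℝ => x ^ k) W) {A B : ℝ} (hB : 0 ≤ B)
    (hW : ∀ k, mom W (2 * k) ≤ A * B ^ k * (2 * k)!) {t : ℝ} (ht : B * t ^ 2 < 1) :
    Integrable (fun x => Real.exp (t * x)) W := by
  have hcosh : Integrable (fun x => Real.cosh (t * x)) W := by
    refine ⟨(by fun_prop), ?_⟩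
    rw [hasFiniteIntegral_iff_norm]
    have e : ∀ x : ℝ, ENNReal.ofReal ‖Real.cosh (t * x)‖ =
        ∑' k : ℕ, ENNReal.ofReal ((t * x) ^ (2 * k) / (2 * k)!) := by
      intro x
      have hs := Real.hasSum_cosh (t * x)
      rw [Real.norm_of_nonneg (Real.cosh_pos _).le, ← hs.tsum_eq,
        ENNReal.ofReal_tsum_of_nonneg (fun k => ?_) hs.summable]
      have : 0 ≤ (t * x) ^ (2 * k) := (even_two_mul k).pow_nonneg _
      positivity
    simp only [e]
    rw [lintegral_tsum (fun k => by fun_prop)]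
    have hg : Summable fun k : ℕ => A * (B * t ^ 2) ^ k :=
      (summable_geometric_of_lt_one (by positivity) ht).mul_left A
    refine lt_of_le_of_lt (ENNReal.tsum_le_tsum fun k => ?_) (hg.tsum_ofReal_lt_top)
    have e2 : ∀ x : ℝ, (t * x) ^ (2 * k) / (2 * k)! = t ^ (2 * k) / (2 * k)! * x ^ (2 * k) := by
      intro x; rw [mul_pow]; ring
    have ht2 : 0 ≤ t ^ (2 * k) := (even_two_mul k).pow_nonneg _
    simp only [e2]
    rw [← ofReal_integral_eq_lintegral_ofReal ((hint _).const_mul _) (ae_of_all _ fun x => by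
      have : 0 ≤ x ^ (2 * k) := (even_two_mul k).pow_nonneg _
      simp only [Pi.zero_apply]
      positivity)]
    refine ENNReal.ofReal_le_ofReal ?_
    rw [integral_const_mul]
    calc t ^ (2 * k) / (2 * k)! * ∫ x, x ^ (2 * k) ∂W
        ≤ t ^ (2 * k) / (2 * k)! * (A * B ^ k * (2 * k)!) :=
          mul_le_mul_of_nonneg_left (hW k) (by positivity)
      _ = A * (B * t ^ 2) ^ k := by
          rw [mul_pow, ← pow_mul]
          field_simp
  refine Integrable.mono' (hcosh.const_mul 2) (by fun_prop) (ae_of_all _ fun x => ?_)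
  rw [Real.norm_of_nonneg (Real.exp_pos _).le, Real.cosh_eq]
  have := (Real.exp_pos (-(t * x))).le
  linarith

theorem zero_mem_interior_integrableExpSet {W : Measure ℝ}
    (hint : ∀ k : ℕ, Integrable (fun x : ℝ => x ^ k) W) {A B : ℝ} (hB : 0 ≤ B)
    (hW : ∀ k, mom W (2 * k) ≤ A * B ^ k * (2 * k)!) :
    0 ∈ interior (integrableExpSet id W) := by
  rw [mem_interior_iff_mem_nhds]
  have hc : Tendsto (fun t : ℝ => B * t ^ 2) (𝓝 0) (𝓝 0) := by
    have : Continuous fun t : ℝ => B * t ^ 2 := by fun_prop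
    simpa using this.tendsto 0
  filter_upwards [hc.eventually (gt_mem_nhds zero_lt_one)] with t ht
  exact integrable_exp_mul_of_moment_growth hint hB hW ht

/-- Both functions are analytic at 0 and the moments are their Taylor derivatives there. -/
theorem complexMGF_eventuallyEq {W W' : Measure ℝ}
    (h0 : 0 ∈ interior (integrableExpSet id W)) (h0' : 0 ∈ interior (integrableExpSet id W'))
    (h : ∀ k, mom W k = mom W' k) : complexMGF id W =ᶠ[𝓝 0] complexMGF id W' := by
  have hd : ∀ (V : Measure ℝ), 0 ∈ interior (integrableExpSet id V) → ∀ n,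
      iteratedDeriv n (complexMGF id V) 0 = (mom V n : ℂ) := by
    intro V hV n
    rw [iteratedDeriv_complexMGF (by simpa using hV), mom, ← integral_complex_ofReal]
    simp
  have s := (analyticAt_complexMGF (X := id) (μ := W) (z := 0) (by simpa using h0)).hasFPowerSeriesAt
  have s' := (analyticAt_complexMGF (X := id) (μ := W') (z := 0)
    (by simpa using h0')).hasFPowerSeriesAt
  simp only [hd W h0, hd W' h0', h] at s s'
  filter_upwards [s.eventually_hasSum_sub, s'.eventually_hasSum_sub] with z hz hz'
  exact hz.unique hz'

/-- A distribution whose moments do not grow too fast is determined by its moments. -/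
theorem eq_of_moments_eq {W W' : Measure ℝ} [IsProbabilityMeasure W] [IsProbabilityMeasure W']
    (hint : ∀ k : ℕ, Integrable (fun x : ℝ => x ^ k) W)
    (hint' : ∀ k : ℕ, Integrable (fun x : ℝ => x ^ k) W') {A B : ℝ} (hB : 0 ≤ B)
    (hW : ∀ k, mom W (2 * k) ≤ A * B ^ k * (2 * k)!) (h : ∀ k, mom W k = mom W' k) : W = W' := by
  have h0 := zero_mem_interior_integrableExpSet hint hB hW
  have h0' := zero_mem_interior_integrableExpSet hint' hB (fun k => h (2 * k) ▸ hW k)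
  have hev := complexMGF_eventuallyEq h0 h0' h
  -- The identity theorem extends the agreement near 0 to the vertical strip over U. The strip
  -- contains the imaginary axis, where the function is the characteristic function.
  set U : Set ℝ := interior (integrableExpSet id W) ∩ interior (integrableExpSet id W')
  have hUconv : Convex ℝ U := convex_integrableExpSet.interior.inter convex_integrableExpSet.interior
  have hpre : IsPreconnected (Complex.re ⁻¹' U) :=
    (hUconv.linear_preimage Complex.reLm).isPreconnected
  have heq : Set.EqOn (complexMGF id W) (complexMGF id W') (Complex.re ⁻¹' U) := by
    refine AnalyticOnNhd.eqOn_of_preconnected_of_eventuallyEq (z₀ := 0)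
      (fun z hz => analyticAt_complexMGF hz.1) (fun z hz => analyticAt_complexMGF hz.2) hpre ?_ hev
    exact ⟨by simpa using h0, by simpa using h0'⟩
  refine Measure.ext_of_charFun ?_
  ext t
  rw [← complexMGF_id_mul_I, ← complexMGF_id_mul_I]
  exact heq ⟨by simpa using h0, by simpa using h0'⟩

/-- The powers of the variable, cut off at `R` and `-R`. -/
def clampPow (R : ℝ) (n : ℕ) : ℝ → ℝ := fun x => (max (-R) (min x R)) ^ n

theorem abs_clamp_le {R x : ℝ} (hR : 0 ≤ R) : |max (-R) (min x R)| ≤ R :=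
  abs_le.2 ⟨le_max_left _ _, max_le (by linarith) (min_le_right _ _)⟩

theorem exists_bcf_clampPow {R : ℝ} (hR : 0 ≤ R) (n : ℕ) :
    ∃ f : ℝ →ᵇ ℝ, ∀ x, f x = clampPow R n x :=
  ⟨BoundedContinuousFunction.ofNormedAddCommGroup (clampPow R n) (by unfold clampPow; fun_prop)
    (R ^ n) fun x => by
      rw [clampPow, norm_pow]
      exact pow_le_pow_left₀ (norm_nonneg _) (abs_clamp_le hR) n, fun _ => rfl⟩

/-- Truncation changes the power only where |x| > R, and there |x|^n ≤ x^(2n) / R^n. -/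
theorem abs_pow_sub_clampPow_le {R : ℝ} (hR : 1 ≤ R) (n : ℕ) (x : ℝ) :
    |x ^ n - clampPow R n x| ≤ 2 / R ^ n * x ^ (2 * n) := by
  have hx2 : 0 ≤ x ^ (2 * n) := (even_two_mul n).pow_nonneg _
  have hRn : 0 < R ^ n := by positivity
  rcases le_or_gt |x| R with h | h
  · have : clampPow R n x = x ^ n := by
      rw [abs_le] at h
      rw [clampPow, min_eq_left h.2, max_eq_right h.1]
    rw [this, sub_self, abs_zero]
    positivity
  · have h1 : |clampPow R n x| ≤ |x| ^ n := by
      rw [clampPow, abs_pow]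
      exact pow_le_pow_left₀ (abs_nonneg _) ((abs_clamp_le (by linarith)).trans h.le) n
    have h2 : |x| ^ n * R ^ n ≤ x ^ (2 * n) := by
      rw [pow_mul, ← sq_abs, ← pow_mul, mul_comm 2 n, pow_mul, sq]
      gcongr
    calc |x ^ n - clampPow R n x| ≤ |x ^ n| + |clampPow R n x| := abs_sub _ _
      _ ≤ 2 * |x| ^ n := by rw [abs_pow]; linarith
      _ ≤ 2 / R ^ n * x ^ (2 * n) := by
          rw [div_mul_eq_mul_div, le_div_iff₀ hRn]
          linarith

theorem abs_mom_sub_le {V : Measure ℝ} [IsProbabilityMeasure V]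
    (hint : ∀ k : ℕ, Integrable (fun x : ℝ => x ^ k) V) {R : ℝ} (hR : 1 ≤ R) (n : ℕ) :
    |mom V n - ∫ x, clampPow R n x ∂V| ≤ 2 / R ^ n * mom V (2 * n) := by
  obtain ⟨f, hf⟩ := exists_bcf_clampPow (zero_le_one.trans hR) n
  have hfi : Integrable (clampPow R n) V := by
    have := f.integrable V
    exact this.congr (ae_of_all _ hf)
  rw [mom, ← integral_sub (hint n) hfi, mom, ← integral_const_mul]
  refine (abs_integral_le_integral_abs).trans (integral_mono ((hint n).sub hfi).abs
    ((hint _).const_mul _) fun x => abs_pow_sub_clampPow_le hR n x)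

section Limits

variable {ι : Type*} {l : Filter ι} [l.NeBot] {ν : ι → Measure ℝ} {V : Measure ℝ}

/-- Weak convergence only sees bounded functions. Truncated even powers are bounded by the limits of
the moments, and Fatou's lemma removes the truncation. -/
theorem integrable_pow_of_tendsto [∀ i, IsProbabilityMeasure (ν i)] [IsProbabilityMeasure V]
    (hint : ∀ i, ∀ k : ℕ, Integrable (fun x : ℝ => x ^ k) (ν i)) {a : ℕ → ℝ}
    (ha : ∀ k, Tendsto (fun i => mom (ν i) k) l (𝓝 (a k)))
    (hV : ∀ f : ℝ →ᵇ ℝ, Tendsto (fun i => ∫ x, f x ∂(ν i)) l (𝓝 (∫ x, f x ∂V))) (n : ℕ) :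
    Integrable (fun x : ℝ => x ^ (2 * n)) V ∧ mom V (2 * n) ≤ a (2 * n) := by
  have hnn : ∀ x : ℝ, 0 ≤ x ^ (2 * n) := fun x => (even_two_mul n).pow_nonneg _
  have hbound : ∀ N : ℕ, ∫⁻ x, ENNReal.ofReal (clampPow N (2 * n) x) ∂V ≤
      ENNReal.ofReal (a (2 * n)) := by
    intro N
    obtain ⟨f, hf⟩ := exists_bcf_clampPow (Nat.cast_nonneg (α := ℝ) N) (2 * n)
    have hle : ∀ x, f x ≤ x ^ (2 * n) := by
      intro x
      rw [hf, clampPow, pow_mul, pow_mul]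
      refine pow_le_pow_left₀ (sq_nonneg _) (sq_le_sq.2 ?_) n
      have hN := Nat.cast_nonneg (α := ℝ) N
      refine abs_le.2 ⟨?_, max_le ?_ ((min_le_left _ _).trans (le_abs_self x))⟩
      · rcases le_total x N with h | h
        · rw [min_eq_left h]
          exact (neg_abs_le x).trans (le_max_right _ _)
        · rw [min_eq_right h]
          have := abs_nonneg x
          exact le_trans (by linarith) (le_max_right _ _)
      · have := abs_nonneg x
        linarith
    have h1 : ∫ x, f x ∂V ≤ a (2 * n) :=
      le_of_tendsto_of_tendsto (hV f) (ha (2 * n)) (Eventually.of_forall fun i =>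
        integral_mono (f.integrable _) (hint i _) hle)
    have h2 : ∀ x, ENNReal.ofReal (clampPow N (2 * n) x) = ENNReal.ofReal (f x) :=
      fun x => by rw [hf]
    simp only [h2]
    rw [← ofReal_integral_eq_lintegral_ofReal (f.integrable _) (ae_of_all _ fun x => by
      rw [hf]; exact (even_two_mul n).pow_nonneg _)]
    exact ENNReal.ofReal_le_ofReal h1
  have hlint : ∫⁻ x, ENNReal.ofReal (x ^ (2 * n)) ∂V ≤ ENNReal.ofReal (a (2 * n)) := by
    have hlim : ∀ x : ℝ, Tendsto (fun N : ℕ => ENNReal.ofReal (clampPow N (2 * n) x)) atTop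
        (𝓝 (ENNReal.ofReal (x ^ (2 * n)))) := by
      intro x
      refine tendsto_const_nhds.congr' ?_
      obtain ⟨N, hN⟩ := exists_nat_ge |x|
      filter_upwards [eventually_ge_atTop N] with M hM
      have : |x| ≤ M := hN.trans (by exact_mod_cast hM)
      rw [abs_le] at this
      rw [clampPow, min_eq_left this.2, max_eq_right this.1]
    calc ∫⁻ x, ENNReal.ofReal (x ^ (2 * n)) ∂V
        = ∫⁻ x, liminf (fun N : ℕ => ENNReal.ofReal (clampPow N (2 * n) x)) atTop ∂V :=
          lintegral_congr fun x => ((hlim x).liminf_eq).symm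
      _ ≤ liminf (fun N : ℕ => ∫⁻ x, ENNReal.ofReal (clampPow N (2 * n) x) ∂V) atTop :=
          lintegral_liminf_le fun N => by unfold clampPow; fun_prop
      _ ≤ ENNReal.ofReal (a (2 * n)) :=
          (liminf_le_liminf (Eventually.of_forall hbound)).trans_eq (by simp)
  have hI : Integrable (fun x : ℝ => x ^ (2 * n)) V := by
    refine ⟨by fun_prop, ?_⟩
    rw [hasFiniteIntegral_iff_ofReal (ae_of_all _ hnn)]
    exact hlint.trans_lt ENNReal.ofReal_lt_top
  refine ⟨hI, ?_⟩
  rw [← ofReal_integral_eq_lintegral_ofReal hI (ae_of_all _ hnn)] at hlint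
  have ha0 : 0 ≤ a (2 * n) := ge_of_tendsto' (ha (2 * n)) fun i => integral_nonneg hnn
  exact (ENNReal.ofReal_le_ofReal_iff ha0).1 hlint

/-- If distributions with convergent moments converge weakly, then the limits of the moments are
the moments of the limit. -/
theorem moments_of_tendsto [∀ i, IsProbabilityMeasure (ν i)] [IsProbabilityMeasure V]
    (hint : ∀ i, ∀ k : ℕ, Integrable (fun x : ℝ => x ^ k) (ν i)) {a : ℕ → ℝ}
    (ha : ∀ k, Tendsto (fun i => mom (ν i) k) l (𝓝 (a k)))
    (hV : ∀ f : ℝ →ᵇ ℝ, Tendsto (fun i => ∫ x, f x ∂(ν i)) l (𝓝 (∫ x, f x ∂V))) :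
    (∀ k : ℕ, Integrable (fun x : ℝ => x ^ k) V) ∧ ∀ k, mom V k = a k := by
  have heven := integrable_pow_of_tendsto hint ha hV
  have hI : ∀ k : ℕ, Integrable (fun x : ℝ => x ^ k) V := by
    intro k
    refine Integrable.mono' ((heven k).1.add (integrable_const 1)) (by fun_prop)
      (ae_of_all _ fun x => ?_)
    simp only [Pi.add_apply]
    rw [Real.norm_eq_abs, pow_mul, pow_right_comm, ← sq_abs (x ^ k)]
    nlinarith [sq_nonneg (|x ^ k| - 1)]
  refine ⟨hI, fun n => ?_⟩
  rcases Nat.eq_zero_or_pos n with rfl | hn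
  · have h1 : ∀ i, mom (ν i) 0 = 1 := fun i => by simp [mom]
    have := ha 0
    simp only [h1] at this
    rw [← tendsto_nhds_unique tendsto_const_nhds this]
    simp [mom]
  -- The truncation error at level R is controlled uniformly by the moments of order 2n. The case n
  -- = 0 is separate because there R^n does not grow.
  · have key : ∀ R : ℝ, 1 ≤ R → |mom V n - a n| ≤ 4 * a (2 * n) / R ^ n := by
      intro R hR
      obtain ⟨f, hf⟩ := exists_bcf_clampPow (zero_le_one.trans hR) n
      have e1 := abs_mom_sub_le hI hR n
      have e2 : |a n - ∫ x, clampPow R n x ∂V| ≤ 2 / R ^ n * a (2 * n) := by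
        have hVf := hV f
        simp only [hf] at hVf
        exact le_of_tendsto_of_tendsto ((ha n).sub hVf).abs ((ha (2 * n)).const_mul _)
          (Eventually.of_forall fun i => abs_mom_sub_le (hint i) hR n)
      have e3 : 2 / R ^ n * mom V (2 * n) ≤ 2 / R ^ n * a (2 * n) :=
        mul_le_mul_of_nonneg_left (heven n).2 (by positivity)
      have e4 : 4 * a (2 * n) / R ^ n = 2 / R ^ n * a (2 * n) + 2 / R ^ n * a (2 * n) := by ring
      rw [e4]
      rw [abs_sub_comm] at e2
      calc |mom V n - a n| ≤ _ := abs_sub_le _ (∫ x, clampPow R n x ∂V) _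
        _ ≤ _ := add_le_add (e1.trans e3) e2
    have hlim : Tendsto (fun R : ℝ => 4 * a (2 * n) / R ^ n) atTop (𝓝 0) :=
      (tendsto_pow_atTop hn.ne').const_div_atTop _
    have h0 : |mom V n - a n| ≤ 0 :=
      ge_of_tendsto hlim ((eventually_ge_atTop 1).mono fun R hR => key R hR)
    exact sub_eq_zero.1 (abs_nonpos_iff.1 h0)

end Limits

theorem isTightMeasureSet_of_second_moment_le {S : Set (Measure ℝ)} {B : ℝ}
    (hS : ∀ μ ∈ S, IsProbabilityMeasure μ ∧ Integrable (fun x : ℝ => x ^ 2) μ ∧ mom μ 2 ≤ B) :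
    IsTightMeasureSet S := by
  refine isTightMeasureSet_of_tendsto_measure_norm_gt ?_
  have hlim : Tendsto (fun r : ℝ => ENNReal.ofReal (B / r ^ 2)) atTop (𝓝 0) := by
    rw [← ENNReal.ofReal_zero]
    exact ENNReal.tendsto_ofReal ((tendsto_pow_atTop two_ne_zero).const_div_atTop _)
  refine tendsto_of_tendsto_of_tendsto_of_le_of_le' tendsto_const_nhds hlim
    (Eventually.of_forall fun _ => zero_le) ?_
  filter_upwards [eventually_gt_atTop 0] with r hr
  refine iSup₂_le fun μ hμ => ?_
  obtain ⟨hp, hi, hB⟩ := hS μ hμ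
  have h1 := mul_meas_ge_le_integral_of_nonneg (ae_of_all μ fun x : ℝ => sq_nonneg x) hi (r ^ 2)
  have h2 : μ.real {x : ℝ | r ^ 2 ≤ x ^ 2} ≤ B / r ^ 2 := by
    rw [le_div_iff₀ (by positivity), mul_comm]
    exact h1.trans hB
  calc μ {x | r < ‖x‖} ≤ μ {x : ℝ | r ^ 2 ≤ x ^ 2} := by
        refine measure_mono fun x hx => ?_
        simp only [Set.mem_ofPred_eq, Real.norm_eq_abs] at hx ⊢
        rw [← sq_abs x]
        exact pow_le_pow_left₀ hr.le hx.le 2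
    _ = ENNReal.ofReal (μ.real {x : ℝ | r ^ 2 ≤ x ^ 2}) := (ofReal_measureReal).symm
    _ ≤ _ := ENNReal.ofReal_le_ofReal h2

/-- Bounded second moments give tightness, hence compactness by Prokhorov's theorem. With
ultrafilters no subsequences are needed: convergence to the same limit along all of them is
convergence. -/
theorem exists_limit_along_ultrafilter {ν : ℕ → Measure ℝ} [∀ i, IsProbabilityMeasure (ν i)]
    (hint : ∀ i, ∀ k : ℕ, Integrable (fun x : ℝ => x ^ k) (ν i)) {a : ℕ → ℝ}
    (ha : ∀ k, Tendsto (fun i => mom (ν i) k) atTop (𝓝 (a k))) (U : Ultrafilter ℕ)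
    (hU : (U : Filter ℕ) ≤ atTop) :
    ∃ V : Measure ℝ, IsProbabilityMeasure V ∧ (∀ k : ℕ, Integrable (fun x : ℝ => x ^ k) V) ∧
      (∀ k, mom V k = a k) ∧
      ∀ f : ℝ →ᵇ ℝ, Tendsto (fun i => ∫ x, f x ∂(ν i)) U (𝓝 (∫ x, f x ∂V)) := by
  obtain ⟨B, hB⟩ := (ha 2).bddAbove_range
  let P : ℕ → ProbabilityMeasure ℝ := fun i => ⟨ν i, inferInstance⟩
  have htight : IsTightMeasureSet
      {((μ : ProbabilityMeasure ℝ) : Measure ℝ) | μ ∈ Set.range P} := by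
    refine isTightMeasureSet_of_second_moment_le (B := B) ?_
    rintro _ ⟨_, ⟨i, rfl⟩, rfl⟩
    exact ⟨inferInstance, hint i 2, hB ⟨i, rfl⟩⟩
  obtain ⟨V, -, hV⟩ := (isCompact_closure_of_isTightMeasureSet htight).ultrafilter_le_nhds
    (U.map P) (by
      rw [le_principal_iff]
      exact mem_of_superset (range_mem_map (f := (U : Filter ℕ)) (m := P)) subset_closure)
  have hV' : Tendsto P U (𝓝 V) := hV
  rw [ProbabilityMeasure.tendsto_iff_forall_integral_tendsto] at hV'
  have := moments_of_tendsto (V := (V : Measure ℝ)) hint (fun k => (ha k).mono_left hU) hV'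
  exact ⟨V, inferInstance, this.1, this.2, hV'⟩

/-- A limit of moment sequences is a moment sequence. -/
theorem exists_measure_of_tendsto_moments {ν : ℕ → Measure ℝ} [∀ i, IsProbabilityMeasure (ν i)]
    (hint : ∀ i, ∀ k : ℕ, Integrable (fun x : ℝ => x ^ k) (ν i)) {a : ℕ → ℝ}
    (ha : ∀ k, Tendsto (fun i => mom (ν i) k) atTop (𝓝 (a k))) :
    ∃ V : Measure ℝ, IsWeightLaw V ∧ ∀ k, mom V k = a k := by
  obtain ⟨V, h1, h2, h3, -⟩ := exists_limit_along_ultrafilter hint ha (Ultrafilter.of atTop)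
    (Ultrafilter.of_le _)
  exact ⟨V, ⟨h1, h2⟩, h3⟩

/-- Convergence of moments to those of a distribution determined by its moments implies weak
convergence. -/
theorem tendsto_integral_of_tendsto_moments {ν : ℕ → Measure ℝ} [∀ i, IsProbabilityMeasure (ν i)]
    (hint : ∀ i, ∀ k : ℕ, Integrable (fun x : ℝ => x ^ k) (ν i)) {W : Measure ℝ}
    (hW : IsWeightLaw W) {A B : ℝ} (hB : 0 ≤ B)
    (hgrowth : ∀ k, mom W (2 * k) ≤ A * B ^ k * (2 * k)!)
    (ha : ∀ k, Tendsto (fun i => mom (ν i) k) atTop (𝓝 (mom W k))) (f : ℝ →ᵇ ℝ) :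
    Tendsto (fun i => ∫ x, f x ∂(ν i)) atTop (𝓝 (∫ x, f x ∂W)) := by
  rw [tendsto_iff_ultrafilter]
  intro U hU
  obtain ⟨V, h1, h2, h3, h4⟩ := exists_limit_along_ultrafilter hint ha U hU
  have := hW.prob
  rw [eq_of_moments_eq hW.finite_moments h2 hB hgrowth fun k => (h3 k).symm]
  exact h4 f

end MomentProblem

/-! ### Expectation as a linear functional on polynomials in the edge weights -/

section PolynomialExpectation

open Finset

variable {σ : Type*}

/-- The expectation of a polynomial in independent variables with moments `μ k`. -/
noncomputable def polyExp (μ : ℕ → ℝ) : MvPolynomial σ ℝ →ₗ[ℝ] ℝ :=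
  (MvPolynomial.basisMonomials σ ℝ).constr ℝ fun j => j.prod fun _ k => μ k

theorem polyExp_monomial (μ : ℕ → ℝ) (j : σ →₀ ℕ) (c : ℝ) :
    polyExp μ (MvPolynomial.monomial j c) = c * j.prod fun _ k => μ k := by
  have h : MvPolynomial.monomial j c = c • MvPolynomial.basisMonomials σ ℝ j := by
    rw [MvPolynomial.coe_basisMonomials, MvPolynomial.smul_monomial, smul_eq_mul, mul_one]
  rw [h, map_smul, polyExp, Module.Basis.constr_basis, smul_eq_mul]

theorem polyExp_one (μ : ℕ → ℝ) : polyExp μ (1 : MvPolynomial σ ℝ) = 1 := by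
  rw [← MvPolynomial.C_1, ← MvPolynomial.monomial_zero', polyExp_monomial]
  simp

/-- The defining product runs over the support of the exponent, so μ 0 is never read; this is why k
≠ 0 is required. -/
theorem polyExp_X_pow (μ : ℕ → ℝ) (e : σ) {k : ℕ} (hk : k ≠ 0) :
    polyExp μ (MvPolynomial.X e ^ k) = μ k := by
  rw [MvPolynomial.X_pow_eq_monomial, polyExp_monomial, one_mul, Finsupp.prod,
    Finsupp.support_single _ hk]
  simp

/-- Polynomials in disjoint sets of variables are independent. -/
theorem polyExp_mul (μ : ℕ → ℝ) {s t : Set σ} (hst : Disjoint s t) {p q : MvPolynomial σ ℝ}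
    (hp : p ∈ MvPolynomial.supported ℝ s) (hq : q ∈ MvPolynomial.supported ℝ t) :
    polyExp μ (p * q) = polyExp μ p * polyExp μ q := by
  rw [MvPolynomial.mem_supported] at hp hq
  have hs : ∀ (r : MvPolynomial σ ℝ) (j : σ →₀ ℕ), j ∈ r.support → (j.support : Set σ) ⊆ r.vars := by
    intro r j hj e he
    exact (MvPolynomial.mem_vars_iff_mem_support e).2 ⟨j, hj, he⟩
  conv_lhs => rw [← MvPolynomial.support_sum_monomial_coeff p,
    ← MvPolynomial.support_sum_monomial_coeff q]
  conv_rhs => rw [← MvPolynomial.support_sum_monomial_coeff p,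
    ← MvPolynomial.support_sum_monomial_coeff q]
  rw [sum_mul_sum, map_sum, map_sum, map_sum, sum_mul_sum]
  refine sum_congr rfl fun i hi => ?_
  rw [map_sum]
  refine sum_congr rfl fun j hj => ?_
  rw [MvPolynomial.monomial_mul, polyExp_monomial, polyExp_monomial, polyExp_monomial,
    Finsupp.prod_add_index_of_disjoint]
  · ring
  · rw [← Finset.disjoint_coe]
    exact hst.mono ((hs p i hi).trans hp) ((hs q j hj).trans hq)

theorem integral_eval_eq_polyExp [Fintype σ] {W : Measure ℝ} (hW : IsWeightLaw W)
    (p : MvPolynomial σ ℝ) :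
    Integrable (fun w : σ → ℝ => MvPolynomial.eval w p) (Measure.pi fun _ => W) ∧
      ∫ w, MvPolynomial.eval w p ∂(Measure.pi fun _ => W) = polyExp (mom W) p := by
  have := hW.prob
  have hmon : ∀ (j : σ →₀ ℕ) (c : ℝ) (w : σ → ℝ),
      MvPolynomial.eval w (MvPolynomial.monomial j c) = c * ∏ e, w e ^ j e := by
    intro j c w
    rw [MvPolynomial.eval_monomial, Finsupp.prod_fintype _ _ fun _ => pow_zero _]
  have hint : ∀ j : σ →₀ ℕ, Integrable (fun w : σ → ℝ => ∏ e, w e ^ j e)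
      (Measure.pi fun _ => W) := fun j =>
    Integrable.fintype_prod (f := fun e (x : ℝ) => x ^ j e) fun e => hW.finite_moments (j e)
  have hI : ∀ (j : σ →₀ ℕ), ∫ w : σ → ℝ, ∏ e, w e ^ j e ∂(Measure.pi fun _ => W) =
      j.prod fun _ k => mom W k := by
    intro j
    rw [integral_fintype_prod_eq_prod (f := fun e (x : ℝ) => x ^ j e),
      Finsupp.prod_fintype _ _ fun _ => by simp [mom]]
    rfl
  have e : ∀ w : σ → ℝ, MvPolynomial.eval w p =
      ∑ j ∈ p.support, MvPolynomial.coeff j p * ∏ e, w e ^ j e := by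
    intro w
    conv_lhs => rw [← MvPolynomial.support_sum_monomial_coeff p]
    rw [map_sum]
    exact sum_congr rfl fun j _ => hmon j _ w
  simp only [e]
  refine ⟨integrable_finsetSum _ fun j _ => (hint j).const_mul _, ?_⟩
  rw [integral_finsetSum _ fun j _ => (hint j).const_mul _]
  conv_rhs => rw [← MvPolynomial.support_sum_monomial_coeff p]
  rw [map_sum]
  refine sum_congr rfl fun j _ => ?_
  rw [integral_const_mul, hI, polyExp_monomial]

end PolynomialExpectation

/-! ### Closed-walk series under the addition of an edge -/

section Resolvent

open Finset

/-- The resolvent identity in coefficients: a walk that uses B is split at its first B-step. -/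
theorem matrix_pow_succ_add {V R : Type*} [Fintype V] [DecidableEq V] [CommRing R]
    (A B : Matrix V V R) (n : ℕ) :
    (A + B) ^ (n + 1) = A ^ (n + 1) +
      ∑ p ∈ antidiagonal n, A ^ p.1 * B * (A + B) ^ p.2 := by
  induction n with
  | zero => simp
  | succ n ih =>
    rw [pow_succ' (A + B) (n + 1), add_mul]
    conv_lhs => rw [ih]
    rw [Finset.Nat.sum_antidiagonal_succ, mul_add, ← pow_succ', mul_sum, pow_zero, one_mul, ← ih,
      add_assoc, add_comm (∑ p ∈ antidiagonal n, _)]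
    simp only [pow_succ', mul_assoc]

/-- The generating function of the walks from `x` to `y`, for the matrix `A`. -/
def walkSeries {V R : Type*} [Fintype V] [DecidableEq V] [CommRing R] (A : Matrix V V R) (x y : V) :
    PowerSeries R := PowerSeries.mk fun n => (A ^ n) x y

theorem walkSeries_add_edge {V R : Type*} [Fintype V] [DecidableEq V] [CommRing R]
    (A : Matrix V V R) {v u : V} (w : R) (x y : V) :
    walkSeries (A + (Matrix.single v u w + Matrix.single u v w)) x y =
      walkSeries A x y + PowerSeries.X * (PowerSeries.C w *
        (walkSeries A x v *
          walkSeries (A + (Matrix.single v u w + Matrix.single u v w)) u y +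
        walkSeries A x u *
          walkSeries (A + (Matrix.single v u w + Matrix.single u v w)) v y)) := by
  set B := Matrix.single v u w + Matrix.single u v w with hB
  ext n
  cases n with
  | zero => simp [walkSeries]
  | succ n =>
    rw [map_add, PowerSeries.coeff_succ_X_mul, PowerSeries.coeff_C_mul, map_add,
      PowerSeries.coeff_mul, PowerSeries.coeff_mul]
    simp only [walkSeries, PowerSeries.coeff_mk]
    rw [matrix_pow_succ_add, Matrix.add_apply, Matrix.sum_apply, ← sum_add_distrib, mul_sum]
    congr 1
    refine sum_congr rfl fun p _ => ?_
    have hsingle : ∀ (M N : Matrix V V R) (i j : V),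
        (M * Matrix.single i j w * N) x y = M x i * w * N j y := by
      intro M N i j
      rw [Matrix.mul_apply, sum_eq_single j]
      · rw [Matrix.mul_single_apply_same]
      · intro k _ hk
        rw [Matrix.mul_single_apply_of_ne _ _ _ _ _ hk, zero_mul]
      · simp
    rw [hB, mul_add, add_mul, Matrix.add_apply, hsingle, hsingle]
    ring

/-- The sums are the truncations of (1 - y)^(-m-1) and (1 - y)^(-m). -/
theorem dvd_sub_multichoose_sum {R : Type*} [CommRing R] (y : R) (J m : ℕ) :
    y ^ (J + 1) ∣ (1 - y) * ∑ j ∈ range (J + 1), ((m + 1).multichoose j : R) * y ^ j -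
      ∑ j ∈ range (J + 1), (m.multichoose j : R) * y ^ j := by
  have h : ∀ J : ℕ, (1 - y) * ∑ j ∈ range (J + 1), ((m + 1).multichoose j : R) * y ^ j =
      ∑ j ∈ range (J + 1), (m.multichoose j : R) * y ^ j -
        ((m + 1).multichoose J : R) * y ^ (J + 1) := by
    intro J
    induction J with
    | zero => simp
    | succ J ih =>
      rw [sum_range_succ, mul_add, ih, sum_range_succ _ (J + 1), Nat.multichoose_succ_succ]
      push_cast
      ring
  rw [h]
  exact ⟨-((m + 1).multichoose J : R), by ring⟩

theorem dvd_pow_sub_sum {R : Type*} [CommRing R] {y F F' z : R} (hF : z ∣ F - (F' + y * F)) (J : ℕ)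
    (hy : z ∣ y ^ (J + 1)) (m : ℕ) :
    z ∣ F ^ m - (∑ j ∈ range (J + 1), (m.multichoose j : R) * y ^ j) * F' ^ m := by
  induction m with
  | zero =>
    rw [sum_range_succ']
    simp
  | succ m ih =>
    have h1 := hy.trans (dvd_sub_multichoose_sum y J m)
    set S := ∑ j ∈ range (J + 1), (m.multichoose j : R) * y ^ j
    set T := ∑ j ∈ range (J + 1), ((m + 1).multichoose j : R) * y ^ j
    have e : F ^ (m + 1) - T * F' ^ (m + 1) =
        F * (F ^ m - S * F' ^ m) + (F - (F' + y * F)) * (T * F' ^ m) -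
          ((1 - y) * T - S) * (F * F' ^ m) := by ring
    rw [e]
    exact dvd_sub (dvd_add (ih.mul_left _) (hF.mul_right _)) (h1.mul_right _)

/-- The effect on the coefficients of the powers of the generating function of closed walks of
adding an edge between two vertices that are far from each other. -/
theorem coeff_walkSeries_pow_add_edge {V R : Type*} [Fintype V] [DecidableEq V] [CommRing R]
    (A : Matrix V V R) {v u : V} (w : R) {n : ℕ} (h1 : ∀ i ≤ n, (A ^ i) v u = 0)
    (h2 : ∀ i ≤ n, (A ^ i) u v = 0) (m : ℕ) :
    PowerSeries.coeff n (walkSeries (A + (Matrix.single v u w + Matrix.single u v w)) v v ^ m) =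
      PowerSeries.coeff n (walkSeries A v v ^ m) + ∑ j ∈ range (n / 2), (m.multichoose (j + 1) : R) *
        (w ^ (2 * (j + 1)) * ∑ p ∈ antidiagonal (n - 2 * (j + 1)),
          PowerSeries.coeff p.1 (walkSeries A v v ^ (m + (j + 1))) *
            PowerSeries.coeff p.2 (walkSeries A u u ^ (j + 1))) := by
  have hvv := walkSeries_add_edge A (v := v) (u := u) w v v
  have huv := walkSeries_add_edge A (v := v) (u := u) w u v
  set F := walkSeries (A + (Matrix.single v u w + Matrix.single u v w)) v v
  set Fu := walkSeries (A + (Matrix.single v u w + Matrix.single u v w)) u v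
  set P := walkSeries A v v
  set Q := walkSeries A u u
  have d1 : (PowerSeries.X : PowerSeries R) ^ (n + 1) ∣ walkSeries A v u :=
    PowerSeries.X_pow_dvd_iff.2 fun i hi => by
      rw [walkSeries, PowerSeries.coeff_mk, h1 i (by omega)]
  have d2 : (PowerSeries.X : PowerSeries R) ^ (n + 1) ∣ walkSeries A u v :=
    PowerSeries.X_pow_dvd_iff.2 fun i hi => by
      rw [walkSeries, PowerSeries.coeff_mk, h2 i (by omega)]
  obtain ⟨M, hM⟩ := d1
  obtain ⟨N, hN⟩ := d2
  rw [hM] at hvv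
  rw [hN] at huv
  set Y := PowerSeries.X ^ 2 * (PowerSeries.C w ^ 2 * (P * Q)) with hY
  -- Eliminating the walks from u to v gives F = P + YF modulo X^(n+1); the cross terms contain
  -- walks between u and v without the new edge, which are too long to matter.
  have hF : (PowerSeries.X : PowerSeries R) ^ (n + 1) ∣ F - (P + Y * F) := by
    refine ⟨PowerSeries.X * PowerSeries.C w * (M * F + P * (N + PowerSeries.X * PowerSeries.C w *
      N * Fu)), ?_⟩
    rw [hY]
    linear_combination hvv + PowerSeries.X * PowerSeries.C w * P * huv
  have hYd : (PowerSeries.X : PowerSeries R) ^ (n + 1) ∣ Y ^ (n / 2 + 1) := by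
    rw [hY, mul_pow, ← pow_mul]
    exact (pow_dvd_pow _ (by omega)).mul_right _
  have hdvd := dvd_pow_sub_sum hF (n / 2) hYd m
  have hc := PowerSeries.X_pow_dvd_iff.1 hdvd n (Nat.lt_succ_self n)
  rw [map_sub, sub_eq_zero] at hc
  rw [hc, sum_range_succ', add_mul, map_add, add_comm]
  congr 1
  · simp
  · rw [sum_mul, map_sum]
    refine sum_congr rfl fun j hj => ?_
    rw [mem_range] at hj
    have e : (m.multichoose (j + 1) : PowerSeries R) * Y ^ (j + 1) * P ^ m =
        PowerSeries.C ((m.multichoose (j + 1) : R) * w ^ (2 * (j + 1))) *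
          (PowerSeries.X ^ (2 * (j + 1)) * (P ^ (m + (j + 1)) * Q ^ (j + 1))) := by
      rw [hY, map_mul, map_natCast, map_pow]
      ring
    rw [e, PowerSeries.coeff_C_mul, PowerSeries.coeff_X_pow_mul', if_pos (by omega),
      PowerSeries.coeff_mul, mul_assoc]

end Resolvent

/-! ### Locally tree-like neighbourhoods and expected closed walks -/

section Trees

open Finset

variable {V : Type*}

/-- The vertex `y` can be reached from `x` by a walk of length at most `k`. -/
def Within (H : SimpleGraph V) (k : ℕ) (x y : V) : Prop := ∃ p : H.Walk x y, p.length ≤ k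

theorem Within.refl (H : SimpleGraph V) (k : ℕ) (x : V) : Within H k x x :=
  ⟨SimpleGraph.Walk.nil, Nat.zero_le k⟩

theorem Within.symm {H : SimpleGraph V} {k : ℕ} {x y : V} (h : Within H k x y) :
    Within H k y x := by
  obtain ⟨p, hp⟩ := h
  exact ⟨p.reverse, by simpa using hp⟩

theorem Within.trans {H : SimpleGraph V} {k l : ℕ} {x y z : V} (h : Within H k x y)
    (h' : Within H l y z) : Within H (k + l) x z := by
  obtain ⟨p, hp⟩ := h
  obtain ⟨q, hq⟩ := h'
  exact ⟨p.append q, by simpa using add_le_add hp hq⟩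

theorem Within.of_adj {H : SimpleGraph V} {x y : V} (h : H.Adj x y) : Within H 1 x y :=
  ⟨h.toWalk, by simp⟩

theorem Within.mono {H H' : SimpleGraph V} (hH : H ≤ H') {k l : ℕ} (hkl : k ≤ l) {x y : V}
    (h : Within H k x y) : Within H' l x y := by
  obtain ⟨p, hp⟩ := h
  exact ⟨p.mapLe hH, by simpa using hp.trans hkl⟩

/-- There is no cycle of length at most `L` through a vertex at distance at most `L` of `v`. -/
def NoShortCycle (H : SimpleGraph V) (L : ℕ) (v : V) : Prop :=
  ∀ x, Within H L v x → ∀ c : H.Walk x x, c.IsCycle → L < c.length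

theorem NoShortCycle.mono {H H' : SimpleGraph V} (hH : H' ≤ H) {L : ℕ} {v : V}
    (h : NoShortCycle H L v) : NoShortCycle H' L v := by
  intro x hx c hc
  have := h x (hx.mono hH le_rfl) (c.mapLe hH) (hc.mapLe hH)
  simpa using this

theorem NoShortCycle.of_adj {H : SimpleGraph V} {L : ℕ} {v u : V} (h : NoShortCycle H (L + 1) v)
    (hvu : H.Adj v u) : NoShortCycle H L u := by
  intro x hx c hc
  have h1 : Within H (L + 1) v x := by
    have := (Within.of_adj hvu).trans hx
    rwa [add_comm] at this
  have := h x h1 c hc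
  omega

/-- A short path from v to u avoiding the edge would close up with it to a short cycle through u. -/
theorem not_within_deleteEdges {H : SimpleGraph V} {L : ℕ} {v u : V}
    (h : NoShortCycle H (L + 1) v) (hvu : H.Adj v u) :
    ¬ Within (H.deleteEdges {s(v, u)}) L v u := by
  classical
  rintro ⟨q, hq⟩
  have hle : H.deleteEdges {s(v, u)} ≤ H := SimpleGraph.deleteEdges_le _
  have hpath : (q.bypass.mapLe hle).IsPath :=
    (SimpleGraph.Walk.isPath_mapLe hle).2 q.bypass_isPath
  have hedge : s(u, v) ∉ (q.bypass.mapLe hle).edges := by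
    rw [SimpleGraph.Walk.edges_mapLe_eq_edges]
    intro he
    have := SimpleGraph.Walk.edges_subset_edgeSet _ he
    rw [SimpleGraph.mem_edgeSet, SimpleGraph.deleteEdges_adj] at this
    exact this.2 (by simp [Sym2.eq_swap])
  have hcyc := (SimpleGraph.Walk.cons_isCycle_iff _ hvu.symm).2 ⟨hpath, hedge⟩
  have h1 := h u ((Within.of_adj hvu).mono le_rfl (by omega)) _ hcyc
  have h2 := q.length_bypass_le_length
  simp only [SimpleGraph.Walk.length_cons, SimpleGraph.Walk.length_map] at h1
  omega

theorem polyExp_X_pow_mul_mul {σ : Type*} (μ : ℕ → ℝ) {e : σ} {s t : Set σ}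
    (he : Disjoint {e} (s ∪ t)) (hst : Disjoint s t) {p q : MvPolynomial σ ℝ} {k : ℕ} (hk : k ≠ 0)
    (hp : p ∈ MvPolynomial.supported ℝ s) (hq : q ∈ MvPolynomial.supported ℝ t) :
    polyExp μ (MvPolynomial.X e ^ k * (p * q)) = μ k * (polyExp μ p * polyExp μ q) := by
  have hX : (MvPolynomial.X e : MvPolynomial σ ℝ) ^ k ∈ MvPolynomial.supported ℝ {e} :=
    Subalgebra.pow_mem _ (MvPolynomial.X_mem_supported.2 (Set.mem_singleton e)) k
  have hpq : p * q ∈ MvPolynomial.supported ℝ (s ∪ t) :=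
    Subalgebra.mul_mem _ (MvPolynomial.supported_mono Set.subset_union_left hp)
      (MvPolynomial.supported_mono Set.subset_union_right hq)
  rw [polyExp_mul μ he hX hpq, polyExp_mul μ hst hp hq, polyExp_X_pow μ _ hk]

open Classical in
/-- The adjacency matrix of a graph with indeterminate weights. -/
noncomputable def polyAdj (H : SimpleGraph V) : Matrix V V (MvPolynomial (Sym2 V) ℝ) :=
  Matrix.of fun i j => if H.Adj i j then MvPolynomial.X s(i, j) else 0

theorem polyAdj_apply_of_adj {H : SimpleGraph V} {i j : V} (h : H.Adj i j) :
    polyAdj H i j = MvPolynomial.X s(i, j) := by simp [polyAdj, h]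

theorem polyAdj_apply_of_not_adj {H : SimpleGraph V} {i j : V} (h : ¬ H.Adj i j) :
    polyAdj H i j = 0 := by simp [polyAdj, h]

/-- The edges with an endpoint at distance at most `k` of `x`. -/
def edgesWithin (H : SimpleGraph V) (k : ℕ) (x : V) : Set (Sym2 V) :=
  {e | e ∈ H.edgeSet ∧ ∃ y ∈ e, Within H k x y}

theorem edgesWithin_mono (H : SimpleGraph V) {k l : ℕ} (h : k ≤ l) (x : V) :
    edgesWithin H k x ⊆ edgesWithin H l x := by
  rintro e ⟨he, y, hy, hw⟩
  exact ⟨he, y, hy, hw.mono le_rfl h⟩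

theorem disjoint_edgesWithin {H : SimpleGraph V} {k l : ℕ} {v u : V}
    (h : ¬ Within H (k + l + 1) v u) : Disjoint (edgesWithin H k v) (edgesWithin H l u) := by
  classical
  rw [Set.disjoint_left]
  rintro e ⟨he, y, hy, hw⟩ ⟨-, z, hz, hw'⟩
  refine h ?_
  have hyz : Within H 1 y z := by
    by_cases hyz : y = z
    · subst hyz
      exact Within.refl _ _ _
    · rw [(Sym2.mem_and_mem_iff hyz).1 ⟨hy, hz⟩] at he
      exact Within.of_adj he
  exact ((hw.trans hyz).trans hw'.symm).mono le_rfl (by omega)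

theorem neighborSet_deleteEdges_eq {H : SimpleGraph V} {v u x : V} (hx : x ≠ v) (hx' : x ≠ u) :
    (H.deleteEdges {s(v, u)}).neighborSet x = H.neighborSet x := by
  ext y
  simp only [SimpleGraph.mem_neighborSet, SimpleGraph.deleteEdges_adj, Set.mem_singleton_iff,
    Sym2.eq_iff]
  tauto

theorem ncard_neighborSet_deleteEdges {H : SimpleGraph V} {v u : V} (h : H.Adj v u) :
    ((H.deleteEdges {s(v, u)}).neighborSet v).ncard = (H.neighborSet v).ncard - 1 := by
  classical
  rw [← Set.ncard_sdiff_singleton_of_mem (show u ∈ H.neighborSet v from h)]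
  congr 1
  ext y
  simp only [SimpleGraph.mem_neighborSet, SimpleGraph.deleteEdges_adj, Set.mem_singleton_iff,
    Sym2.eq_iff, Set.mem_sdiff]
  have := h.ne
  tauto

/-- Near `v`, the graph looks like a tree in which the vertex `v` has degree `D` and the other
vertices have degree `d`. -/
structure IsTreeNear (H : SimpleGraph V) (d D h : ℕ) (v : V) : Prop where
  cycles : NoShortCycle H (2 * h + 1) v
  root : (H.neighborSet v).ncard = D
  inner : ∀ x, x ≠ v → Within H h v x → (H.neighborSet x).ncard = d

/-- Deleting an edge at the root leaves a root with one child fewer and, as the next lemma shows, a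
child with d - 1 children and less height. These are the two recursive calls of `treeCoeff`. -/
theorem IsTreeNear.delete_root {H : SimpleGraph V} {d D h : ℕ} {v u : V}
    (hH : IsTreeNear H d (D + 1) h v) (hvu : H.Adj v u) :
    IsTreeNear (H.deleteEdges {s(v, u)}) d D h v := by
  have hle : H.deleteEdges {s(v, u)} ≤ H := SimpleGraph.deleteEdges_le _
  refine ⟨hH.cycles.mono hle, ?_, fun x hx hw => ?_⟩
  · rw [ncard_neighborSet_deleteEdges hvu, hH.root, Nat.add_sub_cancel]
  · have hxu : x ≠ u := by
      rintro rfl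
      exact not_within_deleteEdges hH.cycles hvu (hw.mono le_rfl (by omega))
    rw [neighborSet_deleteEdges_eq hx hxu]
    exact hH.inner x hx (hw.mono hle le_rfl)

theorem IsTreeNear.delete_child {H : SimpleGraph V} {d D h : ℕ} {v u : V}
    (hH : IsTreeNear H d D (h + 1) v) (hvu : H.Adj v u) :
    IsTreeNear (H.deleteEdges {s(v, u)}) d (d - 1) h u := by
  have hle : H.deleteEdges {s(v, u)} ≤ H := SimpleGraph.deleteEdges_le _
  have hno : ¬ Within (H.deleteEdges {s(v, u)}) (2 * (h + 1)) v u :=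
    not_within_deleteEdges hH.cycles hvu
  refine ⟨?_, ?_, fun x hx hw => ?_⟩
  · have h1 : NoShortCycle H (2 * (h + 1)) u := NoShortCycle.of_adj hH.cycles hvu
    have h2 := h1.mono hle
    intro x hx c hc
    have := h2 x (hx.mono le_rfl (by omega)) c hc
    omega
  · rw [Sym2.eq_swap, ncard_neighborSet_deleteEdges hvu.symm,
      hH.inner u hvu.ne.symm ((Within.of_adj hvu).mono le_rfl (by omega))]
  · have hxv : x ≠ v := by
      rintro rfl
      exact hno (hw.symm.mono le_rfl (by omega))
    rw [neighborSet_deleteEdges_eq hxv hx]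
    refine hH.inner x hxv ?_
    exact ((Within.of_adj hvu).trans (hw.mono hle le_rfl)).mono le_rfl (by omega)

theorem polyAdj_eq_add [DecidableEq V] {H : SimpleGraph V} {v u : V} (hvu : H.Adj v u) :
    polyAdj H = polyAdj (H.deleteEdges {s(v, u)}) +
      (Matrix.single v u (MvPolynomial.X s(v, u)) + Matrix.single u v (MvPolynomial.X s(v, u))) := by
  ext1 i j
  have hne := hvu.ne
  rw [Matrix.add_apply, Matrix.add_apply, Matrix.single_apply, Matrix.single_apply]
  by_cases h1 : v = i ∧ u = j
  · obtain ⟨rfl, rfl⟩ := h1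
    rw [polyAdj_apply_of_adj hvu, polyAdj_apply_of_not_adj (by simp), if_pos ⟨rfl, rfl⟩,
      if_neg (fun h => hne h.1.symm)]
    simp
  · by_cases h2 : u = i ∧ v = j
    · obtain ⟨rfl, rfl⟩ := h2
      rw [polyAdj_apply_of_adj hvu.symm, polyAdj_apply_of_not_adj (by simp [Sym2.eq_swap]),
        if_neg h1, if_pos ⟨rfl, rfl⟩, Sym2.eq_swap]
      simp
    · rw [if_neg h1, if_neg h2, add_zero, add_zero]
      have hs : s(i, j) ≠ s(v, u) := by
        rw [Ne, Sym2.eq_iff]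
        rintro (⟨rfl, rfl⟩ | ⟨rfl, rfl⟩)
        · exact h1 ⟨rfl, rfl⟩
        · exact h2 ⟨rfl, rfl⟩
      by_cases h : H.Adj i j
      · rw [polyAdj_apply_of_adj h, polyAdj_apply_of_adj (by
          rw [SimpleGraph.deleteEdges_adj]; exact ⟨h, by simpa using hs⟩)]
      · rw [polyAdj_apply_of_not_adj h, polyAdj_apply_of_not_adj (by
          rw [SimpleGraph.deleteEdges_adj]; exact fun h' => h h'.1)]

section Matrices

variable [Fintype V] [DecidableEq V]

theorem polyAdj_pow_eq_zero {H : SimpleGraph V} {n : ℕ} {x y : V} (h : ¬ Within H n x y) :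
    (polyAdj H ^ n) x y = 0 := by
  induction n generalizing x with
  | zero =>
    rw [pow_zero, Matrix.one_apply_ne]
    rintro rfl
    exact h (Within.refl _ _ _)
  | succ n ih =>
    rw [pow_succ', Matrix.mul_apply]
    refine sum_eq_zero fun z _ => ?_
    by_cases hz : H.Adj x z
    · rw [ih, mul_zero]
      intro hw
      have := (Within.of_adj hz).trans hw
      rw [add_comm] at this
      exact h this
    · rw [polyAdj_apply_of_not_adj hz, zero_mul]

theorem polyAdj_pow_mem_supported (H : SimpleGraph V) (n : ℕ) (x y : V) :
    (polyAdj H ^ n) x y ∈ MvPolynomial.supported ℝ (edgesWithin H n x) := by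
  induction n generalizing x with
  | zero =>
    rw [pow_zero, Matrix.one_apply]
    split_ifs
    · exact one_mem _
    · exact zero_mem _
  | succ n ih =>
    rw [pow_succ', Matrix.mul_apply]
    refine sum_mem fun z _ => ?_
    by_cases hz : H.Adj x z
    · rw [polyAdj_apply_of_adj hz]
      refine mul_mem (MvPolynomial.X_mem_supported.2 ⟨hz, x, by simp, Within.refl _ _ _⟩) ?_
      refine MvPolynomial.supported_mono ?_ (ih z)
      rintro e ⟨he, a, ha, hw⟩
      have := (Within.of_adj hz).trans hw
      rw [add_comm] at this
      exact ⟨he, a, ha, this⟩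
    · rw [polyAdj_apply_of_not_adj hz, zero_mul]
      exact zero_mem _

theorem coeff_pow_mem {R A : Type*} [CommRing R] [CommRing A] [Algebra R A] (S : Subalgebra R A)
    (F : PowerSeries A) {n : ℕ} (h : ∀ i ≤ n, PowerSeries.coeff i F ∈ S) (m : ℕ) :
    ∀ i ≤ n, PowerSeries.coeff i (F ^ m) ∈ S := by
  induction m with
  | zero =>
    intro i _
    rw [pow_zero, PowerSeries.coeff_one]
    split_ifs
    · exact one_mem _
    · exact zero_mem _
  | succ m ih =>
    intro i hi
    rw [pow_succ, PowerSeries.coeff_mul]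
    refine sum_mem fun p hp => ?_
    have := mem_antidiagonal.1 hp
    exact mul_mem (ih _ (by omega)) (h _ (by omega))

theorem coeff_walkSeries_pow_mem_supported (H : SimpleGraph V) (n m : ℕ) (v : V) :
    PowerSeries.coeff n (walkSeries (polyAdj H) v v ^ m) ∈
      MvPolynomial.supported ℝ (edgesWithin H n v) := by
  refine coeff_pow_mem _ _ (fun i hi => ?_) m n le_rfl
  rw [walkSeries, PowerSeries.coeff_mk]
  exact MvPolynomial.supported_mono (edgesWithin_mono H hi v) (polyAdj_pow_mem_supported H i v v)

/-- The sequence `b`, placed at the even numbers. -/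
def evenPart (b : ℕ → ℝ) (n : ℕ) : ℝ := if Even n then b (n / 2) else 0

theorem evenPart_two_mul (b : ℕ → ℝ) (k : ℕ) : evenPart b (2 * k) = b k := by
  simp [evenPart]

theorem evenPart_odd (b : ℕ → ℝ) {n : ℕ} (h : ¬ Even n) : evenPart b n = 0 := by
  simp [evenPart, h]

theorem sum_antidiagonal_evenPart (b c : ℕ → ℝ) (n : ℕ) :
    ∑ p ∈ antidiagonal n, evenPart b p.1 * evenPart c p.2 =
      evenPart (fun k => ∑ p ∈ antidiagonal k, b p.1 * c p.2) n := by
  rcases Nat.even_or_odd n with hn | hn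
  · obtain ⟨k, rfl⟩ := even_iff_two_dvd.1 hn
    rw [evenPart_two_mul]
    symm
    refine sum_of_injOn (fun p => (2 * p.1, 2 * p.2)) ?_ ?_ ?_ ?_
    · rintro ⟨a, b⟩ _ ⟨c, d⟩ _ h
      simpa using h
    · rintro ⟨i, j⟩ hp
      have := mem_antidiagonal.1 (mem_coe.1 hp)
      simp only [mem_coe, HasAntidiagonal.mem_antidiagonal]
      simp only at this
      omega
    · rintro ⟨i, j⟩ hp hni
      have hij := mem_antidiagonal.1 hp
      simp only at hij
      by_cases hi : Even i
      · exfalso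
        obtain ⟨i', rfl⟩ := even_iff_two_dvd.1 hi
        refine hni ⟨(i', k - i'), ?_, ?_⟩
        · simp only [mem_coe, HasAntidiagonal.mem_antidiagonal]
          omega
        · simp only [Prod.mk.injEq, true_and]
          omega
      · simp only [evenPart_odd b hi, zero_mul]
    · rintro ⟨i, j⟩ _
      simp only [evenPart_two_mul]
  · rw [evenPart_odd _ (Nat.not_even_iff_odd.2 hn)]
    refine sum_eq_zero fun p hp => ?_
    have hp := mem_antidiagonal.1 hp
    by_cases h1 : Even p.1
    · by_cases h2 : Even p.2
      · exact absurd (hp ▸ h1.add h2) (Nat.not_even_iff_odd.2 hn)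
      · rw [evenPart_odd c h2, mul_zero]
    · rw [evenPart_odd b h1, zero_mul]

theorem walkSeries_polyAdj_of_isolated {H : SimpleGraph V} {v : V}
    (h : (H.neighborSet v).ncard = 0) : walkSeries (polyAdj H) v v = 1 := by
  rw [Set.ncard_eq_zero] at h
  ext1 n
  rw [walkSeries, PowerSeries.coeff_mk, PowerSeries.coeff_one]
  cases n with
  | zero => simp
  | succ n =>
    rw [if_neg (by omega), pow_succ', Matrix.mul_apply]
    refine sum_eq_zero fun z _ => ?_
    rw [polyAdj_apply_of_not_adj, zero_mul]
    intro hz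
    have : z ∈ H.neighborSet v := hz
    rw [h] at this
    exact this

/-- The expected number of weighted closed walks at a vertex near which the graph is a tree. -/
theorem polyExp_coeff_walkSeries (μ : ℕ → ℝ) {d : ℕ} (h D : ℕ) {H : SimpleGraph V} {v : V}
    (hH : IsTreeNear H d D h v) (m n : ℕ) (hn : n ≤ 2 * h) :
    polyExp μ (PowerSeries.coeff n (walkSeries (polyAdj H) v v ^ m)) =
      evenPart (treeCoeff (fun j => μ (2 * j)) d h D m) n := by
  induction h generalizing D H v m n with
  | zero =>
    obtain rfl : n = 0 := by omega
    have h0 : PowerSeries.coeff 0 (walkSeries (polyAdj H) v v ^ m) = 1 := by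
      rw [PowerSeries.coeff_zero_eq_constantCoeff, map_pow,
        ← PowerSeries.coeff_zero_eq_constantCoeff_apply]
      simp [walkSeries]
    rw [h0, polyExp_one]
    simp [evenPart, treeCoeff_order_zero]
  | succ h ih =>
    induction D generalizing H v m n with
    | zero =>
      rw [walkSeries_polyAdj_of_isolated hH.root, one_pow, PowerSeries.coeff_one]
      by_cases hn0 : n = 0
      · subst hn0
        simp [polyExp_one, evenPart, treeCoeff_root_zero]
      · rw [if_neg hn0, map_zero]
        by_cases he : Even n
        · obtain ⟨k, rfl⟩ := even_iff_two_dvd.1 he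
          rw [evenPart_two_mul, treeCoeff_root_zero, if_neg (by omega)]
        · rw [evenPart_odd _ he]
    | succ D ihD =>
      obtain ⟨u, hu⟩ : (H.neighborSet v).Nonempty := by
        rw [← Set.ncard_pos, hH.root]
        omega
      have hvu : H.Adj v u := hu
      set H' := H.deleteEdges {s(v, u)} with hH'
      -- The radius 2h + 1 in `IsTreeNear` is made for this: without the edge, v and u are further
      -- apart than the length n of the walks. No walk of length at most n joins them, and the
      -- closed walks on the two sides use disjoint, hence independent, sets of weights.
      have hno : ¬ Within H' (2 * (h + 1)) v u := not_within_deleteEdges hH.cycles hvu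
      have hroot := hH.delete_root hvu
      have hchild := hH.delete_child hvu
      have hz1 : ∀ i ≤ n, (polyAdj H' ^ i) v u = 0 := fun i hi =>
        polyAdj_pow_eq_zero fun hw => hno (hw.mono le_rfl (by omega))
      have hz2 : ∀ i ≤ n, (polyAdj H' ^ i) u v = 0 := fun i hi =>
        polyAdj_pow_eq_zero fun hw => hno (hw.symm.mono le_rfl (by omega))
      have hX : ∀ i (w : V), Disjoint ({s(v, u)} : Set (Sym2 V)) (edgesWithin H' i w) := by
        intro i w
        rw [Set.disjoint_singleton_left]
        rintro ⟨he, -⟩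
        rw [hH', SimpleGraph.mem_edgeSet, SimpleGraph.deleteEdges_adj] at he
        exact he.2 rfl
      have hterm : ∀ j ∈ range (n / 2), polyExp μ ((m.multichoose (j + 1) : MvPolynomial (Sym2 V) ℝ) *
          (MvPolynomial.X s(v, u) ^ (2 * (j + 1)) * ∑ p ∈ antidiagonal (n - 2 * (j + 1)),
            PowerSeries.coeff p.1 (walkSeries (polyAdj H') v v ^ (m + (j + 1))) *
              PowerSeries.coeff p.2 (walkSeries (polyAdj H') u u ^ (j + 1)))) =
          m.multichoose (j + 1) * μ (2 * (j + 1)) *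
            evenPart (fun k => ∑ p ∈ antidiagonal k,
              treeCoeff (fun j => μ (2 * j)) d (h + 1) D (m + (j + 1)) p.1 *
                treeCoeff (fun j => μ (2 * j)) d h (d - 1) (j + 1) p.2) (n - 2 * (j + 1)) := by
        intro j hj
        rw [mem_range] at hj
        rw [← nsmul_eq_mul, map_nsmul, nsmul_eq_mul, mul_assoc, mul_sum, map_sum,
          ← sum_antidiagonal_evenPart]
        congr 1
        rw [mul_sum]
        refine sum_congr rfl fun p hp => ?_
        have hp := mem_antidiagonal.1 hp
        have m1 := coeff_walkSeries_pow_mem_supported H' p.1 (m + (j + 1)) v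
        have m2 := coeff_walkSeries_pow_mem_supported H' p.2 (j + 1) u
        have hd : Disjoint (edgesWithin H' p.1 v) (edgesWithin H' p.2 u) :=
          disjoint_edgesWithin fun hw => hno (hw.mono le_rfl (by omega))
        have hX12 : Disjoint ({s(v, u)} : Set (Sym2 V))
            (edgesWithin H' p.1 v ∪ edgesWithin H' p.2 u) :=
          Set.disjoint_union_right.2 ⟨hX _ _, hX _ _⟩
        have e1 := polyExp_X_pow_mul_mul μ hX12 hd (k := 2 * (j + 1)) (by omega) m1 m2
        have e3 := ihD hroot (m + (j + 1)) p.1 (by omega)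
        have e4 := ih (d - 1) hchild (j + 1) p.2 (by omega)
        rw [e1, e3, e4]
      rw [polyAdj_eq_add hvu, coeff_walkSeries_pow_add_edge _ _ hz1 hz2, map_add, map_sum,
        sum_congr rfl hterm, ihD hroot _ _ hn]
      by_cases he : Even n
      · obtain ⟨k, rfl⟩ := even_iff_two_dvd.1 he
        rw [evenPart_two_mul, evenPart_two_mul, treeCoeff_succ, step_apply,
          Nat.mul_div_cancel_left k two_pos]
        congr 1
        refine sum_congr rfl fun j _ => ?_
        rw [← Nat.mul_sub, evenPart_two_mul]
      · rw [evenPart_odd _ he, evenPart_odd _ he, zero_add]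
        refine sum_eq_zero fun j hj => ?_
        rw [mem_range] at hj
        rw [evenPart_odd, mul_zero]
        rw [Nat.even_sub (by omega)]
        simpa using he

/-- The expected number of closed walks at a vertex near which the graph is a regular tree. -/
theorem polyExp_closed_walks (μ : ℕ → ℝ) {d : ℕ} {H : SimpleGraph V} {v : V}
    (hd : ∀ x, (H.neighborSet x).ncard = d) {n : ℕ} (hv : NoShortCycle H (2 * n + 1) v) :
    polyExp μ ((polyAdj H ^ n) v v) =
      evenPart (fun k => treeCoeff (fun j => μ (2 * j)) d k d 1 k) n := by
  have h := polyExp_coeff_walkSeries μ (d := d) n d (v := v) ⟨hv, hd v, fun x _ _ => hd x⟩ 1 n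
    (by omega)
  rw [pow_one, walkSeries, PowerSeries.coeff_mk] at h
  rw [h]
  unfold evenPart
  split_ifs
  · exact treeCoeff_congr (fun _ _ _ => rfl) (by omega) le_rfl _ _
  · rfl

/-- A bound for the expected number of weighted closed walks of length `n` in a regular graph. -/
theorem abs_polyExp_closed_walks_le (μ : ℕ → ℝ) {d : ℕ} {H : SimpleGraph V}
    (hd : ∀ x, (H.neighborSet x).ncard = d) {n : ℕ} {K : ℝ} (hK1 : 1 ≤ K)
    (hK : ∀ i ≤ n, |μ i| ≤ K) (v : V) : |polyExp μ ((polyAdj H ^ n) v v)| ≤ d ^ n * K ^ n := by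
  classical
  -- Each entry is a sum of monomials with coefficient 1, one per walk, and there are at most d^i
  -- walks.
  have key : ∀ i (x y : V), ∃ M : Multiset (Sym2 V →₀ ℕ),
      (polyAdj H ^ i) x y = (M.map fun j => MvPolynomial.monomial j (1 : ℝ)).sum ∧
      (∀ j ∈ M, j.degree = i) ∧ Multiset.card M ≤ d ^ i := by
    intro i
    induction i with
    | zero =>
      intro x y
      by_cases hxy : x = y
      · refine ⟨{0}, ?_, by simp, by simp⟩
        subst hxy
        simp
      · exact ⟨0, by simp [hxy], by simp, by simp⟩
    | succ i ih =>
      intro x y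
      choose M hM1 hM2 hM3 using fun z => ih z y
      refine ⟨∑ z ∈ (H.neighborSet x).toFinset, (M z).map fun j => Finsupp.single s(x, z) 1 + j,
        ?_, ?_, ?_⟩
      · rw [pow_succ', Matrix.mul_apply, ← Multiset.coe_mapAddMonoidHom, map_sum,
          ← Multiset.coe_sumAddMonoidHom, map_sum]
        simp only [Multiset.coe_mapAddMonoidHom, Multiset.coe_sumAddMonoidHom]
        rw [← sum_subset (subset_univ (H.neighborSet x).toFinset)]
        · refine sum_congr rfl fun z hz => ?_
          have hz : H.Adj x z := by simpa using hz
          rw [polyAdj_apply_of_adj hz, hM1, Multiset.map_map, ← Multiset.sum_map_mul_left]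
          refine congrArg Multiset.sum (Multiset.map_congr rfl fun j _ => ?_)
          rw [Function.comp_apply, MvPolynomial.X, MvPolynomial.monomial_mul, one_mul]
        · intro z _ hz
          have hz : ¬ H.Adj x z := by simpa using hz
          rw [polyAdj_apply_of_not_adj hz, zero_mul]
      · intro j hj
        rw [Multiset.mem_sum] at hj
        obtain ⟨z, -, hz⟩ := hj
        obtain ⟨j', hj', rfl⟩ := Multiset.mem_map.1 hz
        rw [map_add, hM2 z j' hj', Finsupp.degree_single, add_comm]
      · rw [Multiset.card_sum]
        simp only [Multiset.card_map]
        refine (sum_le_card_nsmul _ _ _ fun z _ => hM3 z).trans ?_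
        rw [← Set.ncard_eq_toFinset_card', hd, smul_eq_mul, pow_succ']
  obtain ⟨M, h1, h2, h3⟩ := key n v v
  rw [h1, map_multiset_sum, Multiset.map_map]
  have hmon : ∀ j ∈ M, |polyExp μ (MvPolynomial.monomial j (1 : ℝ))| ≤ K ^ n := by
    intro j hj
    rw [polyExp_monomial, one_mul, Finsupp.prod, abs_prod, ← h2 j hj, Finsupp.degree_apply,
      ← prod_pow_eq_pow_sum]
    refine prod_le_prod (fun _ _ => abs_nonneg _) fun e he => ?_
    -- K ≥ 1 allows each factor to be bounded by K ≤ K^(j e); the exponents add up to n.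
    have he1 : j e ≠ 0 := Finsupp.mem_support_iff.1 he
    have he2 : j e ≤ n := by
      rw [← h2 j hj]
      exact Finsupp.le_degree e j
    exact (hK _ he2).trans (le_self_pow₀ hK1 he1)
  refine (Multiset.abs_sum_le_sum_abs).trans ?_
  rw [Multiset.map_map]
  refine (Multiset.sum_le_card_nsmul _ (K ^ n) fun r hr => ?_).trans ?_
  · obtain ⟨j, hj, rfl⟩ := Multiset.mem_map.1 hr
    exact hmon j hj
  · rw [Multiset.card_map, nsmul_eq_mul]
    gcongr
    exact_mod_cast h3

end Matrices

end Trees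

/-! ### The averaged spectral measure and its moments -/

section Spectral

variable {N : ℕ} (G : SimpleGraph (Fin N))

theorem trace_pow_eq_sum_eigenvalues {n : Type*} [Fintype n] [DecidableEq n]
    {A : Matrix n n ℝ} (hA : A.IsHermitian) (k : ℕ) :
    (A ^ k).trace = ∑ i, hA.eigenvalues i ^ k := by
  conv_lhs => rw [hA.spectral_theorem, ← map_pow, Unitary.conjStarAlgAut_apply,
    Matrix.trace_mul_comm, ← mul_assoc]
  simp [Matrix.diagonal_pow, Matrix.trace_diagonal]

theorem map_eval_polyAdj (w : Sym2 (Fin N) → ℝ) :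
    (MvPolynomial.eval w).mapMatrix (polyAdj G) = weightedAdjMatrix G w := by
  ext i j
  by_cases h : G.Adj i j <;> simp [polyAdj, weightedAdjMatrix, h]

theorem eval_polyAdj_pow (w : Sym2 (Fin N) → ℝ) (n : ℕ) (i j : Fin N) :
    MvPolynomial.eval w ((polyAdj G ^ n) i j) = (weightedAdjMatrix G w ^ n) i j := by
  rw [← map_eval_polyAdj, ← map_pow]
  rfl

theorem sum_eigenvalues_pow (w : Sym2 (Fin N) → ℝ) (n : ℕ) :
    ∑ i, (weightedAdjMatrix_isHermitian G w).eigenvalues i ^ n =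
      ∑ v, MvPolynomial.eval w ((polyAdj G ^ n) v v) := by
  rw [← trace_pow_eq_sum_eigenvalues]
  simp only [eval_polyAdj_pow]
  rfl

theorem integrable_spectralMeasure (w : Sym2 (Fin N) → ℝ) (hN : N ≠ 0) (f : ℝ → ℝ) :
    Integrable f (spectralMeasure G w) := by
  refine Integrable.smul_measure ?_ (by simp [hN])
  rw [integrable_finsetSum_measure]
  intro i _
  exact integrable_dirac (by simp)

theorem integral_spectralMeasure (w : Sym2 (Fin N) → ℝ) (f : ℝ → ℝ) :
    ∫ x, f x ∂(spectralMeasure G w) =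
      (N : ℝ)⁻¹ * ∑ i, f ((weightedAdjMatrix_isHermitian G w).eigenvalues i) := by
  rw [spectralMeasure, integral_smul_measure,
    integral_finsetSum_measure fun i _ => integrable_dirac (by simp)]
  simp [ENNReal.toReal_inv]

theorem integral_pow_spectralMeasure (w : Sym2 (Fin N) → ℝ) (n : ℕ) :
    ∫ x, x ^ n ∂(spectralMeasure G w) =
      (N : ℝ)⁻¹ * ∑ v, MvPolynomial.eval w ((polyAdj G ^ n) v v) := by
  rw [integral_spectralMeasure, sum_eigenvalues_pow]

theorem isProbabilityMeasure_spectralMeasure (w : Sym2 (Fin N) → ℝ) (hN : N ≠ 0) :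
    IsProbabilityMeasure (spectralMeasure G w) := by
  constructor
  have h1 : (N : ENNReal) ≠ 0 := by exact_mod_cast hN
  simp [spectralMeasure, ENNReal.inv_mul_cancel h1]

theorem measurable_sum_pow_eigenvalues (n : ℕ) : Measurable fun w : Sym2 (Fin N) → ℝ =>
    ∑ i, (weightedAdjMatrix_isHermitian G w).eigenvalues i ^ n := by
  simp only [sum_eigenvalues_pow]
  refine Finset.measurable_sum _ fun v _ => ?_
  exact (MvPolynomial.continuous_eval _).measurable

/-- Measurability of single eigenvalues is avoided. Power sums are traces, hence polynomials in the
weights, and f is a limit of polynomials uniformly approximating it on growing intervals. -/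
theorem measurable_sum_comp_eigenvalues {f : ℝ → ℝ} (hf : Continuous f) :
    Measurable fun w : Sym2 (Fin N) → ℝ =>
      ∑ i, f ((weightedAdjMatrix_isHermitian G w).eigenvalues i) := by
  have hp : ∀ n : ℕ, ∃ p : Polynomial ℝ, ∀ x ∈ Set.Icc (-(n : ℝ)) n,
      |p.eval x - f x| < 1 / ((n : ℝ) + 1) := fun n =>
    exists_polynomial_near_of_continuousOn _ _ f hf.continuousOn _ (by positivity)
  choose p hp using hp
  refine measurable_of_tendsto_metrizable (f := fun n w =>
    ∑ i, (p n).eval ((weightedAdjMatrix_isHermitian G w).eigenvalues i)) (fun n => ?_) ?_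
  · simp only [Polynomial.eval_eq_sum_range]
    simp_rw [Finset.sum_comm (s := Finset.univ), ← Finset.mul_sum]
    exact Finset.measurable_sum _ fun j _ => (measurable_sum_pow_eigenvalues G j).const_mul _
  · rw [tendsto_pi_nhds]
    intro w
    refine tendsto_finsetSum _ fun i _ => ?_
    set x := (weightedAdjMatrix_isHermitian G w).eigenvalues i
    rw [tendsto_iff_norm_sub_tendsto_zero]
    refine squeeze_zero' (Eventually.of_forall fun n => norm_nonneg _) ?_
      tendsto_one_div_add_atTop_nhds_zero_nat
    obtain ⟨m, hm⟩ := exists_nat_ge |x|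
    filter_upwards [eventually_ge_atTop m] with n hn
    refine (hp n x (abs_le.1 (hm.trans ?_))).le
    exact_mod_cast hn

theorem measurable_integral_spectralMeasure {f : ℝ → ℝ} (hf : Continuous f) :
    Measurable fun w => ∫ x, f x ∂(spectralMeasure G w) := by
  simp only [integral_spectralMeasure]
  exact (measurable_sum_comp_eigenvalues G hf).const_mul _

/-- Closed sets form a generating π-system, and their indicators are limits of continuous thickened
indicators. -/
theorem measurable_spectralMeasure : Measurable (spectralMeasure G) := by
  rcases eq_or_ne N 0 with rfl | hN
  · have : spectralMeasure G = fun _ => 0 := by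
      funext w
      simp [spectralMeasure]
    rw [this]
    exact measurable_const
  have := fun w => isProbabilityMeasure_spectralMeasure G w hN
  refine Measurable.measure_of_isPiSystem_of_isProbabilityMeasure
    ((BorelSpace.measurable_eq (α := ℝ)).trans borel_eq_generateFrom_isClosed)
    isPiSystem_isClosed fun F hF => ?_
  have hF : IsClosed F := hF
  have hpos : ∀ n : ℕ, (0 : ℝ) < 1 / ((n : ℝ) + 1) := fun n => by positivity
  have hreal : Measurable fun w => (spectralMeasure G w).real F := by
    refine measurable_of_tendsto_metrizable (f := fun n w =>
      ∫ x, (thickenedIndicator (hpos n) F x : ℝ) ∂(spectralMeasure G w)) (fun n => ?_) ?_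
    · exact measurable_integral_spectralMeasure G (by fun_prop)
    · rw [tendsto_pi_nhds]
      intro w
      exact tendsto_integral_thickenedIndicator_of_isClosed _ hF hpos
        tendsto_one_div_add_atTop_nhds_zero_nat
  have h := hreal.ennreal_ofReal
  have heq : ∀ w, ENNReal.ofReal ((spectralMeasure G w).real F) = spectralMeasure G w F :=
    fun w => ENNReal.ofReal_toReal (measure_ne_top _ _)
  simpa only [heq] using h

/-- The spectral measure averaged over independent weights of law `W`. -/
noncomputable def averagedSpectralMeasure (W : Measure ℝ) : Measure ℝ :=
  (Measure.pi fun _ : Sym2 (Fin N) => W).bind (spectralMeasure G)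

variable {G}

theorem isProbabilityMeasure_averagedSpectralMeasure {W : Measure ℝ} [IsProbabilityMeasure W]
    (hN : N ≠ 0) : IsProbabilityMeasure (averagedSpectralMeasure G W) := by
  have := fun w => isProbabilityMeasure_spectralMeasure G w hN
  exact isProbabilityMeasure_bind (measurable_spectralMeasure G).aemeasurable
    (ae_of_all _ this)

variable (G) in
/-- The spectral measure as a Markov kernel. -/
noncomputable def spectralKernel : Kernel (Sym2 (Fin N) → ℝ) ℝ :=
  ⟨spectralMeasure G, measurable_spectralMeasure G⟩

theorem integral_bind_kernel {α : Type*} [MeasurableSpace α] {m : Measure α} {κ : Kernel α ℝ}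
    {f : ℝ → ℝ} (hf : Integrable f (m.bind κ)) :
    ∫ x, f x ∂(m.bind κ) = ∫ w, (∫ x, f x ∂(κ w)) ∂m := by
  rw [Measure.comp_eq_comp_const_apply] at hf ⊢
  rw [Kernel.integral_comp hf, Kernel.const_apply]

theorem integral_averagedSpectralMeasure {W : Measure ℝ} {f : ℝ → ℝ}
    (hf : Integrable f (averagedSpectralMeasure G W)) :
    ∫ x, f x ∂(averagedSpectralMeasure G W) =
      ∫ w, (∫ x, f x ∂(spectralMeasure G w)) ∂(Measure.pi fun _ : Sym2 (Fin N) => W) :=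
  integral_bind_kernel (κ := spectralKernel G) hf

theorem integrable_pow_averagedSpectralMeasure {W : Measure ℝ} (hW : IsWeightLaw W) (hN : N ≠ 0)
    (n : ℕ) : Integrable (fun x : ℝ => x ^ n) (averagedSpectralMeasure G W) := by
  have := hW.prob
  have heven : ∀ k : ℕ, Integrable (fun x : ℝ => x ^ (2 * k)) (averagedSpectralMeasure G W) := by
    intro k
    refine (Measure.integrable_comp_iff (κ := spectralKernel G) (by fun_prop)).2 ⟨?_, ?_⟩
    · exact ae_of_all _ fun w => integrable_spectralMeasure G w hN _
    · have h1 : ∀ w, ∫ x, ‖x ^ (2 * k)‖ ∂(spectralKernel G w) =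
          (N : ℝ)⁻¹ * ∑ v, MvPolynomial.eval w ((polyAdj G ^ (2 * k)) v v) := by
        intro w
        rw [← integral_pow_spectralMeasure]
        refine integral_congr_ae (ae_of_all _ fun x => ?_)
        exact Real.norm_of_nonneg ((even_two_mul k).pow_nonneg x)
      simp only [h1]
      exact (integrable_finsetSum _ fun v _ => (integral_eval_eq_polyExp hW _).1).const_mul _
  refine Integrable.mono' ((heven n).add (heven 0)) (by fun_prop) (ae_of_all _ fun x => ?_)
  have : |x ^ n| ≤ (x ^ n) ^ 2 + 1 := by
    rw [← sq_abs]
    nlinarith [sq_nonneg (|x ^ n| - 1), abs_nonneg (x ^ n)]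
  simpa [pow_mul, mul_comm 2 n] using this

theorem mom_averagedSpectralMeasure {W : Measure ℝ} (hW : IsWeightLaw W) (hN : N ≠ 0) (n : ℕ) :
    mom (averagedSpectralMeasure G W) n =
      (N : ℝ)⁻¹ * ∑ v, polyExp (mom W) ((polyAdj G ^ n) v v) := by
  rw [mom, integral_averagedSpectralMeasure (integrable_pow_averagedSpectralMeasure hW hN n)]
  simp only [integral_pow_spectralMeasure]
  rw [integral_const_mul, integral_finsetSum _ fun v _ => (integral_eval_eq_polyExp hW _).1]
  simp only [(integral_eval_eq_polyExp hW _).2]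

end Spectral

/-! ### Counting the vertices near short cycles -/

section BadVertices

open Finset

/-- A cycle is a copy of a cycle graph. -/
theorem exists_copy_cycleGraph {V : Type*} {G : SimpleGraph V} {a : V} (p : G.Walk a a)
    (hp : p.IsCycle) : ∃ (f : (SimpleGraph.cycleGraph p.length).Copy G) (i : Fin p.length),
      f i = a := by
  have h3 := hp.three_le_length
  have hlen : p.tail.support.length = p.length := by
    rw [SimpleGraph.Walk.length_support, SimpleGraph.Walk.length_tail_add_one hp.not_nil]
  have hget : ∀ m : Fin p.length, p.getVert (m + 1) = p.tail.getVert m := by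
    intro m
    rw [SimpleGraph.Walk.getVert_tail]
  -- The shift by one places the vertices on `p.tail`, which is a path, so injectivity is immediate.
  -- The base point a is then the last vertex.
  refine ⟨⟨⟨fun n => p.getVert (n + 1), ?_⟩, ?_⟩, ⟨p.length - 1, by omega⟩, ?_⟩
  · intro ⟨x, hx⟩ ⟨y, hy⟩ hab
    have hne : x ≠ y := fun h => hab.ne (by simp [h])
    wlog hle : y < x generalizing x y
    · exact (this y hy x hx hab.symm hne.symm (by omega)).symm
    rcases SimpleGraph.cycleGraph_adj'.1 hab with hab | hab
    · rw [Fin.sub_val_of_le (by simpa using hle.le)] at hab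
      simp only at hab ⊢
      obtain rfl : x = y + 1 := by omega
      exact (p.adj_getVert_succ (by omega)).symm
    · rw [Fin.coe_sub_iff_lt.2 (by simpa using hle)] at hab
      simp only at hab ⊢
      obtain rfl : x = p.length - 1 := by omega
      obtain rfl : y = 0 := by omega
      rw [Nat.sub_add_cancel (by omega), p.getVert_length]
      have := p.adj_getVert_succ (i := 0) (by omega)
      rwa [p.getVert_zero] at this
  · intro m n hmn
    have hpath : p.tail.IsPath := hp.isPath_tail
    simp only [RelHom.coeFn_mk, hget] at hmn
    have hl := SimpleGraph.Walk.length_tail_add_one hp.not_nil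
    exact Fin.ext (hpath.getVert_injOn (by simp; omega) (by simp; omega) hmn)
  · change p.getVert _ = a
    rw [Nat.sub_add_cancel (by omega), p.getVert_length]

variable {N : ℕ}

theorem card_cycle_vertices_le (G : SimpleGraph (Fin N)) (k : ℕ) :
    {x | ∃ c : G.Walk x x, c.IsCycle ∧ c.length = k}.ncard ≤ k * cycleCount k G := by
  classical
  have hsub : {x | ∃ c : G.Walk x x, c.IsCycle ∧ c.length = k} ⊆
      ↑((univ.image (SimpleGraph.Copy.toSubgraph
        (A := SimpleGraph.cycleGraph k) (B := G))).biUnion fun S => S.verts.toFinset) := by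
    rintro x ⟨c, hc, rfl⟩
    obtain ⟨f, i, hi⟩ := exists_copy_cycleGraph c hc
    rw [mem_coe, mem_biUnion]
    refine ⟨f.toSubgraph, mem_image_of_mem _ (mem_univ _), ?_⟩
    rw [Set.mem_toFinset, SimpleGraph.Subgraph.map_verts]
    exact ⟨i, trivial, hi⟩
  refine (Set.ncard_le_ncard hsub (finite_toSet _)).trans ?_
  rw [Set.ncard_coe_finset, mul_comm, cycleCount,
    SimpleGraph.copyCount_eq_card_image_copyToSubgraph]
  refine card_biUnion_le_card_mul _ _ _ fun S hS => ?_
  obtain ⟨f, -, rfl⟩ := mem_image.1 hS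
  rw [← Set.ncard_eq_toFinset_card', SimpleGraph.Subgraph.map_verts]
  refine (Set.ncard_image_le (Set.toFinite _)).trans ?_
  simp [Set.ncard_univ]

theorem card_within_le {G : SimpleGraph (Fin N)} {d : ℕ}
    (hd : ∀ x, (G.neighborSet x).ncard = d) (L : ℕ) (x : Fin N) :
    {y | Within G L x y}.ncard ≤ (d + 1) ^ L := by
  classical
  induction L generalizing x with
  | zero =>
    have : {y | Within G 0 x y} ⊆ {x} := by
      rintro y ⟨p, hp⟩
      exact (SimpleGraph.Walk.eq_of_length_eq_zero (Nat.le_zero.1 hp)).symm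
    simpa using Set.ncard_le_ncard this
  | succ L ih =>
    have hsub : {y | Within G (L + 1) x y} ⊆
        {x} ∪ ↑((G.neighborSet x).toFinset.biUnion fun z => {y | Within G L z y}.toFinset) := by
      rintro y ⟨p, hp⟩
      cases p with
      | nil => exact Or.inl rfl
      | cons h q =>
        refine Or.inr ?_
        rw [mem_coe, mem_biUnion]
        refine ⟨_, by simpa using h, ?_⟩
        rw [Set.mem_toFinset]
        exact ⟨q, by simpa using hp⟩
    refine (Set.ncard_le_ncard hsub (Set.toFinite _)).trans ((Set.ncard_union_le _ _).trans ?_)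
    rw [Set.ncard_singleton, Set.ncard_coe_finset]
    have h1 : ((G.neighborSet x).toFinset.biUnion fun z => {y | Within G L z y}.toFinset).card ≤
        d * (d + 1) ^ L := by
      have := card_biUnion_le_card_mul (G.neighborSet x).toFinset
        (fun z => {y | Within G L z y}.toFinset) ((d + 1) ^ L) fun z _ => by
          rw [← Set.ncard_eq_toFinset_card']
          exact ih z
      rwa [← Set.ncard_eq_toFinset_card', hd] at this
    have h2 : 1 ≤ (d + 1) ^ L := Nat.one_le_pow _ _ (by omega)
    rw [pow_succ]
    linarith

/-- A union bound: a cycle of length k has k vertices, each of which spoils at most (d + 1)^L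
others. -/
theorem card_not_noShortCycle_le {G : SimpleGraph (Fin N)} {d : ℕ}
    (hd : ∀ x, (G.neighborSet x).ncard = d) (L : ℕ) :
    {v | ¬ NoShortCycle G L v}.ncard ≤
      ∑ k ∈ Icc 3 L, k * cycleCount k G * (d + 1) ^ L := by
  classical
  have hsub : {v | ¬ NoShortCycle G L v} ⊆ ↑((Icc 3 L).biUnion fun k =>
      {x | ∃ c : G.Walk x x, c.IsCycle ∧ c.length = k}.toFinset.biUnion fun x =>
        {v | Within G L x v}.toFinset) := by
    intro v hv
    simp only [NoShortCycle, Set.mem_ofPred_eq, not_forall, not_lt] at hv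
    obtain ⟨x, hx, c, hc, hcL⟩ := hv
    rw [mem_coe, mem_biUnion]
    refine ⟨c.length, mem_Icc.2 ⟨hc.three_le_length, hcL⟩, ?_⟩
    rw [mem_biUnion]
    refine ⟨x, ?_, ?_⟩
    · rw [Set.mem_toFinset]
      exact ⟨c, hc, rfl⟩
    · rw [Set.mem_toFinset]
      exact hx.symm
  refine (Set.ncard_le_ncard hsub (finite_toSet _)).trans ?_
  rw [Set.ncard_coe_finset]
  refine card_biUnion_le.trans (sum_le_sum fun k _ => ?_)
  refine (card_biUnion_le_card_mul _ _ ((d + 1) ^ L) fun x _ => ?_).trans ?_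
  · rw [← Set.ncard_eq_toFinset_card']
    exact card_within_le hd L x
  · rw [← Set.ncard_eq_toFinset_card']
    exact Nat.mul_le_mul_right _ (card_cycle_vertices_le G k)

theorem ncard_neighborSet_eq {G : SimpleGraph (Fin N)} [G.LocallyFinite] {d : ℕ}
    (h : G.IsRegularOfDegree d) (x : Fin N) : (G.neighborSet x).ncard = d := by
  rw [Set.ncard_eq_toFinset_card', ← h x]
  rfl

end BadVertices

/-! ### Convergence of the moments of the spectral measures -/

section Moments

variable {d : ℕ} {N : ℕ → ℕ} {G : ∀ i, SimpleGraph (Fin (N i))}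

theorem IsLocallyTreelike.isLittleO_bad (h : IsLocallyTreelike d N G) (L : ℕ) :
    (fun i => ({v | ¬ NoShortCycle (G i) L v}.ncard : ℝ)) =o[atTop] fun i => (N i : ℝ) := by
  classical
  have h1 : (fun i => ∑ k ∈ Finset.Icc 3 L,
      (k * cycleCount k (G i) * (d + 1) ^ L : ℝ)) =o[atTop] fun i => (N i : ℝ) := by
    refine Asymptotics.IsLittleO.fun_sum fun k hk => ?_
    have := ((h.cycles k (Finset.mem_Icc.1 hk).1).const_mul_left (k : ℝ)).const_mul_left
      (((d : ℝ) + 1) ^ L)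
    refine this.congr_left fun i => ?_
    ring
  refine Asymptotics.IsBigO.trans_isLittleO (Asymptotics.IsBigO.of_bound 1
    (Eventually.of_forall fun i => ?_)) h1
  rw [one_mul, Real.norm_of_nonneg (by positivity), Real.norm_of_nonneg (by positivity)]
  have := card_not_noShortCycle_le (fun x => ncard_neighborSet_eq (h.regular i) x) L
  exact_mod_cast this

/-- The moments of the limiting spectral law, in terms of the moments `μ` of the weights. -/
noncomputable def limitMoment (d : ℕ) (μ : ℕ → ℝ) (n : ℕ) : ℝ :=
  evenPart (fun k => treeCoeff (fun j => μ (2 * j)) d k d 1 k) n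

/-- A vertex far from short cycles contributes exactly the tree value. Each of the o(N) others
deviates by at most a constant C. -/
theorem IsLocallyTreelike.tendsto_mom (h : IsLocallyTreelike d N G) {W : Measure ℝ}
    (hW : IsWeightLaw W) (n : ℕ) :
    Tendsto (fun i => mom (averagedSpectralMeasure (G i) W) n) atTop
      (𝓝 (limitMoment d (mom W) n)) := by
  classical
  set t := limitMoment d (mom W) n
  obtain ⟨K, hK1, hK⟩ : ∃ K : ℝ, 1 ≤ K ∧ ∀ i ≤ n, |mom W i| ≤ K := by
    refine ⟨1 + ∑ i ∈ Finset.range (n + 1), |mom W i|, ?_, fun i hi => ?_⟩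
    · have : 0 ≤ ∑ i ∈ Finset.range (n + 1), |mom W i| := Finset.sum_nonneg fun _ _ => abs_nonneg _
      linarith
    · have := Finset.single_le_sum (f := fun i => |mom W i|) (fun _ _ => abs_nonneg _)
        (Finset.mem_range.2 (Nat.lt_succ_of_le hi))
      linarith
  set C : ℝ := d ^ n * K ^ n + |t|
  have hC : 0 ≤ C := by positivity
  have hbad := ((h.isLittleO_bad (2 * n + 1)).const_mul_left C).tendsto_div_nhds_zero
  rw [tendsto_iff_norm_sub_tendsto_zero]
  refine squeeze_zero' (Eventually.of_forall fun i => norm_nonneg _) ?_ hbad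
  filter_upwards [h.size.eventually_ge_atTop 1] with i hi
  have hN : (0 : ℝ) < N i := by exact_mod_cast hi
  have hreg := fun x => ncard_neighborSet_eq (h.regular i) x
  rw [mom_averagedSpectralMeasure hW (by omega), Real.norm_eq_abs]
  have h1 : (N i : ℝ)⁻¹ * ∑ v, polyExp (mom W) ((polyAdj (G i) ^ n) v v) - t =
      (N i : ℝ)⁻¹ * ∑ v, (polyExp (mom W) ((polyAdj (G i) ^ n) v v) - t) := by
    rw [Finset.sum_sub_distrib, Finset.sum_const, Finset.card_univ, Fintype.card_fin, nsmul_eq_mul]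
    field_simp
  rw [h1, abs_mul, abs_of_pos (inv_pos.2 hN), inv_mul_eq_div]
  gcongr
  refine (Finset.abs_sum_le_sum_abs _ _).trans ?_
  have h2 : ∀ v, |polyExp (mom W) ((polyAdj (G i) ^ n) v v) - t| ≤
      if ¬ NoShortCycle (G i) (2 * n + 1) v then C else 0 := by
    intro v
    by_cases hv : NoShortCycle (G i) (2 * n + 1) v
    · rw [if_neg (not_not.2 hv), polyExp_closed_walks (mom W) hreg hv]
      exact (abs_eq_zero.2 (sub_self _)).le
    · rw [if_pos hv]
      have := abs_polyExp_closed_walks_le (mom W) hreg hK1 hK v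
      exact (abs_sub _ _).trans (add_le_add this le_rfl)
  refine (Finset.sum_le_sum fun v _ => h2 v).trans ?_
  rw [← Finset.sum_filter, Finset.sum_const, nsmul_eq_mul, mul_comm, Set.ncard_eq_toFinset_card']
  gcongr
  intro v hv
  simpa using hv

end Moments

/-! ### Regular graphs of large girth -/

section CayleyGraphs

/-- Reduced words of length at most `n` in the free product of `d` groups of order two. -/
def ReducedWord (d n : ℕ) : Type :=
  {l : List (Fin d) // l.IsChain (· ≠ ·) ∧ l.length ≤ n}

instance (d n : ℕ) : Finite (ReducedWord d n) :=
  Set.Finite.subset (List.finite_length_le (Fin d) n) fun _ hl => hl.2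

variable {d n : ℕ}

/-- The empty word. -/
def emptyWord (d n : ℕ) : ReducedWord d n := ⟨[], List.isChain_nil, Nat.zero_le n⟩

/-- Remove the first letter if it is `i`, else add the letter `i` in front if there is room. -/
def letterFun (i : Fin d) (n : ℕ) : List (Fin d) → List (Fin d)
  | [] => if 0 < n then [i] else []
  | j :: t => if j = i then t else if (j :: t).length < n then i :: j :: t else j :: t

theorem letterFun_cons_self (i : Fin d) (n : ℕ) (t : List (Fin d)) :
    letterFun i n (i :: t) = t := by simp [letterFun]

theorem letterFun_of_chain {i : Fin d} {n : ℕ} {t : List (Fin d)}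
    (h : (i :: t).IsChain (· ≠ ·)) (hn : t.length < n) : letterFun i n t = i :: t := by
  cases t with
  | nil => exact if_pos hn
  | cons j s =>
    have hij : j ≠ i := (List.isChain_cons_cons.1 h).1.symm
    simp only [letterFun, if_neg hij, if_pos hn]

theorem letterFun_mem {i : Fin d} {n : ℕ} {l : List (Fin d)}
    (h : l.IsChain (· ≠ ·) ∧ l.length ≤ n) :
    (letterFun i n l).IsChain (· ≠ ·) ∧ (letterFun i n l).length ≤ n := by
  cases l with
  | nil =>
    simp only [letterFun]
    split_ifs with h0
    · exact ⟨List.isChain_singleton _, h0⟩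
    · exact h
  | cons j t =>
    simp only [letterFun]
    split_ifs with h1 h2
    · exact ⟨h.1.tail, (Nat.le_succ _).trans h.2⟩
    · exact ⟨List.isChain_cons_cons.2 ⟨fun h => h1 h.symm, h.1⟩, h2⟩
    · exact h

theorem letterFun_letterFun {i : Fin d} {n : ℕ} {l : List (Fin d)}
    (h : l.IsChain (· ≠ ·) ∧ l.length ≤ n) : letterFun i n (letterFun i n l) = l := by
  cases l with
  | nil =>
    by_cases h0 : 0 < n <;> simp [letterFun, h0]
  | cons j t =>
    by_cases h1 : j = i
    · subst h1
      rw [letterFun_cons_self]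
      exact letterFun_of_chain h.1 h.2
    · by_cases h2 : (j :: t).length < n
      · simp only [letterFun, if_neg h1, if_pos h2, if_true]
      · simp only [letterFun, if_neg h1, if_neg h2]

/-- The involution of the reduced words attached to a letter. -/
def letterPerm (n : ℕ) (i : Fin d) : Equiv.Perm (ReducedWord d n) where
  toFun l := ⟨letterFun i n l.1, letterFun_mem l.2⟩
  invFun l := ⟨letterFun i n l.1, letterFun_mem l.2⟩
  left_inv l := Subtype.ext (letterFun_letterFun l.2)
  right_inv l := Subtype.ext (letterFun_letterFun l.2)

theorem letterPerm_mul_self (n : ℕ) (i : Fin d) : letterPerm n i * letterPerm n i = 1 := by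
  ext1 l
  exact (letterPerm n i).left_inv l

/-- The action recovers a reduced word from the permutation it defines. Hence no nonempty reduced
word of length at most n acts trivially, and the Cayley graph has girth greater than n. -/
theorem prod_letterPerm_emptyWord {l : List (Fin d)} (hl : l.IsChain (· ≠ ·))
    (hn : l.length ≤ n) : ((l.map (letterPerm n)).prod (emptyWord d n)).1 = l := by
  induction l with
  | nil => rfl
  | cons i t ih =>
    have h := ih hl.tail ((Nat.le_succ _).trans hn)
    rw [List.map_cons, List.prod_cons, Equiv.Perm.mul_apply]
    change letterFun i n _ = _
    rw [h]
    exact letterFun_of_chain hl hn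

theorem letterPerm_ne_one (hn : 0 < n) (i : Fin d) : letterPerm n i ≠ 1 := by
  intro h
  have := prod_letterPerm_emptyWord (n := n) (List.isChain_singleton i) hn
  rw [List.map_singleton, List.prod_singleton, h] at this
  exact List.cons_ne_nil _ _ this.symm

theorem letterPerm_injective (hn : 0 < n) : Function.Injective (letterPerm (d := d) n) := by
  intro i j h
  have hi := prod_letterPerm_emptyWord (n := n) (List.isChain_singleton i) hn
  have hj := prod_letterPerm_emptyWord (n := n) (List.isChain_singleton j) hn
  rw [List.map_singleton, List.prod_singleton] at hi hj
  rw [h, hj] at hi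
  exact (List.singleton_inj.1 hi).symm

/-- The Cayley graph of the group of permutations of the reduced words with respect to the
involutions `letterPerm n i`. -/
def letterGraph (d n : ℕ) (hn : 0 < n) : SimpleGraph (Equiv.Perm (ReducedWord d n)) where
  Adj g h := ∃ i, h = g * letterPerm n i
  symm := ⟨by
    rintro g h ⟨i, rfl⟩
    exact ⟨i, by rw [mul_assoc, letterPerm_mul_self, mul_one]⟩⟩
  loopless := ⟨by
    rintro g ⟨i, hi⟩
    exact letterPerm_ne_one hn i (left_eq_mul.1 hi)⟩

theorem ncard_neighborSet_letterGraph (hn : 0 < n) (g : Equiv.Perm (ReducedWord d n)) :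
    ((letterGraph d n hn).neighborSet g).ncard = d := by
  have h : (letterGraph d n hn).neighborSet g = Set.range fun i => g * letterPerm n i := by
    ext h
    exact ⟨fun ⟨i, hi⟩ => ⟨i, hi.symm⟩, fun ⟨i, hi⟩ => ⟨i, hi.symm⟩⟩
  have hinj : Function.Injective fun i : Fin d => g * letterPerm n i :=
    (mul_right_injective g).comp (letterPerm_injective hn)
  rw [h, ← Set.image_univ, Set.ncard_image_of_injective _ hinj, Set.ncard_univ, Nat.card_fin]

/-- A trail never repeats an edge, so consecutive letters differ. The last clause records the first
edge, which the induction needs in order to compare the new letter with the next one. -/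
theorem exists_word_of_isTrail (hn : 0 < n) {g h : Equiv.Perm (ReducedWord d n)}
    (p : (letterGraph d n hn).Walk g h) (hp : p.IsTrail) :
    ∃ l : List (Fin d), l.IsChain (· ≠ ·) ∧ l.length = p.length ∧
      h = g * (l.map (letterPerm n)).prod ∧
      ∀ i ∈ l.head?, s(g, g * letterPerm n i) ∈ p.edges := by
  induction p with
  | nil => exact ⟨[], List.isChain_nil, rfl, by simp, by simp⟩
  | @cons g u h hadj p ih =>
    rw [SimpleGraph.Walk.isTrail_cons] at hp
    obtain ⟨l, h1, h2, h3, h4⟩ := ih hp.1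
    obtain ⟨i, hi⟩ := id hadj
    subst hi
    refine ⟨i :: l, List.isChain_cons.2 ⟨fun j hj hij => ?_, h1⟩, ?_, ?_, ?_⟩
    · subst hij
      have := h4 i hj
      rw [mul_assoc, letterPerm_mul_self, mul_one, Sym2.eq_swap] at this
      exact hp.2 this
    · rw [List.length_cons, SimpleGraph.Walk.length_cons, h2]
    · rw [h3, List.map_cons, List.prod_cons, mul_assoc]
    · intro j hj
      obtain rfl : i = j := by simpa using hj
      rw [SimpleGraph.Walk.edges_cons]
      exact List.mem_cons_self

theorem lt_length_of_isCycle_letterGraph (hn : 0 < n) {g : Equiv.Perm (ReducedWord d n)}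
    (p : (letterGraph d n hn).Walk g g) (hp : p.IsCycle) : n < p.length := by
  by_contra hlt
  obtain ⟨l, h1, h2, h3, -⟩ := exists_word_of_isTrail hn p hp.isTrail
  have h4 := prod_letterPerm_emptyWord h1 (h2.le.trans (not_lt.1 hlt))
  rw [left_eq_mul.1 h3] at h4
  have h5 : l = [] := h4.symm
  have := hp.three_le_length
  rw [← h2, h5] at this
  simp at this

/-- The word of length `k` in which the letters `a` and `b` alternate. -/
def alternatingWord {α : Type*} (a b : α) : ℕ → List α
  | 0 => []
  | k + 1 => a :: alternatingWord b a k

theorem length_alternatingWord {α : Type*} (a b : α) (k : ℕ) :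
    (alternatingWord a b k).length = k := by
  induction k generalizing a b with
  | zero => rfl
  | succ k ih => rw [alternatingWord, List.length_cons, ih]

theorem isChain_alternatingWord {α : Type*} {a b : α} (hab : a ≠ b) (k : ℕ) :
    (alternatingWord a b k).IsChain (· ≠ ·) := by
  induction k generalizing a b with
  | zero => exact List.isChain_nil
  | succ k ih =>
    refine List.isChain_cons.2 ⟨fun c hc => ?_, ih hab.symm⟩
    cases k with
    | zero => simp [alternatingWord] at hc
    | succ k =>
      obtain rfl : b = c := by simpa [alternatingWord] using hc
      exact hab

/-- Two letters already give n + 1 reduced words, the alternating ones of lengths 0 to n. -/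
theorem lt_card_perm_reducedWord (hd : 2 ≤ d) (n : ℕ) :
    n < Nat.card (Equiv.Perm (ReducedWord d n)) := by
  have hab : (⟨0, by omega⟩ : Fin d) ≠ ⟨1, by omega⟩ := by simp
  let f : Fin (n + 1) → ReducedWord d n := fun k =>
    ⟨alternatingWord ⟨0, by omega⟩ ⟨1, by omega⟩ k, isChain_alternatingWord hab k, by
      rw [length_alternatingWord]; omega⟩
  have hf : Function.Injective f := by
    intro j k h
    have := congrArg (fun l : ReducedWord d n => l.1.length) h
    simp only [f, length_alternatingWord] at this
    exact Fin.ext this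
  have h1 := Nat.card_le_card_of_injective f hf
  rw [Nat.card_fin] at h1
  rw [Nat.card_perm]
  exact h1.trans (Nat.self_le_factorial _)

/-- Without such a sequence `IsLimitingSpectralLaw` would hold vacuously and uniqueness would fail.
The number of k-cycles is in fact eventually 0 here. -/
theorem exists_isLocallyTreelike (hd : 2 ≤ d) :
    ∃ (N : ℕ → ℕ) (G : ∀ i, SimpleGraph (Fin (N i))), IsLocallyTreelike d N G := by
  classical
  let Γ : ℕ → Type := fun i => Equiv.Perm (ReducedWord d (i + 1))
  let e : ∀ i, Γ i ≃ Fin (Nat.card (Γ i)) := fun i => Finite.equivFin (Γ i)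
  refine ⟨fun i => Nat.card (Γ i),
    fun i => (letterGraph d (i + 1) i.succ_pos).comap (e i).symm, ?_, ?_, ?_⟩
  · intro i x
    refine Eq.trans ?_ (ncard_neighborSet_letterGraph i.succ_pos ((e i).symm x))
    rw [SimpleGraph.degree, ← Set.ncard_coe_finset, SimpleGraph.coe_neighborFinset,
      ← Set.ncard_image_of_injective _ (e i).symm.injective]
    congr 1
    ext y
    constructor
    · rintro ⟨z, hz, rfl⟩
      exact hz
    · intro hy
      exact ⟨e i y, by simpa using hy, by simp⟩
  · refine tendsto_atTop_mono (fun i => ?_) tendsto_id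
    exact (Nat.le_succ i).trans (lt_card_perm_reducedWord hd (i + 1)).le
  · intro k hk
    refine (Asymptotics.isLittleO_zero _ _).congr' ?_ EventuallyEq.rfl
    filter_upwards [eventually_ge_atTop k] with i hi
    symm
    rw [Nat.cast_eq_zero, cycleCount, SimpleGraph.copyCount_eq_zero]
    intro hcopy
    obtain ⟨v, p, hp, hpk⟩ := (SimpleGraph.cycleGraph_isContained_iff hk).1 hcopy
    let φ := SimpleGraph.Hom.comap (e i).symm (letterGraph d (i + 1) i.succ_pos)
    have hφ : Function.Injective φ := (e i).symm.injective
    have := lt_length_of_isCycle_letterGraph i.succ_pos (p.map φ)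
      ((SimpleGraph.Walk.isCycle_map_iff_of_injective hφ).2 hp)
    rw [SimpleGraph.Walk.length_map, hpk] at this
    omega

end CayleyGraphs

/-! ### Rescaled weight laws -/

section Rescaling

variable {r : ℝ} {W : Measure ℝ}

theorem isWeightLaw_rescale (r : ℝ) (hW : IsWeightLaw W) : IsWeightLaw (rescale r W) := by
  have := hW.prob
  have hm : Measurable fun x : ℝ => x / r := by fun_prop
  refine ⟨Measure.isProbabilityMeasure_map hm.aemeasurable, fun k => ?_⟩
  rw [rescale, integrable_map_measure (by fun_prop) hm.aemeasurable]
  simpa only [Function.comp_def, div_pow] using (hW.finite_moments k).div_const (r ^ k)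

theorem mom_rescale (r : ℝ) (W : Measure ℝ) (n : ℕ) : mom (rescale r W) n = mom W n / r ^ n := by
  have hm : Measurable fun x : ℝ => x / r := by fun_prop
  rw [mom, rescale, integral_map hm.aemeasurable (by fun_prop), mom, ← integral_div]
  simp only [div_pow]

theorem IsWeightLaw.mom_zero (hW : IsWeightLaw W) : mom W 0 = 1 := by
  have := hW.prob
  simp [mom]

end Rescaling

/-! ### Existence and uniqueness of the eigendistribution -/

section Limits

variable {d : ℕ} {N : ℕ → ℕ} {G : ∀ i, SimpleGraph (Fin (N i))}

theorem IsLocallyTreelike.shift (h : IsLocallyTreelike d N G) (m : ℕ) :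
    IsLocallyTreelike d (fun i => N (i + m)) (fun i => G (i + m)) where
  regular i := h.regular (i + m)
  size := h.size.comp (tendsto_add_atTop_nat m)
  cycles k hk := (h.cycles k hk).comp_tendsto (tendsto_add_atTop_nat m)

theorem IsLocallyTreelike.exists_forall_ne_zero (h : IsLocallyTreelike d N G) :
    ∃ m, ∀ i, N (i + m) ≠ 0 := by
  obtain ⟨m, hm⟩ := eventually_atTop.1 (h.size.eventually_ge_atTop 1)
  exact ⟨m, fun i => (Nat.lt_of_lt_of_le Nat.zero_lt_one (hm _ (Nat.le_add_left m i))).ne'⟩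

theorem exists_isLocallyTreelike_ne_zero (hd : 2 ≤ d) :
    ∃ (N : ℕ → ℕ) (G : ∀ i, SimpleGraph (Fin (N i))),
      IsLocallyTreelike d N G ∧ ∀ i, N i ≠ 0 := by
  obtain ⟨N, G, h⟩ := exists_isLocallyTreelike hd
  obtain ⟨m, hm⟩ := h.exists_forall_ne_zero
  exact ⟨_, _, h.shift m, hm⟩

theorem limitMoment_two_mul (d : ℕ) (μ : ℕ → ℝ) (k : ℕ) :
    limitMoment d μ (2 * k) = treeCoeff (fun j => μ (2 * j)) d k d 1 k :=
  evenPart_two_mul _ _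

theorem limitMoment_two (d : ℕ) (μ : ℕ → ℝ) : limitMoment d μ 2 = d * μ 2 := by
  have h := limitMoment_two_mul d μ 1
  rw [treeCoeff_one_one] at h
  simpa using h

/-- The moments of the limiting spectral law are those of some distribution. -/
theorem exists_isWeightLaw_limitMoment (hd : 2 ≤ d) {W : Measure ℝ} (hW : IsWeightLaw W) :
    ∃ V, IsWeightLaw V ∧ ∀ n, mom V n = limitMoment d (mom W) n / √d ^ n := by
  obtain ⟨N, G, h, hN⟩ := exists_isLocallyTreelike_ne_zero hd
  have := hW.prob
  have := fun i => isProbabilityMeasure_averagedSpectralMeasure (G := G i) (W := W) (hN i)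
  obtain ⟨V, hV, hmom⟩ := exists_measure_of_tendsto_moments
    (fun i => integrable_pow_averagedSpectralMeasure (G := G i) hW (hN i)) (h.tendsto_mom hW)
  exact ⟨rescale √d V, isWeightLaw_rescale _ hV, fun n => by rw [mom_rescale, hmom]⟩

theorem sqrt_pow_two_mul (d k : ℕ) : √(d : ℝ) ^ (2 * k) = d ^ k := by
  rw [pow_mul, Real.sq_sqrt (Nat.cast_nonneg d)]

/-- The distribution with the fixed sequence as its even moments. -/
theorem exists_isWeightLaw_fixedSeq (hd : 2 ≤ d) :
    ∃ V, IsWeightLaw V ∧ ∀ n, mom V n = evenPart (fixedSeq d) n := by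
  choose F hF using fun W : {W : Measure ℝ // IsWeightLaw W} =>
    exists_isWeightLaw_limitMoment hd W.2
  let S : {W : Measure ℝ // IsWeightLaw W} → {W : Measure ℝ // IsWeightLaw W} :=
    fun W => ⟨F W, (hF W).1⟩
  -- The starting law matters only through its second moment 1/4, which the rescaled map preserves.
  have h0 : IsWeightLaw (Measure.dirac (1 / 2 : ℝ)) :=
    ⟨inferInstance, fun k => integrable_dirac enorm_lt_top⟩
  let Z : ℕ → {W : Measure ℝ // IsWeightLaw W} := fun n => S^[n] ⟨_, h0⟩
  have hZ : ∀ n k, mom (Z (n + 1)).1 k = limitMoment d (mom (Z n).1) k / √d ^ k := by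
    intro n k
    have : Z (n + 1) = S (Z n) := Function.iterate_succ_apply' _ _ _
    rw [this]
    exact (hF (Z n)).2 k
  have hd0 : (d : ℝ) ≠ 0 := by positivity
  have hb1 : ∀ n, mom (Z n).1 (2 * 1) = 1 / 4 := by
    intro n
    induction n with
    | zero =>
      change mom (Measure.dirac (1 / 2 : ℝ)) 2 = 1 / 4
      rw [mom, integral_dirac]
      norm_num
    | succ n ih =>
      rw [hZ, sqrt_pow_two_mul, mul_one, limitMoment_two, pow_one,
        mul_div_cancel_left₀ _ hd0]
      exact ih
  have hb : ∀ n k, (d : ℝ) ^ k * mom (Z (n + 1)).1 (2 * k) =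
      treeCoeff (fun j => mom (Z n).1 (2 * j)) d k d 1 k := by
    intro n k
    rw [hZ, sqrt_pow_two_mul, limitMoment_two_mul, mul_div_cancel₀ _ (pow_ne_zero k hd0)]
  have hlim := tendsto_fixedSeq (b := fun n k => mom (Z n).1 (2 * k)) hd
    (fun n => (Z n).2.mom_zero) hb1 hb
  have := fun n => (Z (n + 1)).2.prob
  -- The sequence starts at Z 1 because the point mass Z 0 has nonzero odd moments; one application
  -- of the map removes them.
  refine exists_measure_of_tendsto_moments (ν := fun n => (Z (n + 1)).1)
    (fun n => (Z (n + 1)).2.finite_moments) fun n => ?_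
  by_cases hn : Even n
  · obtain ⟨k, rfl⟩ := even_iff_two_dvd.1 hn
    rw [evenPart_two_mul]
    exact (tendsto_add_atTop_iff_nat 1).2 (hlim k)
  · rw [evenPart_odd _ hn]
    refine tendsto_const_nhds.congr fun i => ?_
    rw [hZ, limitMoment, evenPart_odd _ hn, zero_div]

/-- Since (k!)² ≤ (2k)!, the growth bound takes the form required for determinacy. -/
theorem fixedSeq_le_factorial (hd : 2 ≤ d) (k : ℕ) :
    fixedSeq d k ≤ (8 * d ^ 2 : ℝ) ^ k * (2 * k).factorial := by
  have hd1 : (1 : ℝ) ≤ 8 * d ^ 2 := by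
    have : (2 : ℝ) ≤ d := by exact_mod_cast hd
    nlinarith
  rcases Nat.eq_zero_or_pos k with rfl | hk
  · simp [fixedSeq_zero]
  · refine (fixedSeq_le hd hk).trans ?_
    rw [mul_comm]
    have h1 : (k.factorial : ℝ) ^ 2 ≤ (2 * k).factorial := by
      have := Nat.le_of_dvd (Nat.factorial_pos _) (Nat.factorial_mul_factorial_dvd_factorial_add k k)
      rw [← sq, ← two_mul] at this
      exact_mod_cast this
    have h2 : (8 * d ^ 2 : ℝ) ^ (k - 1) ≤ (8 * d ^ 2 : ℝ) ^ k :=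
      pow_le_pow_right₀ hd1 (Nat.sub_le k 1)
    gcongr

variable {W : Measure ℝ}

theorem limitMoment_of_mom_eq (hd : 2 ≤ d) (hmom : ∀ n, mom W n = evenPart (fixedSeq d) n)
    (n : ℕ) : limitMoment d (mom W) n = √d ^ n * mom W n := by
  rw [hmom]
  by_cases hn : Even n
  · obtain ⟨k, rfl⟩ := even_iff_two_dvd.1 hn
    simp only [limitMoment_two_mul, hmom, evenPart_two_mul]
    rw [sqrt_pow_two_mul]
    exact fixedSeq_spec hd k
  · rw [limitMoment, evenPart_odd _ hn, evenPart_odd _ hn, mul_zero]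

theorem isEigendistribution_of_mom_eq (hd : 2 ≤ d) (hW : IsWeightLaw W)
    (hmom : ∀ n, mom W n = evenPart (fixedSeq d) n) : IsEigendistribution d W := by
  have hd0 : (0 : ℝ) < √d := Real.sqrt_pos.2 (by positivity)
  -- `rescale r` divides by r, so the n-th moment is multiplied by √d^n. The first graphs are
  -- dropped below because they may have no vertices, and then no probability measure.
  refine ⟨hW, (√d)⁻¹, inv_pos.2 hd0, fun N G h f => ?_⟩
  obtain ⟨m, hm⟩ := h.exists_forall_ne_zero
  rw [← tendsto_add_atTop_iff_nat m]
  have := hW.prob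
  have := fun i => isProbabilityMeasure_averagedSpectralMeasure (G := G (i + m)) (W := W) (hm i)
  have hV : ∀ n, mom (rescale (√d)⁻¹ W) n = limitMoment d (mom W) n := by
    intro n
    rw [mom_rescale, limitMoment_of_mom_eq hd hmom, inv_pow, div_inv_eq_mul, mul_comm]
  have hlim := tendsto_integral_of_tendsto_moments
    (fun i => integrable_pow_averagedSpectralMeasure (G := G (i + m)) hW (hm i))
    (isWeightLaw_rescale (√d)⁻¹ hW) (A := 1) (B := d * (8 * d ^ 2)) (by positivity) (fun k => ?_)
    (fun n => by rw [hV]; exact (h.shift m).tendsto_mom hW n) f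
  · refine hlim.congr fun i => ?_
    exact integral_averagedSpectralMeasure (f.integrable _)
  · rw [hV, limitMoment_of_mom_eq hd hmom, hmom, evenPart_two_mul, sqrt_pow_two_mul, one_mul,
      mul_pow, mul_assoc]
    have := fixedSeq_le_factorial hd k
    gcongr

/-- The second moments give r⁻² = d. The remaining even moments then satisfy the fixed-point
equation, and the odd ones vanish with those of the limit. -/
theorem mom_eq_of_isEigendistribution (hd : 2 ≤ d) (hW : IsEigendistribution d W)
    (h2 : mom W 2 = 1 / 4) (n : ℕ) : mom W n = evenPart (fixedSeq d) n := by
  obtain ⟨hW, r, hr, hlaw⟩ := hW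
  obtain ⟨N, G, h, hN⟩ := exists_isLocallyTreelike_ne_zero hd
  have := hW.prob
  have := fun i => isProbabilityMeasure_averagedSpectralMeasure (G := G i) (W := W) (hN i)
  have := (isWeightLaw_rescale r hW).prob
  have hmom := (moments_of_tendsto (V := rescale r W)
    (fun i => integrable_pow_averagedSpectralMeasure (G := G i) hW (hN i)) (h.tendsto_mom hW)
    (fun f => (hlaw N G h f).congr fun i =>
      (integral_averagedSpectralMeasure (f.integrable _)).symm)).2
  simp only [mom_rescale] at hmom
  have hr2 : (r ^ 2)⁻¹ = d := by
    have := hmom 2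
    rw [limitMoment_two, h2] at this
    rw [inv_eq_one_div]
    field_simp at this ⊢
    linarith
  have heven : ∀ k, treeCoeff (fun j => mom W (2 * j)) d k d 1 k = d ^ k * mom W (2 * k) := by
    intro k
    rw [← limitMoment_two_mul, ← hmom, ← hr2, div_eq_inv_mul, pow_mul, inv_pow]
  have hfix : (fun j => mom W (2 * j)) = fixedSeq d := eq_fixedSeq hd hW.mom_zero h2 heven
  by_cases hn : Even n
  · obtain ⟨k, rfl⟩ := even_iff_two_dvd.1 hn
    rw [evenPart_two_mul, ← hfix]
  · have := hmom n
    rw [limitMoment, evenPart_odd _ hn] at this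
    rw [evenPart_odd _ hn]
    exact (div_eq_zero_iff.1 this).resolve_right (pow_ne_zero n hr.ne')

/-- The normalised eigendistribution (for `d ≥ 2`). -/
theorem exists_eigendistribution (hd : 2 ≤ d) : ∃ V : Measure ℝ,
    (∀ n, mom V n = evenPart (fixedSeq d) n) ∧
      ∀ W : Measure ℝ, (IsEigendistribution d W ∧ mom W 2 = 1 / 4) ↔ W = V := by
  obtain ⟨V, hV, hmom⟩ := exists_isWeightLaw_fixedSeq hd
  refine ⟨V, hmom, fun W => ⟨fun ⟨hW, h2⟩ => ?_, ?_⟩⟩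
  · have := hV.prob
    have := hW.1.prob
    have hW' := mom_eq_of_isEigendistribution hd hW h2
    refine eq_of_moments_eq hW.1.finite_moments hV.finite_moments (A := 1) (B := 8 * d ^ 2)
      (by positivity) (fun k => ?_) fun n => by rw [hW', hmom]
    rw [hW', evenPart_two_mul, one_mul]
    exact fixedSeq_le_factorial hd k
  · rintro rfl
    refine ⟨isEigendistribution_of_mom_eq hd hV hmom, ?_⟩
    have := hmom (2 * 1)
    rwa [evenPart_two_mul, fixedSeq_one] at this

end Limits

end RegularSpectra

/-! ### Assembly of the theorem -/

theorem theorem1p2 :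
    ∃ 𝒲 : ℕ → Measure ℝ,
      (∀ d : ℕ, 2 ≤ d →
        (∀ W : Measure ℝ,
          (RegularSpectra.IsEigendistribution d W ∧ RegularSpectra.mom W 2 = 1 / 4) ↔ W = 𝒲 d) ∧
        (∀ k : ℕ, RegularSpectra.mom (𝒲 d) (2 * k + 1) = 0) ∧
        (RegularSpectra.mom (𝒲 d) 2 = 1 / 4 ∧
          RegularSpectra.mom (𝒲 d) 4 = 1 / 8 ∧
          RegularSpectra.mom (𝒲 d) 6 = 5 / 64) ∧
        RegularSpectra.mom (𝒲 d) 8 = 7 / 128 + 1 / (128 * ((d : ℝ) ^ 2 + (d : ℝ) + 1)) ∧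
        RegularSpectra.mom (𝒲 d) 8 ≠ RegularSpectra.mom RegularSpectra.semicircle 8 ∧
        𝒲 d ≠ RegularSpectra.semicircle) ∧
      (∀ k : ℕ, ∃ C : ℝ, ∀ d : ℕ, 2 ≤ d →
        |RegularSpectra.mom (𝒲 d) (2 * k) - RegularSpectra.mom RegularSpectra.semicircle (2 * k)|
          ≤ C / (d : ℝ) ^ 2) ∧
      (RegularSpectra.mom RegularSpectra.semicircle 2 = 1 / 4 ∧
        RegularSpectra.mom RegularSpectra.semicircle 4 = 1 / 8 ∧
        RegularSpectra.mom RegularSpectra.semicircle 6 = 5 / 64 ∧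
        RegularSpectra.mom RegularSpectra.semicircle 8 = 7 / 128) := by
  have hex : ∀ d : ℕ, ∃ V : Measure ℝ, 2 ≤ d →
      (∀ n, RegularSpectra.mom V n = RegularSpectra.evenPart (RegularSpectra.fixedSeq d) n) ∧
        ∀ W : Measure ℝ,
          (RegularSpectra.IsEigendistribution d W ∧ RegularSpectra.mom W 2 = 1 / 4) ↔ W = V := by
    intro d
    by_cases hd : 2 ≤ d
    · obtain ⟨V, hV⟩ := RegularSpectra.exists_eigendistribution hd
      exact ⟨V, fun _ => hV⟩
    -- A default value for d < 2, about which nothing is claimed.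
    · exact ⟨0, fun h => absurd h hd⟩
  choose 𝒲 h𝒲 using hex
  have heven : ∀ d, 2 ≤ d → ∀ k,
      RegularSpectra.mom (𝒲 d) (2 * k) = RegularSpectra.fixedSeq d k := fun d hd k => by
    rw [(h𝒲 d hd).1, RegularSpectra.evenPart_two_mul]
  obtain ⟨s2, s4, s6, s8⟩ := RegularSpectra.mom_semicircle_small
  refine ⟨𝒲, fun d hd => ?_, fun k => ?_, s2, s4, s6, s8⟩
  · have h8 : RegularSpectra.mom (𝒲 d) 8 = 7 / 128 + 1 / (128 * ((d : ℝ) ^ 2 + (d : ℝ) + 1)) :=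
      (heven d hd 4).trans (RegularSpectra.fixedSeq_four hd)
    have hne : RegularSpectra.mom (𝒲 d) 8 ≠ RegularSpectra.mom RegularSpectra.semicircle 8 := by
      have : (0 : ℝ) < 1 / (128 * ((d : ℝ) ^ 2 + (d : ℝ) + 1)) := by positivity
      rw [h8, s8]
      linarith
    refine ⟨(h𝒲 d hd).2, fun k => ?_, ⟨(heven d hd 1).trans (RegularSpectra.fixedSeq_one d),
      (heven d hd 2).trans (RegularSpectra.fixedSeq_two hd),
      (heven d hd 3).trans (RegularSpectra.fixedSeq_three hd)⟩, h8, hne,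
      fun h => hne (by rw [h])⟩
    rw [(h𝒲 d hd).1, RegularSpectra.evenPart_odd _ (by simp)]
  · obtain ⟨B, hB⟩ := RegularSpectra.fixedSeq_asymptotics k
    refine ⟨B, fun d hd => ?_⟩
    rw [heven d hd, RegularSpectra.mom_semicircle]
    exact hB d hd
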